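/- **Models.** Let $n\ge 1$ and $1\le k\le n$ be integers, $[n]=\{1,\dots,n\}$, $q\in(0,1/2]$ and $\lambda\in[0,1-q]$. A latent assignment $z\in[n]^n$ is either uniform on $[n]^n$ (independent sampling, "I") or a uniform permutation of $[n]$ (permutation sampling, "P"). Conditionally on $z$, one observes a simple graph on $[n]$ in which the edges $\{i,j\}$, $i<j$, are present independently with probability $q+\Theta_{z_iz_j}$; $Y_{ij}=Y_{ji}$ denotes the indicator of the edge $\{i,j\}$ minus $q$. The matrix $\Theta$ is one of - (HS) $\Theta_{ij}=\lambda\mathbf 1\{i\le k\}\mathbf 1\{j\le k\}$; - (SBM) $\Theta_{ij}=\lambda\mathbf 1\{\lceil i/k\rceil=\lceil j/k\rceil\}$, where $k$ divides $n$; - (TS) $\Theta_{ij}=\lambda\mathbf 1\{|i-j|\le k/2\}$, where $k$ is even. This gives six models (HS-I), (SBM-I), (TS-I), (HS-P), (SBM-P), (TS-P). $\mathbb E$ denotes the expectation in the model under consideration. **Rooted basis.** A template is a finite simple graph $G=(V,E)$ with vertex set $V=\{v_1,\dots,v_r\}$, $r\ge 2$, at least one edge, and no isolated vertex except possibly $v_1,v_2$.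 Two templates are equivalent if there is a graph isomorphism between them that maps $v_1$ to $v_1$ and $v_2$ to $v_2$. $\mathcal G^{(1,2)}_{\le D}$ is a maximum collection of pairwise non-equivalent templates with at most $D$ edges. $\Pi^{(1,2)}_V$ is the set of injective maps $\pi:V\to[n]$ with $\pi(v_1)=1$ and $\pi(v_2)=2$. For a graph $H$ with edge set $E(H)$ and vertices in $V$, let $P_{H,\pi}=\prod_{\{u,v\}\in E(H)}Y_{\pi(u)\pi(v)}$. If $G_1,\dots,G_m$ are the connected components of $G$ with at least two vertices, let $$\overline P^{(1,2)}_{G}=\sum_{\pi\in\Pi^{(1,2)}_V}\ \prod_{l=1}^{m}\bigl(P_{G_l,\pi}-\mathbb E[P_{G_l,\pi}]\bigr),\qquad \Psi^{(1,2)}_G=\frac{\overline P^{(1,2)}_G}{\sqrt{\mathbb V^{(1,2)}(G)}},$$ $$\mathbb V^{(1,2)}(G)=\frac{(n-2)!}{(n-|V|)!}\,\bigl|\mathrm{Aut}^{(1,2)}(G)\bigr|\,\bigl(q(1-q)\bigr)^{|E|},$$ where $\mathrm{Aut}^{(1,2)}(G)$ is the set of automorphisms of $G$ that fix $v_1$ and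 $v_2$. **Theorem.** There exist positive numerical constants $c_0$ and $c$ such that the following holds for every integer $D\ge2$ and for all six models. If $$\frac kn\ \vee\ \frac{\lambda k}{\sqrt{nq}}\ \vee\ \frac{\lambda}{q}\ \le\ D^{-c_0},$$ then, for every real vector $\alpha=(\alpha_\emptyset,(\alpha_G)_{G\in\mathcal G^{(1,2)}_{\le D}})$, $$(1-cD^{-2})\|\alpha\|_2^2\ \le\ \mathbb E\Bigl[\Bigl(\alpha_\emptyset+\sum_{G\in\mathcal G^{(1,2)}_{\le D}}\alpha_G\Psi^{(1,2)}_G\Bigr)^2\Bigr]\ \le\ (1+cD^{-2})\|\alpha\|_2^2 .$$ Equivalently, the Gram matrix of $(1,(\Psi^{(1,2)}_G)_{G\in\mathcal G^{(1,2)}_{\le D}})$ is within $cD^{-2}$ of the identity in operator norm. -/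

import Mathlib

open scoped BigOperators

namespace LatentGraph

/-! ### The six latent structure random graph models -/

/-- The three structures: hidden subclique, stochastic block model, Toeplitz seriation. -/
inductive Model where
  | HS
  | SBM
  | TS

/-- The two sampling schemes for the latent assignment. -/
inductive Sampling where
  | independent
  | permutation

/-- Standing arithmetic restriction of each structure: `n / k` is an integer for the block model,
`k` is even for Toeplitz seriation, and there is none for the hidden subclique. -/
def Model.Admissible (m : Model) (n k : ℕ) : Prop :=
  match m with
  | .HS => True
  | .SBM => k ∣ n
  | .TS => Even k

/-- The relation "`Θ i j` equals the signal" on labels. The label `i : Fin n` stands for the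
integer `i + 1` of `{1, …, n}`. -/
def Model.Linked (m : Model) {n : ℕ} (k : ℕ) (i j : Fin n) : Prop :=
  match m with
  | .HS => (i : ℕ) + 1 ≤ k ∧ (j : ℕ) + 1 ≤ k
  | .SBM => ⌈(((i : ℕ) + 1 : ℕ) : ℝ) / (k : ℝ)⌉ = ⌈(((j : ℕ) + 1 : ℕ) : ℝ) / (k : ℝ)⌉
  | .TS => |((i : ℕ) : ℝ) - ((j : ℕ) : ℝ)| ≤ (k : ℝ) / 2

open Classical in
/-- The signal matrix `Θ`, with entries in `{0, lam}`. -/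
noncomputable def Model.Theta (m : Model) {n : ℕ} (k : ℕ) (lam : ℝ) (i j : Fin n) : ℝ :=
  if m.Linked k i j then lam else 0

open Classical in
/-- The set on which the latent assignment `z` is uniform: all maps from nodes to labels
(the coordinates are then independent and uniform), or all bijections. -/
noncomputable def Sampling.latents (s : Sampling) (n : ℕ) : Finset (Fin n → Fin n) :=
  match s with
  | .independent => Finset.univ
  | .permutation => Finset.univ.filter fun z => Function.Bijective z

/-- The conditional probability, given the assignment `z`, that the observed graph is `A`:
the pairs `i < j` are independent edges with probability `q + Θ (z i) (z j)`. -/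
noncomputable def condProb (m : Model) {n : ℕ} (k : ℕ) (lam q : ℝ) (z : Fin n → Fin n)
    (A : SimpleGraph (Fin n)) : ℝ :=
  open Classical in
  ∏ p ∈ (Finset.univ : Finset (Fin n × Fin n)).filter (fun p => p.1 < p.2),
    if A.Adj p.1 p.2 then q + m.Theta k lam (z p.1) (z p.2)
    else 1 - q - m.Theta k lam (z p.1) (z p.2)

/-- The expectation of a function `f` of the observed graph: `z` is uniform on `s.latents n`, and
the graph is drawn from `condProb` given `z`. -/
noncomputable def expect (m : Model) (s : Sampling) (n k : ℕ) (lam q : ℝ)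
    (f : SimpleGraph (Fin n) → ℝ) : ℝ :=
  open Classical in
  (∑ z ∈ s.latents n, ∑ A : SimpleGraph (Fin n), condProb m k lam q z A * f A) /
    ((s.latents n).card : ℝ)

open Classical in
/-- The centred adjacency `Y`: the edge indicator minus `q`, on unordered pairs of nodes. -/
noncomputable def centredAdj {n : ℕ} (q : ℝ) (A : SimpleGraph (Fin n)) (e : Sym2 (Fin n)) : ℝ :=
  (if e ∈ A.edgeSet then 1 else 0) - q

/-! ### Rooted templates -/

/-- A template with two distinguished vertices: a simple graph with at least one edge on the
vertex set `{v₁, v₂, …}` of cardinality `extra + 2`, without isolated vertices except possibly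
`v₁` and `v₂`. The vertices `v₁` and `v₂` are `0` and `1`. -/
structure RootedTemplate where
  extra : ℕ
  graph : SimpleGraph (Fin (extra + 2))
  not_isolated : ∀ v, v ≠ 0 → v ≠ 1 → ∃ w, graph.Adj v w
  has_edge : ∃ v w, graph.Adj v w

namespace RootedTemplate

/-- The number of vertices. -/
def numVertices (G : RootedTemplate) : ℕ := G.extra + 2

open Classical in
/-- The finite set of edges. -/
noncomputable def edges (G : RootedTemplate) : Finset (Sym2 (Fin (G.extra + 2))) :=
  G.graph.edgeFinset

/-- Two templates are equivalent if some graph isomorphism maps `v₁` to `v₁` and `v₂` to `v₂`. -/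
def Equivalent (G H : RootedTemplate) : Prop :=
  ∃ σ : G.graph ≃g H.graph, σ 0 = 0 ∧ σ 1 = 1

/-- The number of automorphisms that fix `v₁` and `v₂`. -/
noncomputable def autCard (G : RootedTemplate) : ℕ :=
  Nat.card {σ : G.graph ≃g G.graph // σ 0 = 0 ∧ σ 1 = 1}

open Classical in
/-- The labelings: injective maps from the vertices to the nodes that send `v₁` to the first
node and `v₂` to the second node. The node `i : Fin n` stands for the integer `i + 1`. -/
noncomputable def labelings (G : RootedTemplate) (n : ℕ) :
    Finset (Fin (G.extra + 2) → Fin n) :=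
  Finset.univ.filter fun π => Function.Injective π ∧ (π 0 : ℕ) = 0 ∧ (π 1 : ℕ) = 1

open Classical in
/-- The edges of a connected component. -/
noncomputable def componentEdges (G : RootedTemplate) (c : G.graph.ConnectedComponent) :
    Finset (Sym2 (Fin (G.extra + 2))) :=
  G.edges.filter fun e => ∀ v ∈ e, G.graph.connectedComponentMk v = c

open Classical in
/-- The connected components with at least two vertices. -/
noncomputable def nontrivialComponents (G : RootedTemplate) :
    Finset G.graph.ConnectedComponent :=
  Finset.univ.filter fun c => c.supp.Nontrivial

/-- The monomial of a connected component `c` under the labeling `π`. -/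
noncomputable def componentMonomial (G : RootedTemplate) (c : G.graph.ConnectedComponent)
    {n : ℕ} (q : ℝ) (π : Fin (G.extra + 2) → Fin n) (A : SimpleGraph (Fin n)) : ℝ :=
  ∏ e ∈ G.componentEdges c, centredAdj q A (e.map π)

/-- The corrected monomial: the product over the nontrivial connected components of the
component monomials, each centred by its expectation. -/
noncomputable def correctedMonomial (m : Model) (s : Sampling) (n k : ℕ) (lam q : ℝ)
    (G : RootedTemplate) (π : Fin (G.extra + 2) → Fin n) (A : SimpleGraph (Fin n)) : ℝ :=
  ∏ c ∈ G.nontrivialComponents,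
    (G.componentMonomial c q π A - expect m s n k lam q (G.componentMonomial c q π))

/-- The variance proxy. -/
noncomputable def varianceProxy (n : ℕ) (q : ℝ) (G : RootedTemplate) : ℝ :=
  ((n - 2).factorial : ℝ) / ((n - G.numVertices).factorial : ℝ) * (G.autCard : ℝ) *
    (q * (1 - q)) ^ G.edges.card

/-- The normalized rooted invariant polynomial `Ψ_G`. -/
noncomputable def Psi (m : Model) (s : Sampling) (n k : ℕ) (lam q : ℝ)
    (G : RootedTemplate) (A : SimpleGraph (Fin n)) : ℝ :=
  (∑ π ∈ G.labelings n, correctedMonomial m s n k lam q G π A) /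
    Real.sqrt (varianceProxy n q G)

end RootedTemplate

/-- `𝒢` is a maximum collection of pairwise non-equivalent templates with at most `D` edges: it
contains exactly one member of each equivalence class. -/
structure IsMaximumCollection (D : ℕ) (𝒢 : Finset RootedTemplate) : Prop where
  edges_le : ∀ G ∈ 𝒢, G.edges.card ≤ D
  eq_of_equivalent : ∀ G ∈ 𝒢, ∀ H ∈ 𝒢, G.Equivalent H → G = H
  exists_equivalent : ∀ G : RootedTemplate, G.edges.card ≤ D → ∃ H ∈ 𝒢, G.Equivalent H

end LatentGraph

/-!
The proof never works with templates directly. A rooted polynomial `Ψ_G` is a combination of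
*centred monomials* of labelled edge sets `S`, the products over the connected components of `S`
of the monomials in `Y / √(q(1-q))`, each centred by its mean. Every labelled edge set is a copy of
at most one template of the collection, it is then the copy under as many labelings as there are
automorphisms fixing the roots, and the variance proxy is the normalisation that turns `α` into a
coefficient vector on labelled edge sets with the same Euclidean norm (`add_sum_Psi_eq`,
`sum_labelledCoeff_sq`). So it suffices that the Gram matrix of the centred monomials of all
edge sets with at most `D` edges is close to the identity (`abs_expect_sq_sub_le`).

The diagonal entries are within `t` of one, with `t` a large negative power of `D`. The key estimate
(`abs_expect_centredMono_mul_le`) bounds an off-diagonal entry by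
`8 t^|S ∆ T| n^(-|V(S) ∆ V(T)|/2)`. Schur's test then applies: conjugating by `n^(-|V(S)|/2)`
makes the row sum at `S` a sum over `F = S ∆ T` of `t^|F|` times `1/n` for each node of `F` outside
`V(S)`. Building `F` edge by edge, each endpoint is one of `O(D)` nodes already present or one of
`n` new nodes of weight `1/n`, so the row sum is at most a geometric series in `64 D² t`
(`row_sum_le`).

For the key estimate, condition on the latent assignment `z`. Edges in exactly one of `S` and `T`
contribute the signal `ε = λ/√(q(1-q))` and force the labels of their endpoints to be linked;
edges in both contribute a factor close to one.

* In all three structures a label is linked to at most `3k` labels. Every component of the edges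
  used once that contains an anchor, a node common to `S` and `T`, can be explored from it, and
  each new node costs `ε · 3k/n`, which the hypothesis on `λk/√(nq)` makes at most `δ n^(-1/2)`;
  the remaining edges cost `ε ≤ δ` (`Regime.pinned_le`).
* A component of `S` or `T` that meets no node of the other set has no anchor: exploring it from
  one of its own nodes loses one factor `n^(-1/2)`. Its centring regains it. Under independent
  sampling such a component is independent of the rest and contributes zero.
* Under permutation sampling, the law of the labels of few nodes is the uniform law on maps
  conditioned on the absence of coincidences (`Sampling.mean_mul_expect_avoid`), which has
  probability at least `1/2`. Keeping the exclusions inside a component with that component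
  preserves its centring, so it contributes zero unless one of the exclusions between it and
  another component is replaced by a coincidence. A coincidence has probability of order `1/n` and
  serves at most two components, so each of them gains `n^(-1/2)`
  (`abs_expect_prod_mul_avoid_le`).
-/

namespace LatentGraph

/-! ### Averages over latent assignments -/

/-- A function of the coordinates in `W₁` and a function of the coordinates in a disjoint set `W₂`
are independent under the uniform law on all assignments. -/
lemma expect_mul_of_dependsOn {n : ℕ} {f g : (Fin n → Fin n) → ℝ} {W₁ W₂ : Finset (Fin n)}
    (hf : DependsOn f W₁) (hg : DependsOn g W₂) (h : Disjoint W₁ W₂) :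
    (𝔼 z, f z * g z) = (𝔼 z, f z) * 𝔼 z, g z := by
  -- Exchanging the `W₁`-coordinates of two independent copies preserves the joint law.
  let mix : (Fin n → Fin n) → (Fin n → Fin n) → (Fin n → Fin n) :=
    fun z w i => if i ∈ W₁ then z i else w i
  let e : ((Fin n → Fin n) × (Fin n → Fin n)) ≃ ((Fin n → Fin n) × (Fin n → Fin n)) :=
    { toFun := fun p => (mix p.1 p.2, mix p.2 p.1)
      invFun := fun p => (mix p.1 p.2, mix p.2 p.1)
      left_inv := by
        rintro ⟨z, w⟩
        ext i <;> simp only [mix] <;> split_ifs <;> rfl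
      right_inv := by
        rintro ⟨z, w⟩
        ext i <;> simp only [mix] <;> split_ifs <;> rfl }
  have key : (𝔼 p : (Fin n → Fin n) × (Fin n → Fin n), f p.1 * g p.2)
      = 𝔼 p : (Fin n → Fin n) × (Fin n → Fin n), f p.1 * g p.1 := by
    refine Fintype.expect_equiv e _ _ ?_
    rintro ⟨z, w⟩
    have h1 : f z = f (mix z w) := hf fun i hi => by
      have : i ∈ W₁ := by simpa using hi
      simp [mix, this]
    have h2 : g w = g (mix z w) := hg fun i hi => by
      have : i ∉ W₁ := fun h' => Finset.disjoint_left.mp h h' (by simpa using hi)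
      simp [mix, this]
    simp only [e, Equiv.coe_fn_mk]
    rw [h1, h2]
  rw [← Finset.univ_product_univ, Finset.expect_product, Finset.expect_product] at key
  calc (𝔼 z, f z * g z) = 𝔼 z : Fin n → Fin n, 𝔼 _w : Fin n → Fin n, f z * g z := by
        refine Finset.expect_congr rfl fun z _ => ?_
        have : Nonempty (Fin n → Fin n) := ⟨z⟩
        rw [Fintype.expect_const]
    _ = 𝔼 z : Fin n → Fin n, 𝔼 w : Fin n → Fin n, f z * g w := key.symm
    _ = _ := by
        rw [Finset.expect_mul]
        exact Finset.expect_congr rfl fun z _ => (Finset.mul_expect _ _ _).symm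

/-- Resampling one coordinate does not change the average. -/
lemma expect_eq_expect_update {n : ℕ} (x : Fin n) (g : (Fin n → Fin n) → ℝ) :
    (𝔼 z, g z) = 𝔼 z : Fin n → Fin n, 𝔼 c : Fin n, g (Function.update z x c) := by
  let e : ((Fin n → Fin n) × Fin n) ≃ ((Fin n → Fin n) × Fin n) :=
    { toFun := fun p => (Function.update p.1 x p.2, p.1 x)
      invFun := fun p => (Function.update p.1 x p.2, p.1 x)
      left_inv := by rintro ⟨z, c⟩; simp
      right_inv := by rintro ⟨z, c⟩; simp }
  have key : (𝔼 p : (Fin n → Fin n) × Fin n, g (Function.update p.1 x p.2))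
      = 𝔼 p : (Fin n → Fin n) × Fin n, g p.1 :=
    Fintype.expect_equiv e _ _ fun p => by simp [e]
  rw [← Finset.univ_product_univ, Finset.expect_product, Finset.expect_product] at key
  have : Nonempty (Fin n) := ⟨x⟩
  rw [key]
  exact Finset.expect_congr rfl fun z _ => (Fintype.expect_const _).symm

/-- The indicator that no pair in `Q` receives equal labels. -/
def avoid {n : ℕ} (Q : Finset (Fin n × Fin n)) (z : Fin n → Fin n) : ℝ :=
  ∏ p ∈ Q, if z p.1 = z p.2 then 0 else 1

lemma avoid_nonneg {n : ℕ} (Q : Finset (Fin n × Fin n)) (z : Fin n → Fin n) : 0 ≤ avoid Q z :=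
  Finset.prod_nonneg fun p _ => by split_ifs <;> norm_num

lemma avoid_le_one {n : ℕ} (Q : Finset (Fin n × Fin n)) (z : Fin n → Fin n) : avoid Q z ≤ 1 :=
  Finset.prod_le_one (fun p _ => by split_ifs <;> norm_num) fun p _ => by split_ifs <;> norm_num

lemma avoid_eq_zero {n : ℕ} {Q : Finset (Fin n × Fin n)} {z : Fin n → Fin n} {p : Fin n × Fin n}
    (hp : p ∈ Q) (h : z p.1 = z p.2) : avoid Q z = 0 :=
  Finset.prod_eq_zero hp (by simp [h])

lemma avoid_offDiag {n : ℕ} (W : Finset (Fin n)) (z : Fin n → Fin n) [Decidable (Set.InjOn z W)] :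
    avoid W.offDiag z = if Set.InjOn z W then 1 else 0 := by
  split_ifs with h
  · refine Finset.prod_eq_one fun p hp => ?_
    rw [Finset.mem_offDiag] at hp
    exact if_neg fun h' => hp.2.2 (h (by simpa using hp.1) (by simpa using hp.2.1) h')
  · simp only [Set.InjOn, not_forall] at h
    obtain ⟨x, hx, y, hy, hxy, hne⟩ := h
    exact avoid_eq_zero (p := (x, y)) (Finset.mem_offDiag.mpr ⟨by simpa using hx,
      by simpa using hy, hne⟩) hxy

lemma dependsOn_avoid {n : ℕ} {Q : Finset (Fin n × Fin n)} {W : Finset (Fin n)}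
    (h : ∀ p ∈ Q, p.1 ∈ W ∧ p.2 ∈ W) : DependsOn (avoid Q) W := by
  intro z w hzw
  refine Finset.prod_congr rfl fun p hp => ?_
  rw [hzw _ (h p hp).1, hzw _ (h p hp).2]

/-- The pairs of nodes in `W` whose labels are forced to be distinct by the sampling scheme. -/
def Sampling.exclusions (s : Sampling) {n : ℕ} (W : Finset (Fin n)) : Finset (Fin n × Fin n) :=
  match s with
  | .independent => ∅
  | .permutation => W.offDiag

lemma Sampling.exclusions_subset (s : Sampling) {n : ℕ} (W : Finset (Fin n)) :
    s.exclusions W ⊆ W.offDiag := by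
  cases s
  · exact Finset.empty_subset _
  · exact subset_rfl

/-- The mean of a function of the latent assignment. -/
noncomputable def Sampling.mean (s : Sampling) {n : ℕ} (g : (Fin n → Fin n) → ℝ) : ℝ :=
  𝔼 z ∈ s.latents n, g z

lemma expect_coincide {n : ℕ} {x y : Fin n} (h : x ≠ y) :
    (𝔼 z : Fin n → Fin n, if z x = z y then (1 : ℝ) else 0) = 1 / n := by
  have : Nonempty (Fin n) := ⟨x⟩
  rw [expect_eq_expect_update x]
  rw [Finset.expect_congr rfl (g := fun _ => (1 / n : ℝ)) fun z _ => ?_, Fintype.expect_const]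
  rw [Fintype.expect_eq_sum_div_card]
  simp [Function.update_of_ne h.symm]

/-- The uniform law on all maps is injective on a small set `W` with probability at least `1/2`. -/
lemma half_le_expect_avoid (s : Sampling) {n : ℕ} (hn : 0 < n) (W : Finset (Fin n))
    (hW : 2 * (W.card : ℝ) ^ 2 ≤ n) : 1 / 2 ≤ 𝔼 z : Fin n → Fin n, avoid (s.exclusions W) z := by
  have : Nonempty (Fin n) := ⟨⟨0, hn⟩⟩
  have hn' : (0 : ℝ) < n := by exact_mod_cast hn
  have union_bound : ∀ (Q : Finset (Fin n × Fin n)) (z : Fin n → Fin n),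
      1 - ∑ p ∈ Q, (if z p.1 = z p.2 then (1 : ℝ) else 0) ≤ avoid Q z := by
    intro Q z
    by_cases h : ∃ p ∈ Q, z p.1 = z p.2
    · obtain ⟨p, hp, hz⟩ := h
      have h1 : (1 : ℝ) ≤ ∑ p ∈ Q, (if z p.1 = z p.2 then (1 : ℝ) else 0) := by
        refine le_trans (by simp [hz]) (Finset.single_le_sum (f := fun p : Fin n × Fin n =>
          if z p.1 = z p.2 then (1 : ℝ) else 0) (fun p _ => by split_ifs <;> norm_num) hp)
      linarith [avoid_nonneg Q z]
    · push Not at h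
      have h1 : avoid Q z = 1 := Finset.prod_eq_one fun p hp => if_neg (h p hp)
      have h2 : 0 ≤ ∑ p ∈ Q, (if z p.1 = z p.2 then (1 : ℝ) else 0) :=
        Finset.sum_nonneg fun p _ => by split_ifs <;> norm_num
      linarith
  have h1 := Finset.expect_le_expect (s := Finset.univ)
    fun z (_ : z ∈ Finset.univ) => union_bound (s.exclusions W) z
  rw [Finset.expect_sub_distrib, Fintype.expect_const, Finset.expect_sum_comm] at h1
  have h2 : ∑ p ∈ s.exclusions W, (𝔼 z : Fin n → Fin n, if z p.1 = z p.2 then (1 : ℝ) else 0)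
      ≤ (W.card : ℝ) ^ 2 / n := by
    rw [Finset.sum_congr rfl (g := fun _ => (1 / n : ℝ)) fun p hp =>
      expect_coincide (Finset.mem_offDiag.mp (s.exclusions_subset W hp)).2.2]
    rw [Finset.sum_const, nsmul_eq_mul, ← div_eq_mul_one_div]
    gcongr
    have h3 : (s.exclusions W).card ≤ W.card ^ 2 := by
      refine (Finset.card_le_card (s.exclusions_subset W)).trans ?_
      rw [Finset.offDiag_card, sq]
      omega
    exact_mod_cast h3
  have h3 : (W.card : ℝ) ^ 2 / n ≤ 1 / 2 := by
    rw [div_le_iff₀ hn']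
    linarith
  linarith

/-- Comparison of the sampling scheme with the uniform law on all maps: on functions of the
coordinates in `W`, it is that law conditioned on the excluded coincidences. -/
lemma Sampling.mean_mul_expect_avoid (s : Sampling) {n : ℕ} {W : Finset (Fin n)}
    {g : (Fin n → Fin n) → ℝ} (hg : DependsOn g W) :
    s.mean g * (𝔼 z : Fin n → Fin n, avoid (s.exclusions W) z)
      = 𝔼 z : Fin n → Fin n, g z * avoid (s.exclusions W) z := by
  classical
  cases s with
  | independent =>
    rcases isEmpty_or_nonempty (Fin n → Fin n) with h | h
    · simp [Sampling.mean, Sampling.exclusions, avoid, Sampling.latents]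
    · simp [Sampling.mean, Sampling.exclusions, avoid, Sampling.latents]
  | permutation =>
    have hperm : (Sampling.permutation).mean g = 𝔼 σ : Equiv.Perm (Fin n), g σ := by
      unfold Sampling.mean
      symm
      refine Finset.expect_bij (fun σ _ => (σ : Fin n → Fin n)) ?_ ?_ ?_ ?_
      · intro σ _
        exact Finset.mem_filter.mpr ⟨Finset.mem_univ _, σ.bijective⟩
      · intro σ _
        rfl
      · intro σ _ τ _ h
        exact DFunLike.coe_injective h
      · intro z hz
        simp only [Sampling.latents, Finset.mem_filter, Finset.mem_univ, true_and] at hz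
        exact ⟨Equiv.ofBijective z hz, Finset.mem_univ _, rfl⟩
    -- Relabelling by a fixed permutation preserves the uniform law and injectivity on `W`.
    have hrel : ∀ σ : Equiv.Perm (Fin n),
        (𝔼 z : Fin n → Fin n, g z * avoid W.offDiag z)
          = 𝔼 z : Fin n → Fin n, g (σ ∘ z) * avoid W.offDiag z := by
      intro σ
      symm
      refine Fintype.expect_equiv (Equiv.arrowCongr (Equiv.refl _) σ) _ _ fun z => ?_
      have : avoid W.offDiag z = avoid W.offDiag (σ ∘ z) := by simp [avoid]
      rw [this]
      rfl
    have havg : ∀ z : Fin n → Fin n,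
        (𝔼 σ : Equiv.Perm (Fin n), g (σ ∘ z)) * avoid W.offDiag z
          = (𝔼 σ : Equiv.Perm (Fin n), g σ) * avoid W.offDiag z := by
      intro z
      rw [avoid_offDiag]
      split_ifs with hz
      · obtain ⟨τ, hτ⟩ := Finset.exists_equiv_extend_of_card_eq (α := Fin n)
          (t := (Finset.univ : Finset (Fin n))) (by simp) (Finset.subset_univ _) hz
        let τ' : Equiv.Perm (Fin n) := τ.trans ⟨Subtype.val, fun x => ⟨x, Finset.mem_univ x⟩,
          fun x => rfl, fun x => rfl⟩
        have h1 : ∀ σ : Equiv.Perm (Fin n), g (σ ∘ z) = g (τ'.trans σ) := fun σ =>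
          hg fun i hi => by
            have := hτ i (by simpa using hi)
            simp [τ', this]
        congr 1
        exact Fintype.expect_equiv (Equiv.mulRight τ') _ _ fun σ => by
          rw [h1]
          rfl
      · simp
    simp only [Sampling.exclusions]
    calc _ = 𝔼 z : Fin n → Fin n, (𝔼 σ : Equiv.Perm (Fin n), g (σ ∘ z)) * avoid W.offDiag z := by
          rw [hperm, Finset.mul_expect]
          exact Finset.expect_congr rfl fun z _ => (havg z).symm
      _ = 𝔼 σ : Equiv.Perm (Fin n), 𝔼 z : Fin n → Fin n, g (σ ∘ z) * avoid W.offDiag z := by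
          rw [Finset.expect_comm]
          exact Finset.expect_congr rfl fun z _ => Finset.expect_mul _ _ _
      _ = 𝔼 _σ : Equiv.Perm (Fin n), 𝔼 z : Fin n → Fin n, g z * avoid W.offDiag z :=
          Finset.expect_congr rfl fun σ _ => (hrel σ).symm
      _ = _ := Fintype.expect_const _

lemma Sampling.latents_nonempty (s : Sampling) (n : ℕ) : (s.latents n).Nonempty := by
  classical
  refine ⟨id, ?_⟩
  cases s
  · exact Finset.mem_univ _
  · exact Finset.mem_filter.mpr ⟨Finset.mem_univ _, Function.bijective_id⟩

lemma Sampling.mean_mono (s : Sampling) {n : ℕ} {f g : (Fin n → Fin n) → ℝ}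
    (h : ∀ z, f z ≤ g z) : s.mean f ≤ s.mean g :=
  Finset.expect_le_expect fun z _ => h z

lemma Sampling.mean_const (s : Sampling) {n : ℕ} (c : ℝ) :
    s.mean (fun _ : Fin n → Fin n => c) = c :=
  Finset.expect_const (s.latents_nonempty n) c

lemma Sampling.mean_nonneg (s : Sampling) {n : ℕ} {f : (Fin n → Fin n) → ℝ}
    (h : ∀ z, 0 ≤ f z) : 0 ≤ s.mean f :=
  Finset.expect_nonneg fun z _ => h z

/-- Means of nonnegative functions of few coordinates are at most twice those under the uniform
law on all maps. -/
lemma Sampling.mean_le_two_mul_expect (s : Sampling) {n : ℕ} (hn : 0 < n) {W : Finset (Fin n)}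
    (hW : 2 * (W.card : ℝ) ^ 2 ≤ n) {g : (Fin n → Fin n) → ℝ} (hg : DependsOn g W)
    (hg0 : ∀ z, 0 ≤ g z) : s.mean g ≤ 2 * 𝔼 z : Fin n → Fin n, g z := by
  have h1 := half_le_expect_avoid s hn W hW
  have h2 := s.mean_mul_expect_avoid hg
  have h3 : (𝔼 z : Fin n → Fin n, g z * avoid (s.exclusions W) z) ≤ 𝔼 z : Fin n → Fin n, g z :=
    Finset.expect_le_expect fun z _ => mul_le_of_le_one_right (hg0 z) (avoid_le_one _ _)
  have h4 := s.mean_nonneg hg0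
  nlinarith

/-! ### Weak dependence created by excluded coincidences -/

/-- `f` depends only on the labels of the nodes in `W`, and its absolute mean is at most `b`, even
conditionally on the label of any single node of `W`. -/
structure Spread {n : ℕ} (f : (Fin n → Fin n) → ℝ) (W : Finset (Fin n)) (b : ℝ) : Prop where
  dep : DependsOn f W
  mean_le : (𝔼 z, |f z|) ≤ b
  pinned_le : ∀ u ∈ W, ∀ a, (𝔼 z : Fin n → Fin n, |f z| * (if z u = a then 1 else 0)) ≤ b / n

lemma Spread.nonneg {n : ℕ} {f : (Fin n → Fin n) → ℝ} {W : Finset (Fin n)} {b : ℝ}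
    (h : Spread f W b) : 0 ≤ b :=
  le_trans (Finset.expect_nonneg fun _ _ => abs_nonneg _) h.mean_le

lemma dependsOn_mul {n : ℕ} {f g : (Fin n → Fin n) → ℝ} {W W' : Finset (Fin n)}
    (hf : DependsOn f W) (hg : DependsOn g W') :
    DependsOn (fun z => f z * g z) (W ∪ W' : Finset (Fin n)) := by
  intro z w h
  have h1 : f z = f w := hf fun i hi => h i (by simp [Finset.mem_coe.mp hi])
  have h2 : g z = g w := hg fun i hi => h i (by simp [Finset.mem_coe.mp hi])
  simp only [h1, h2]

lemma dependsOn_abs {n : ℕ} {f : (Fin n → Fin n) → ℝ} {W : Finset (Fin n)}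
    (hf : DependsOn f W) : DependsOn (fun z => |f z|) W :=
  fun z w h => by simp only [hf h]

lemma dependsOn_abs_mul_pin {n : ℕ} {f : (Fin n → Fin n) → ℝ} {W : Finset (Fin n)}
    (hf : DependsOn f W) {u : Fin n} (hu : u ∈ W) (a : Fin n) :
    DependsOn (fun z => |f z| * (if z u = a then 1 else 0)) W :=
  fun z w h => by simp only [hf h, h u hu]

lemma Spread.mul {n : ℕ} {f g : (Fin n → Fin n) → ℝ} {W W' : Finset (Fin n)} {b b' : ℝ}
    (hf : Spread f W b) (hg : Spread g W' b') (h : Disjoint W W') :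
    Spread (fun z => f z * g z) (W ∪ W') (b * b') where
  dep := dependsOn_mul hf.dep hg.dep
  mean_le := by
    simp only [abs_mul]
    rw [expect_mul_of_dependsOn (dependsOn_abs hf.dep) (dependsOn_abs hg.dep) h]
    exact mul_le_mul hf.mean_le hg.mean_le (Finset.expect_nonneg fun _ _ => abs_nonneg _) hf.nonneg
  pinned_le := by
    intro u hu a
    simp only [abs_mul]
    rcases Finset.mem_union.mp hu with hu | hu
    · rw [Finset.expect_congr rfl
        (g := fun z => (|f z| * (if z u = a then 1 else 0)) * |g z|) fun z _ => by ring,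
        expect_mul_of_dependsOn (dependsOn_abs_mul_pin hf.dep hu a) (dependsOn_abs hg.dep) h,
        mul_div_right_comm]
      exact mul_le_mul (hf.pinned_le u hu a) hg.mean_le
        (Finset.expect_nonneg fun _ _ => abs_nonneg _) (div_nonneg hf.nonneg (Nat.cast_nonneg n))
    · rw [Finset.expect_congr rfl
        (g := fun z => |f z| * (|g z| * (if z u = a then 1 else 0))) fun z _ => by ring,
        expect_mul_of_dependsOn (dependsOn_abs hf.dep) (dependsOn_abs_mul_pin hg.dep hu a) h,
        mul_div_assoc]
      exact mul_le_mul hf.mean_le (hg.pinned_le u hu a)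
        (Finset.expect_nonneg fun _ _ => by positivity) hf.nonneg

/-- If the label of `x` under the first factor is forced to equal the label of `y` under the
second, independent factor, the mean drops by a factor `n`. -/
lemma expect_glue_le {n : ℕ} {f : (Fin n → Fin n) → ℝ} {g : (Fin n → Fin n) → ℝ}
    {W W' : Finset (Fin n)} {b : ℝ} {x y : Fin n} (hf : Spread f W b) (hx : x ∈ W)
    (hg : DependsOn g W') (hg0 : ∀ z, 0 ≤ g z) (hy : y ∈ W') (h : Disjoint W W') :
    (𝔼 z, |f z| * g z * (if z x = z y then 1 else 0)) ≤ b / n * 𝔼 z, g z := by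
  have hsplit : ∀ z : Fin n → Fin n, |f z| * g z * (if z x = z y then 1 else 0)
      = ∑ c : Fin n, (|f z| * (if z x = c then 1 else 0)) * (g z * (if z y = c then 1 else 0)) := by
    intro z
    rw [Finset.sum_eq_single (z x)]
    · by_cases hxy : z x = z y
      · simp [hxy]
      · simp [hxy, Ne.symm hxy]
    · intro c _ hc
      simp [Ne.symm hc]
    · simp
  have hg' : ∀ c : Fin n, DependsOn (fun z => g z * (if z y = c then 1 else 0)) W' := by
    intro c z w hzw
    simp only [hg hzw, hzw y hy]
  rw [Finset.expect_congr rfl fun z _ => hsplit z, Finset.expect_sum_comm]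
  calc _ = ∑ c : Fin n, (𝔼 z, |f z| * (if z x = c then 1 else 0)) *
        𝔼 z, g z * (if z y = c then 1 else 0) :=
        Finset.sum_congr rfl fun c _ =>
          expect_mul_of_dependsOn (dependsOn_abs_mul_pin hf.dep hx c) (hg' c) h
    _ ≤ ∑ c : Fin n, b / n * 𝔼 z, g z * (if z y = c then 1 else 0) := by
        refine Finset.sum_le_sum fun c _ => mul_le_mul_of_nonneg_right (hf.pinned_le x hx c)
          (Finset.expect_nonneg fun z _ => mul_nonneg (hg0 z) (by split_ifs <;> norm_num))
    _ = b / n * 𝔼 z, g z := by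
        rw [← Finset.mul_sum, ← Finset.expect_sum_comm]
        congr 1
        refine Finset.expect_congr rfl fun z _ => ?_
        rw [← Finset.mul_sum]
        simp

lemma Spread.glue {n : ℕ} {f g : (Fin n → Fin n) → ℝ} {W W' : Finset (Fin n)} {b b' : ℝ}
    (hf : Spread f W b) (hg : Spread g W' b') (h : Disjoint W W') {x y : Fin n} (hx : x ∈ W)
    (hy : y ∈ W') :
    Spread (fun z => f z * g z * (if z x = z y then 1 else 0)) (W ∪ W') (b * b' / n) where
  dep := by
    intro z w hzw
    have h1 : f z = f w := hf.dep fun i hi => hzw i (by simp [Finset.mem_coe.mp hi])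
    have h2 : g z = g w := hg.dep fun i hi => hzw i (by simp [Finset.mem_coe.mp hi])
    simp only [h1, h2, hzw x (by simp [hx]), hzw y (by simp [hy])]
  mean_le := by
    have habs : ∀ z : Fin n → Fin n, |f z * g z * (if z x = z y then 1 else 0)|
        = |f z| * |g z| * (if z x = z y then 1 else 0) := by
      intro z
      rw [abs_mul, abs_mul]
      congr 1
      split_ifs <;> norm_num
    rw [Finset.expect_congr rfl fun z _ => habs z]
    refine (expect_glue_le hf hx (dependsOn_abs hg.dep) (fun z => abs_nonneg _) hy h).trans ?_
    rw [mul_div_right_comm]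
    exact mul_le_mul_of_nonneg_left hg.mean_le (div_nonneg hf.nonneg (Nat.cast_nonneg n))
  pinned_le := by
    intro u hu a
    have habs : ∀ z : Fin n → Fin n, |f z * g z * (if z x = z y then 1 else 0)|
        = |f z| * |g z| * (if z x = z y then 1 else 0) := by
      intro z
      rw [abs_mul, abs_mul]
      congr 1
      split_ifs <;> norm_num
    rw [Finset.expect_congr rfl fun z _ => by rw [habs z]]
    have hn : (0 : ℝ) ≤ n := Nat.cast_nonneg n
    rcases Finset.mem_union.mp hu with hu | hu
    · rw [Finset.expect_congr rfl (g := fun z => |g z| * (|f z| * (if z u = a then 1 else 0)) *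
        (if z y = z x then 1 else 0)) fun z _ => by simp only [eq_comm (a := z y)]; ring]
      refine (expect_glue_le hg hy (dependsOn_abs_mul_pin hf.dep hu a)
        (fun z => by positivity) hx h.symm).trans ?_
      calc _ ≤ b' / n * (b / n) :=
            mul_le_mul_of_nonneg_left (hf.pinned_le u hu a) (div_nonneg hg.nonneg hn)
        _ = _ := by ring
    · rw [Finset.expect_congr rfl (g := fun z => |f z| * (|g z| * (if z u = a then 1 else 0)) *
        (if z x = z y then 1 else 0)) fun z _ => by ring]
      refine (expect_glue_le hf hx (dependsOn_abs_mul_pin hg.dep hu a)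
        (fun z => by positivity) hy h).trans ?_
      calc _ ≤ b / n * (b' / n) :=
            mul_le_mul_of_nonneg_left (hg.pinned_le u hu a) (div_nonneg hf.nonneg hn)
        _ = _ := by ring

/-- The product of one block `f` and a family of centred blocks, all on disjoint sets of nodes,
under excluded coincidences between blocks. A centred block contributes nothing unless it coincides
somewhere with another block; such a coincidence costs `1 / n` and involves at most two centred
blocks, so each centred block gains a factor of order `n ^ (-1/2)`. -/
theorem abs_expect_prod_mul_avoid_le {n : ℕ} {ι : Type*} [DecidableEq ι]
    {F : ι → (Fin n → Fin n) → ℝ} {U : ι → Finset (Fin n)} {β : ι → ℝ} {ρ M : ℝ}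
    (hρ0 : 0 ≤ ρ) (hρ : ρ ^ 2 = 1 / n) (hM : 0 ≤ M) (hMρ : M * ρ ≤ 1) (J : Finset ι)
    (hF : ∀ j ∈ J, Spread (F j) (U j) (β j)) (hF0 : ∀ j ∈ J, (𝔼 z, F j z) = 0)
    (hU : ∀ i ∈ J, ∀ j ∈ J, i ≠ j → Disjoint (U i) (U j))
    {f : (Fin n → Fin n) → ℝ} {W : Finset (Fin n)} {b : ℝ} (hf : Spread f W b)
    (hW : ∀ j ∈ J, Disjoint W (U j)) {Q : Finset (Fin n × Fin n)}
    (hQ : ∀ p ∈ Q, p.1 ∈ W ∪ J.biUnion U ∧ p.2 ∈ W ∪ J.biUnion U)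
    (hQU : ∀ p ∈ Q, ∀ j ∈ J, ¬(p.1 ∈ U j ∧ p.2 ∈ U j)) (hQM : (Q.card : ℝ) ≤ M ^ 2) :
    |𝔼 z, f z * (∏ j ∈ J, F j z) * avoid Q z| ≤ b * (∏ j ∈ J, β j) * (M * ρ) ^ J.card := by
  have hMρ0 : 0 ≤ M * ρ := mul_nonneg hM hρ0
  have hn0 : (0 : ℝ) ≤ n := Nat.cast_nonneg n
  induction hN : J.card using Nat.strong_induction_on generalizing J f W b Q with
  | _ N IH =>
  subst hN
  rcases J.eq_empty_or_nonempty with rfl | ⟨j, hj⟩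
  · simp only [Finset.prod_empty, mul_one, Finset.card_empty, pow_zero]
    refine (Finset.abs_expect_le _ _).trans (le_trans (Finset.expect_le_expect fun z _ => ?_)
      hf.mean_le)
    rw [abs_mul, abs_of_nonneg (avoid_nonneg Q z)]
    exact mul_le_of_le_one_right (abs_nonneg _) (avoid_le_one Q z)
  have hβ : ∀ i ∈ J, 0 ≤ β i := fun i hi => (hF i hi).nonneg
  have hcard : (J.erase j).card = J.card - 1 := Finset.card_erase_of_mem hj
  have hpos : 0 < J.card := Finset.card_pos.mpr ⟨j, hj⟩
  set B : ℝ := b * (∏ i ∈ J, β i) * (1 / n) * (M * ρ) ^ (J.card - 2) with hB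
  have hB0 : 0 ≤ B := mul_nonneg (mul_nonneg (mul_nonneg hf.nonneg (Finset.prod_nonneg hβ))
    (by positivity)) (pow_nonneg hMρ0 _)
  -- One forced coincidence between the block `j` and another block.
  have glue_bound : ∀ X ⊆ Q, ∀ x ∈ U j, ∀ y, y ∉ U j → y ∈ W ∪ J.biUnion U →
      |𝔼 z, f z * (∏ i ∈ J, F i z) * (if z x = z y then 1 else 0) * avoid X z| ≤ B := by
    intro X hX x hx y hyj hy
    have hXM : (X.card : ℝ) ≤ M ^ 2 := le_trans (by exact_mod_cast Finset.card_le_card hX) hQM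
    rcases Finset.mem_union.mp hy with hyW | hyU
    · have hsp := (hF j hj).glue hf (hW j hj).symm hx hyW
      have := IH (J.erase j).card (by omega) (J.erase j)
        (fun i hi => hF i (Finset.mem_of_mem_erase hi))
        (fun i hi => hF0 i (Finset.mem_of_mem_erase hi))
        (fun i hi k hk => hU i (Finset.mem_of_mem_erase hi) k (Finset.mem_of_mem_erase hk))
        hsp (fun i hi => Finset.disjoint_union_left.mpr
          ⟨hU j hj i (Finset.mem_of_mem_erase hi) (Finset.ne_of_mem_erase hi).symm,
            hW i (Finset.mem_of_mem_erase hi)⟩)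
        (Q := X) (fun p hp => by
          have hh := hQ p (hX hp)
          have aux : ∀ v, v ∈ W ∪ J.biUnion U → v ∈ (U j ∪ W) ∪ (J.erase j).biUnion U := by
            intro v hv
            simp only [Finset.mem_union, Finset.mem_biUnion, Finset.mem_erase] at hv ⊢
            rcases hv with hv | ⟨i, hi, hv⟩
            · exact Or.inl (Or.inr hv)
            · by_cases hij : i = j
              · subst hij
                exact Or.inl (Or.inl hv)
              · exact Or.inr ⟨i, ⟨hij, hi⟩, hv⟩
          exact ⟨aux _ hh.1, aux _ hh.2⟩)
        (fun p hp i hi => hQU p (hX hp) i (Finset.mem_of_mem_erase hi)) hXM rfl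
      refine le_trans (le_of_eq ?_) (this.trans ?_)
      · congr 1
        refine Finset.expect_congr rfl fun z _ => ?_
        rw [← Finset.mul_prod_erase J _ hj]
        ring
      · rw [hB, ← Finset.mul_prod_erase J _ hj, hcard]
        have h1 : (M * ρ) ^ (J.card - 1) ≤ (M * ρ) ^ (J.card - 2) :=
          pow_le_pow_of_le_one hMρ0 hMρ (by omega)
        have h2 : 0 ≤ β j * b / n * ∏ i ∈ J.erase j, β i :=
          mul_nonneg (div_nonneg (mul_nonneg (hβ j hj) hf.nonneg) hn0)
            (Finset.prod_nonneg fun i hi => hβ i (Finset.mem_of_mem_erase hi))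
        calc _ ≤ β j * b / n * (∏ i ∈ J.erase j, β i) * (M * ρ) ^ (J.card - 2) :=
              mul_le_mul_of_nonneg_left h1 h2
          _ = _ := by ring
    · obtain ⟨k, hk, hyk⟩ := Finset.mem_biUnion.mp hyU
      have hkj : k ≠ j := fun h => hyj (h ▸ hyk)
      have hk' : k ∈ J.erase j := Finset.mem_erase.mpr ⟨hkj, hk⟩
      have hcard2 : ((J.erase j).erase k).card = J.card - 2 := by
        rw [Finset.card_erase_of_mem hk', hcard]
        omega
      have hsub : ∀ i ∈ (J.erase j).erase k, i ∈ J := fun i hi =>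
        Finset.mem_of_mem_erase (Finset.mem_of_mem_erase hi)
      have hsp := hf.mul ((hF j hj).glue (hF k hk) (hU j hj k hk hkj.symm) hx hyk)
        (Finset.disjoint_union_right.mpr ⟨hW j hj, hW k hk⟩)
      have := IH ((J.erase j).erase k).card (by omega) ((J.erase j).erase k)
        (fun i hi => hF i (hsub i hi)) (fun i hi => hF0 i (hsub i hi))
        (fun i hi l hl => hU i (hsub i hi) l (hsub l hl))
        hsp (fun i hi => Finset.disjoint_union_left.mpr ⟨hW i (hsub i hi),
          Finset.disjoint_union_left.mpr
          ⟨hU j hj i (hsub i hi) (Finset.ne_of_mem_erase (Finset.mem_of_mem_erase hi)).symm,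
            hU k hk i (hsub i hi) (Finset.ne_of_mem_erase hi).symm⟩⟩)
        (Q := X) (fun p hp => by
          have hh := hQ p (hX hp)
          have aux : ∀ v, v ∈ W ∪ J.biUnion U →
              v ∈ (W ∪ (U j ∪ U k)) ∪ ((J.erase j).erase k).biUnion U := by
            intro v hv
            simp only [Finset.mem_union, Finset.mem_biUnion, Finset.mem_erase] at hv ⊢
            rcases hv with hv | ⟨i, hi, hv⟩
            · exact Or.inl (Or.inl hv)
            · by_cases hij : i = j
              · subst hij
                exact Or.inl (Or.inr (Or.inl hv))
              · by_cases hik : i = k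
                · subst hik
                  exact Or.inl (Or.inr (Or.inr hv))
                · exact Or.inr ⟨i, ⟨hik, hij, hi⟩, hv⟩
          exact ⟨aux _ hh.1, aux _ hh.2⟩)
        (fun p hp i hi => hQU p (hX hp) i (hsub i hi)) hXM rfl
      refine le_trans (le_of_eq ?_) (this.trans (le_of_eq ?_))
      · congr 1
        refine Finset.expect_congr rfl fun z _ => ?_
        rw [← Finset.mul_prod_erase J _ hj, ← Finset.mul_prod_erase (J.erase j) _ hk']
        ring
      · rw [hB, ← Finset.mul_prod_erase J _ hj, ← Finset.mul_prod_erase (J.erase j) _ hk', hcard2]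
        ring
  set Q₀ := Q.filter fun p => ¬(p.1 ∈ U j ∨ p.2 ∈ U j) with hQ₀
  -- Exclusions touching the block `j` are added one at a time.
  have incl : ∀ P ⊆ Q.filter fun p => p.1 ∈ U j ∨ p.2 ∈ U j,
      |𝔼 z, f z * (∏ i ∈ J, F i z) * avoid (Q₀ ∪ P) z| ≤ P.card * B := by
    intro P
    induction P using Finset.induction_on with
    | empty =>
      intro _
      have hdep : DependsOn (fun z => f z * (∏ i ∈ J.erase j, F i z) * avoid Q₀ z)
          ((Finset.univ \ U j : Finset (Fin n)) : Set (Fin n)) := by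
        intro z w hzw
        have h1 : f z = f w := hf.dep fun i hi => hzw i (by
          simpa using Finset.disjoint_left.mp (hW j hj) hi)
        have h2 : (∏ i ∈ J.erase j, F i z) = ∏ i ∈ J.erase j, F i w :=
          Finset.prod_congr rfl fun i hi => (hF i (Finset.mem_of_mem_erase hi)).dep fun v hv => by
            have hij := hU i (Finset.mem_of_mem_erase hi) j hj (Finset.ne_of_mem_erase hi)
            exact hzw v (by simpa using Finset.disjoint_left.mp hij hv)
        have h3 : avoid Q₀ z = avoid Q₀ w := Finset.prod_congr rfl fun p hp => by
          have := (Finset.mem_filter.mp hp).2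
          push Not at this
          rw [hzw p.1 (by simpa using this.1), hzw p.2 (by simpa using this.2)]
        simp only [h1, h2, h3]
      have : (𝔼 z, f z * (∏ i ∈ J, F i z) * avoid (Q₀ ∪ ∅) z)
          = (𝔼 z, F j z) * 𝔼 z, f z * (∏ i ∈ J.erase j, F i z) * avoid Q₀ z := by
        rw [← expect_mul_of_dependsOn (hF j hj).dep hdep Finset.disjoint_sdiff]
        refine Finset.expect_congr rfl fun z _ => ?_
        rw [← Finset.mul_prod_erase J _ hj, Finset.union_empty]
        ring
      rw [this, hF0 j hj]
      simp
    | insert p P hp ihP =>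
      intro hPQ
      have hpQ := Finset.mem_filter.mp (hPQ (Finset.mem_insert_self p P))
      have hP := ihP fun q hq => hPQ (Finset.mem_insert_of_mem hq)
      have hpX : p ∉ Q₀ ∪ P := by
        rw [Finset.mem_union, not_or]
        exact ⟨fun h => (Finset.mem_filter.mp h).2 hpQ.2, hp⟩
      have hXQ : Q₀ ∪ P ⊆ Q := Finset.union_subset (Finset.filter_subset _ _)
        fun q hq => (Finset.mem_filter.mp (hPQ (Finset.mem_insert_of_mem hq))).1
      have hstep : (𝔼 z, f z * (∏ i ∈ J, F i z) * avoid (Q₀ ∪ insert p P) z)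
          = (𝔼 z, f z * (∏ i ∈ J, F i z) * avoid (Q₀ ∪ P) z)
            - 𝔼 z, f z * (∏ i ∈ J, F i z) * (if z p.1 = z p.2 then 1 else 0)
              * avoid (Q₀ ∪ P) z := by
        rw [← Finset.expect_sub_distrib]
        refine Finset.expect_congr rfl fun z _ => ?_
        rw [Finset.union_insert, avoid, Finset.prod_insert hpX, ← avoid]
        split_ifs <;> ring
      have hglue : |𝔼 z, f z * (∏ i ∈ J, F i z) * (if z p.1 = z p.2 then 1 else 0)
          * avoid (Q₀ ∪ P) z| ≤ B := by
        have hnot := hQU p hpQ.1 j hj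
        have hin := hQ p hpQ.1
        rcases hpQ.2 with h | h
        · exact glue_bound _ hXQ p.1 h p.2 (fun h' => hnot ⟨h, h'⟩) hin.2
        · have := glue_bound _ hXQ p.2 h p.1 (fun h' => hnot ⟨h', h⟩) hin.1
          simpa only [eq_comm] using this
      rw [hstep, Finset.card_insert_of_notMem hp]
      push_cast
      calc _ ≤ _ := abs_sub _ _
        _ ≤ P.card * B + B := add_le_add hP hglue
        _ = _ := by ring
  have hQeq : Q₀ ∪ (Q.filter fun p => p.1 ∈ U j ∨ p.2 ∈ U j) = Q := by
    rw [Finset.union_comm]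
    exact Finset.filter_union_filter_not_eq _ Q
  have hfin := incl _ subset_rfl
  rw [hQeq] at hfin
  have hc1 : ((Q.filter fun p => p.1 ∈ U j ∨ p.2 ∈ U j).card : ℝ) ≤ M ^ 2 :=
    le_trans (by exact_mod_cast Finset.card_filter_le _ _) hQM
  refine hfin.trans ((mul_le_mul_of_nonneg_right hc1 hB0).trans ?_)
  have hpow : M ^ 2 * (1 / n) * (M * ρ) ^ (J.card - 2) ≤ (M * ρ) ^ J.card := by
    rw [← hρ, ← mul_pow, ← pow_add]
    exact pow_le_pow_of_le_one hMρ0 hMρ (by omega)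
  have h0 : 0 ≤ b * ∏ i ∈ J, β i := mul_nonneg hf.nonneg (Finset.prod_nonneg hβ)
  calc M ^ 2 * B = b * (∏ i ∈ J, β i) * (M ^ 2 * (1 / n) * (M * ρ) ^ (J.card - 2)) := by
        rw [hB]
        ring
    _ ≤ _ := mul_le_mul_of_nonneg_left hpow h0

/-! ### Counting linked labelings of an edge set -/

/-- The nodes covered by a set of edges. -/
def verts {n : ℕ} (F : Finset (Sym2 (Fin n))) : Finset (Fin n) :=
  Finset.univ.filter fun x => ∃ e ∈ F, x ∈ e

lemma mem_verts {n : ℕ} {F : Finset (Sym2 (Fin n))} {x : Fin n} :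
    x ∈ verts F ↔ ∃ e ∈ F, x ∈ e := by
  simp [verts]

/-- The indicator that the labels of the endpoints of every edge of `F` form a pair of `Lk`. -/
def linkInd {n : ℕ} (Lk : Finset (Sym2 (Fin n))) (F : Finset (Sym2 (Fin n)))
    (z : Fin n → Fin n) : ℝ :=
  ∏ e ∈ F, if e.map z ∈ Lk then 1 else 0

lemma linkInd_nonneg {n : ℕ} (Lk F : Finset (Sym2 (Fin n))) (z : Fin n → Fin n) :
    0 ≤ linkInd Lk F z :=
  Finset.prod_nonneg fun p _ => by split_ifs <;> norm_num

lemma linkInd_le_one {n : ℕ} (Lk F : Finset (Sym2 (Fin n))) (z : Fin n → Fin n) :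
    linkInd Lk F z ≤ 1 :=
  Finset.prod_le_one (fun p _ => by split_ifs <;> norm_num) fun p _ => by split_ifs <;> norm_num

lemma dependsOn_linkInd {n : ℕ} (Lk F : Finset (Sym2 (Fin n))) :
    DependsOn (linkInd Lk F) (verts F) := by
  intro z w h
  refine Finset.prod_congr rfl fun e he => ?_
  have : e.map z = e.map w := by
    induction e using Sym2.ind with
    | _ x y =>
      rw [Sym2.map_mk, Sym2.map_mk, h x (mem_verts.mpr ⟨_, he, Sym2.mem_mk_left x y⟩),
        h y (mem_verts.mpr ⟨_, he, Sym2.mem_mk_right x y⟩)]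
  rw [this]

/-- Every nonempty set of nodes of `F` that avoids the anchors `M` is left by an edge of `F`;
equivalently, every connected component of `F` contains an anchor. -/
def Anchored {n : ℕ} (F : Finset (Sym2 (Fin n))) (M : Finset (Fin n)) : Prop :=
  ∀ X ⊆ verts F, X.Nonempty → Disjoint X M → ∃ x ∈ X, ∃ y ∉ X, s(x, y) ∈ F

/-- Attaching the nodes of `X` one at a time, each to a node already labelled: every attachment
leaves at most `κ` of the `n` labels. -/
lemma expect_mul_linkInd_le {n : ℕ} {Lk F : Finset (Sym2 (Fin n))} {κ : ℝ}
    (hκ : ∀ a, ((Finset.univ.filter fun b => s(a, b) ∈ Lk).card : ℝ) ≤ κ)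
    (X : Finset (Fin n))
    (hX : ∀ Y ⊆ X, Y.Nonempty → ∃ x ∈ Y, ∃ y ∉ Y, s(x, y) ∈ F)
    (h : (Fin n → Fin n) → ℝ) (h0 : ∀ z, 0 ≤ h z)
    (hdep : DependsOn h ((Finset.univ \ X : Finset (Fin n)) : Set (Fin n))) :
    (𝔼 z, h z * linkInd Lk F z) ≤ (κ / n) ^ X.card * 𝔼 z, h z := by
  induction hN : X.card generalizing X h with
  | zero =>
    rw [pow_zero, one_mul]
    exact Finset.expect_le_expect fun z _ => mul_le_of_le_one_right (h0 z) (linkInd_le_one _ _ _)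
  | succ N ih =>
    obtain ⟨x, hx, y, hy, he⟩ := hX X subset_rfl (Finset.card_pos.mp (by omega))
    have hxy : y ≠ x := fun hh => hy (hh ▸ hx)
    have hκ0 : 0 ≤ κ := le_trans (Nat.cast_nonneg _) (hκ x)
    have hn0 : (0 : ℝ) ≤ n := Nat.cast_nonneg n
    set h' : (Fin n → Fin n) → ℝ := fun z => h z * (if s(z y, z x) ∈ Lk then 1 else 0) with hh'
    have step1 : ∀ z, h z * linkInd Lk F z = h' z * linkInd Lk F z := by
      intro z
      simp only [hh']
      by_cases hz : s(z y, z x) ∈ Lk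
      · simp [hz]
      · have : linkInd Lk F z = 0 := by
          refine Finset.prod_eq_zero he ?_
          rw [Sym2.map_mk, Sym2.eq_swap, if_neg hz]
        simp [this]
    have step2 := ih (X.erase x) (fun Y hY => hX Y (hY.trans (Finset.erase_subset _ _))) h'
      (fun z => mul_nonneg (h0 z) (by split_ifs <;> norm_num))
      (by
        intro z w hzw
        have hz1 : h z = h w := hdep fun i hi => hzw i (by
          simp only [Finset.coe_sdiff, Finset.coe_univ, Set.mem_sdiff, Set.mem_univ, true_and,
            Finset.mem_coe, Finset.mem_erase, not_and] at hi ⊢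
          exact fun _ => hi)
        simp only [hh', hz1]
        rw [hzw x (by simp), hzw y (by simp [hy])])
      (by rw [Finset.card_erase_of_mem hx, hN]; rfl)
    have step3 : (𝔼 z, h' z) ≤ κ / n * 𝔼 z, h z := by
      rw [expect_eq_expect_update x h', Finset.mul_expect]
      refine Finset.expect_le_expect fun z _ => ?_
      have hz1 : ∀ c, h (Function.update z x c) = h z := fun c => hdep fun i hi => by
        have : i ≠ x := fun hh => by
          subst hh
          simp at hi
          exact hi hx
        rw [Function.update_of_ne this]
      simp only [hh', hz1, Function.update_of_ne hxy, Function.update_self]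
      rw [← Finset.mul_expect, mul_comm]
      refine mul_le_mul_of_nonneg_right ?_ (h0 z)
      rw [Fintype.expect_eq_sum_div_card, Fintype.card_fin]
      refine div_le_div_of_nonneg_right ?_ hn0
      rw [Finset.sum_boole]
      exact hκ (z y)
    calc _ = 𝔼 z, h' z * linkInd Lk F z := Finset.expect_congr rfl fun z _ => step1 z
      _ ≤ (κ / n) ^ N * 𝔼 z, h' z := step2
      _ ≤ (κ / n) ^ N * (κ / n * 𝔼 z, h z) :=
          mul_le_mul_of_nonneg_left step3 (pow_nonneg (div_nonneg hκ0 hn0) _)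
      _ = _ := by ring

lemma card_le_card_edges {n : ℕ} {F : Finset (Sym2 (Fin n))} (X : Finset (Fin n))
    (hX : ∀ Y ⊆ X, Y.Nonempty → ∃ x ∈ Y, ∃ y ∉ Y, s(x, y) ∈ F) :
    X.card ≤ (F.filter fun e => ∃ x ∈ X, x ∈ e).card := by
  induction hN : X.card generalizing X with
  | zero => exact Nat.zero_le _
  | succ N ih =>
    obtain ⟨x, hx, y, hy, he⟩ := hX X subset_rfl (Finset.card_pos.mp (by omega))
    have h1 := ih (X.erase x) (fun Y hY => hX Y (hY.trans (Finset.erase_subset _ _)))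
      (by rw [Finset.card_erase_of_mem hx, hN]; rfl)
    have h2 : (F.filter fun e => ∃ v ∈ X.erase x, v ∈ e) ⊂ F.filter fun e => ∃ v ∈ X, v ∈ e := by
      rw [Finset.ssubset_iff_of_subset]
      · refine ⟨s(x, y), Finset.mem_filter.mpr ⟨he, x, hx, Sym2.mem_mk_left x y⟩, ?_⟩
        simp only [Finset.mem_filter, not_and, not_exists]
        rintro _ v hv hve
        rcases Sym2.mem_iff.mp hve with rfl | rfl
        · exact (Finset.mem_erase.mp hv).1 rfl
        · exact hy (Finset.mem_erase.mp hv).2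
      · intro e
        simp only [Finset.mem_filter]
        rintro ⟨h, v, hv, hve⟩
        exact ⟨h, v, Finset.mem_of_mem_erase hv, hve⟩
    have h3 := Finset.card_lt_card h2
    omega

/-- Any prescribed node can be made an anchor, replacing an anchor of its own component, without
decreasing the number of nodes that are not anchors. -/
lemma Anchored.exists_mem {n : ℕ} {F : Finset (Sym2 (Fin n))} {M : Finset (Fin n)}
    (hM : Anchored F M) (u : Fin n) :
    ∃ M', u ∈ M' ∧ Anchored F M' ∧ (verts F \ M).card ≤ (verts F \ M').card := by
  classical
  by_cases hu : u ∈ verts F \ M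
  · let R : Fin n → Fin n → Prop := fun a b => s(a, b) ∈ F
    let Z : Finset (Fin n) := Finset.univ.filter fun y => Relation.ReflTransGen R u y
    have hZ : ∀ {y}, y ∈ Z ↔ Relation.ReflTransGen R u y := by simp [Z]
    obtain ⟨huF, huM⟩ := Finset.mem_sdiff.mp hu
    have hZF : Z ⊆ verts F := by
      intro y hy
      rcases Relation.ReflTransGen.cases_tail (hZ.mp hy) with h | ⟨c, _, hc⟩
      · exact h ▸ huF
      · exact mem_verts.mpr ⟨_, hc, Sym2.mem_mk_right c y⟩
    obtain ⟨m, hmZ, hmM⟩ : ∃ m ∈ Z, m ∈ M := by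
      by_contra hcon
      push Not at hcon
      obtain ⟨x, hx, y, hy, he⟩ := hM Z hZF ⟨u, hZ.mpr .refl⟩ (Finset.disjoint_left.mpr hcon)
      exact hy (hZ.mpr ((hZ.mp hx).tail he))
    have hum : u ≠ m := fun h => huM (h ▸ hmM)
    refine ⟨insert u (M.erase m), Finset.mem_insert_self _ _, ?_, ?_⟩
    · intro X hX hX0 hXM
      by_cases hmX : m ∈ X
      · by_contra hcon
        push Not at hcon
        have hout : ∀ y, Relation.ReflTransGen R u y → y ∉ X := by
          intro y hy
          induction hy with
          | refl => exact fun h => Finset.disjoint_left.mp hXM h (Finset.mem_insert_self _ _)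
          | tail _ hbc ih => exact fun hc => hcon _ hc _ ih (by rw [Sym2.eq_swap]; exact hbc)
        exact hout m (hZ.mp hmZ) hmX
      · refine hM X hX hX0 (Finset.disjoint_left.mpr fun v hv hvM => ?_)
        exact Finset.disjoint_left.mp hXM hv (Finset.mem_insert_of_mem
          (Finset.mem_erase.mpr ⟨fun h => hmX (h ▸ hv), hvM⟩))
    · have h1 : insert m ((verts F \ M).erase u) ⊆ verts F \ insert u (M.erase m) := by
        intro v hv
        simp only [Finset.mem_insert, Finset.mem_erase, Finset.mem_sdiff] at hv ⊢
        rcases hv with rfl | ⟨h1, h2, h3⟩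
        · exact ⟨hZF hmZ, by simp [hum.symm]⟩
        · exact ⟨h2, by simp [h1, h3]⟩
      have h2 := Finset.card_le_card h1
      rw [Finset.card_insert_of_notMem (by simp [hmM]), Finset.card_erase_of_mem hu] at h2
      have h3 := Finset.card_pos.mpr ⟨u, hu⟩
      omega
  · refine ⟨insert u M, Finset.mem_insert_self _ _, ?_, ?_⟩
    · intro X hX hX0 hXM
      exact hM X hX hX0 (hXM.mono_right (Finset.subset_insert _ _))
    · refine Finset.card_le_card fun v hv => ?_
      have hvu : v ≠ u := fun h => hu (h ▸ hv)
      simp only [Finset.mem_sdiff, Finset.mem_insert, not_or] at hv ⊢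
      exact ⟨hv.1, hvu, hv.2⟩

lemma expect_pin {n : ℕ} (u a : Fin n) :
    (𝔼 z : Fin n → Fin n, if z u = a then (1 : ℝ) else 0) = 1 / n := by
  have : Nonempty (Fin n) := ⟨u⟩
  rw [expect_eq_expect_update u]
  simp only [Function.update_self]
  rw [Fintype.expect_const, Fintype.expect_eq_sum_div_card]
  simp

/-- The numerical regime: the pairs in `Lk` link each label to at most `κ` labels, an edge used once
contributes the signal `ε`, an edge used twice the excess `η`, and `ρ = n ^ (-1/2)`. Attaching a
node by an edge costs `ε κ / n = (ε κ ρ) ρ`, of which `δ` bounds all but one factor `ρ`. -/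
structure Regime (n : ℕ) (Lk : Finset (Sym2 (Fin n))) (ε η κ ρ δ : ℝ) : Prop where
  n_pos : 0 < n
  degree_le : ∀ a, ((Finset.univ.filter fun b => s(a, b) ∈ Lk).card : ℝ) ≤ κ
  eps_nonneg : 0 ≤ ε
  eta_nonneg : 0 ≤ η
  rho_nonneg : 0 ≤ ρ
  rho_sq : ρ ^ 2 = 1 / n
  eps_le : ε ≤ δ
  eta_le : η ≤ δ
  attach_le : ε * κ * ρ ≤ δ
  rho_le : ρ ≤ 1

lemma Regime.pinned_le {n : ℕ} {Lk F : Finset (Sym2 (Fin n))} {ε η κ ρ δ : ℝ}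
    (h : Regime n Lk ε η κ ρ δ) {M : Finset (Fin n)} (hM : Anchored F M) (u a : Fin n) :
    ε ^ F.card * (𝔼 z : Fin n → Fin n, linkInd Lk F z * (if z u = a then 1 else 0))
      ≤ δ ^ F.card * ρ ^ (verts F \ M).card / n := by
  obtain ⟨M', huM', hM', hcard⟩ := hM.exists_mem u
  have hκ0 : 0 ≤ κ := le_trans (Nat.cast_nonneg _) (h.degree_le u)
  have hδ0 : 0 ≤ δ := h.eps_nonneg.trans h.eps_le
  have hn0 : (0 : ℝ) ≤ n := Nat.cast_nonneg n
  have hcut : ∀ Y ⊆ verts F \ M', Y.Nonempty → ∃ x ∈ Y, ∃ y ∉ Y, s(x, y) ∈ F :=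
    fun Y hY hY0 => hM' Y (hY.trans Finset.sdiff_subset) hY0
      (Finset.disjoint_of_subset_left hY Finset.sdiff_disjoint)
  set b := (verts F \ M').card with hb
  have hbF : b ≤ F.card := (card_le_card_edges _ hcut).trans (Finset.card_filter_le _ _)
  have h1 := expect_mul_linkInd_le (F := F) h.degree_le (verts F \ M') hcut
    (fun z => if z u = a then (1 : ℝ) else 0) (fun z => by split_ifs <;> norm_num)
    (by
      intro z w hzw
      have : z u = w u := hzw u (by simp [huM'])
      simp only [this])
  rw [expect_pin] at h1
  have h2 : κ / n = κ * ρ * ρ := by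
    rw [mul_assoc, ← sq, h.rho_sq]
    ring
  calc _ = ε ^ F.card * (𝔼 z : Fin n → Fin n, (if z u = a then 1 else 0) * linkInd Lk F z) := by
        congr 1
        exact Finset.expect_congr rfl fun z _ => mul_comm _ _
    _ ≤ ε ^ F.card * ((κ / n) ^ b * (1 / n)) :=
        mul_le_mul_of_nonneg_left h1 (pow_nonneg h.eps_nonneg _)
    _ = ε ^ (F.card - b) * (ε * κ * ρ) ^ b * ρ ^ b / n := by
        rw [h2, ← Nat.sub_add_cancel hbF, pow_add, Nat.add_sub_cancel]
        ring
    _ ≤ δ ^ (F.card - b) * δ ^ b * ρ ^ (verts F \ M).card / n := by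
        have hρ := h.rho_nonneg
        have hε := h.eps_nonneg
        refine div_le_div_of_nonneg_right ?_ hn0
        refine mul_le_mul (mul_le_mul (pow_le_pow_left₀ hε h.eps_le _)
          (pow_le_pow_left₀ (by positivity) h.attach_le _) (by positivity) (by positivity))
          (pow_le_pow_of_le_one hρ h.rho_le hcard) (by positivity) (by positivity)
    _ = _ := by rw [← pow_add, Nat.sub_add_cancel hbF]

lemma expect_le_of_pinned_le {n : ℕ} (hn : 0 < n) {g : (Fin n → Fin n) → ℝ} {b : ℝ}
    (h : ∀ u a, (𝔼 z : Fin n → Fin n, g z * (if z u = a then 1 else 0)) ≤ b / n) :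
    (𝔼 z, g z) ≤ b := by
  have hsplit : (𝔼 z, g z)
      = ∑ a : Fin n, 𝔼 z : Fin n → Fin n, g z * (if z ⟨0, hn⟩ = a then 1 else 0) := by
    rw [← Finset.expect_sum_comm]
    refine Finset.expect_congr rfl fun z _ => ?_
    rw [← Finset.mul_sum]
    simp
  rw [hsplit]
  refine (Finset.sum_le_sum fun a _ => h _ a).trans (le_of_eq ?_)
  have : (n : ℝ) ≠ 0 := by exact_mod_cast hn.ne'
  rw [Finset.sum_const, Finset.card_univ, Fintype.card_fin, nsmul_eq_mul]
  field_simp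

lemma Regime.expect_le {n : ℕ} {Lk F : Finset (Sym2 (Fin n))} {ε η κ ρ δ : ℝ}
    (h : Regime n Lk ε η κ ρ δ) {M : Finset (Fin n)} (hM : Anchored F M) :
    ε ^ F.card * (𝔼 z : Fin n → Fin n, linkInd Lk F z)
      ≤ δ ^ F.card * ρ ^ (verts F \ M).card := by
  rw [Finset.mul_expect]
  refine expect_le_of_pinned_le h.n_pos fun u a => ?_
  rw [← Finset.expect_congr rfl fun z _ => (mul_assoc _ _ _).symm, ← Finset.mul_expect]
  exact h.pinned_le hM u a

/-! ### Families of connected edge sets -/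

section Family

variable {n : ℕ} {ι : Type*}

/-- The number of members of the family that contain the edge `e`. -/
def mult (C : ι → Finset (Sym2 (Fin n))) (I : Finset ι) (e : Sym2 (Fin n)) : ℕ :=
  (I.filter fun i => e ∈ C i).card

/-- The edges that lie in exactly `r` members of the family. -/
def level (C : ι → Finset (Sym2 (Fin n))) (I : Finset ι) (r : ℕ) : Finset (Sym2 (Fin n)) :=
  Finset.univ.filter fun e => mult C I e = r

lemma mem_level {C : ι → Finset (Sym2 (Fin n))} {I : Finset ι} {r : ℕ} {e : Sym2 (Fin n)} :
    e ∈ level C I r ↔ mult C I e = r := by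
  simp [level]

/-- Each edge set of the family is nonempty and connected, in the sense that an edge leaves every
set of nodes that contains some but not all of its nodes. -/
structure ConnectedFamily (C : ι → Finset (Sym2 (Fin n))) (K : Finset ι) : Prop where
  nonempty : ∀ i ∈ K, (C i).Nonempty
  connected : ∀ i ∈ K, ∀ X : Finset (Fin n), (∃ x ∈ X, x ∈ verts (C i)) →
    (∃ y ∉ X, y ∈ verts (C i)) → ∃ x ∈ X, ∃ y ∉ X, s(x, y) ∈ C i

lemma ConnectedFamily.anchored {C : ι → Finset (Sym2 (Fin n))} {K : Finset ι}
    (hC : ConnectedFamily C K) {i : ι} (hi : i ∈ K) {m : Fin n} (hm : m ∈ verts (C i)) :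
    Anchored (C i) {m} := by
  intro X hX hX0 hXm
  obtain ⟨x, hx⟩ := hX0
  exact hC.connected i hi X ⟨x, hx, hX hx⟩
    ⟨m, fun h => Finset.disjoint_left.mp hXm h (Finset.mem_singleton_self m), hm⟩

/-- The conditional mean, given the latent assignment, of the product of the monomials of the
members of the family: `ε` times the link indicator for each edge used once, and one plus `η` times
the link indicator for each edge used twice. -/
def weight (ε η : ℝ) (Lk : Finset (Sym2 (Fin n))) (C : ι → Finset (Sym2 (Fin n)))
    (I : Finset ι) (z : Fin n → Fin n) : ℝ :=
  (∏ e ∈ level C I 1, ε * (if e.map z ∈ Lk then 1 else 0)) *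
    ∏ e ∈ level C I 2, (1 + η * (if e.map z ∈ Lk then 1 else 0))

/-- The mean of the monomial of an edge set. -/
noncomputable def Sampling.monoMean (s : Sampling) (ε : ℝ) (Lk F : Finset (Sym2 (Fin n))) : ℝ :=
  s.mean fun z => ε ^ F.card * linkInd Lk F z

/-- The conditional mean, given the latent assignment, of the product of the centred monomials of
the members of the family, expanded over the set of monomials kept. -/
noncomputable def centredWeight [DecidableEq ι] (s : Sampling) (ε η : ℝ)
    (Lk : Finset (Sym2 (Fin n))) (C : ι → Finset (Sym2 (Fin n))) (K : Finset ι)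
    (z : Fin n → Fin n) : ℝ :=
  ∑ I ∈ K.powerset, (∏ i ∈ K \ I, -s.monoMean ε Lk (C i)) * weight ε η Lk C I z

/-- The nodes that lie in at least two members of the family. -/
def shared [DecidableEq ι] (C : ι → Finset (Sym2 (Fin n))) (K : Finset ι) : Finset (Fin n) :=
  Finset.univ.filter fun x => ∃ i ∈ K, ∃ j ∈ K, i ≠ j ∧ x ∈ verts (C i) ∧ x ∈ verts (C j)

lemma mem_shared [DecidableEq ι] {C : ι → Finset (Sym2 (Fin n))} {K : Finset ι} {x : Fin n} :
    x ∈ shared C K ↔ ∃ i ∈ K, ∃ j ∈ K, i ≠ j ∧ x ∈ verts (C i) ∧ x ∈ verts (C j) := by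
  simp [shared]

lemma prod_eps_eq (ε : ℝ) (Lk F : Finset (Sym2 (Fin n))) (z : Fin n → Fin n) :
    (∏ e ∈ F, ε * (if e.map z ∈ Lk then 1 else 0)) = ε ^ F.card * linkInd Lk F z := by
  rw [Finset.prod_mul_distrib, Finset.prod_const, linkInd]

lemma card_verts_le (F : Finset (Sym2 (Fin n))) : (verts F).card ≤ 2 * F.card := by
  have h : verts F = F.biUnion Sym2.toFinset := by
    ext x
    simp [mem_verts]
  rw [h, mul_comm]
  refine Finset.card_biUnion_le_card_mul _ _ _ fun e _ => ?_
  rw [Sym2.card_toFinset]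
  split_ifs <;> norm_num

/-- A member of the family that shares no edge with the others splits off as a factor. -/
lemma centredWeight_insert [DecidableEq ι] (s : Sampling) (ε η : ℝ) (Lk : Finset (Sym2 (Fin n)))
    {C : ι → Finset (Sym2 (Fin n))} {K : Finset ι} {j : ι} (hj : j ∉ K)
    (hd : ∀ i ∈ K, Disjoint (C i) (C j)) (z : Fin n → Fin n) :
    centredWeight s ε η Lk C (insert j K) z
      = (ε ^ (C j).card * linkInd Lk (C j) z - s.monoMean ε Lk (C j))
        * centredWeight s ε η Lk C K z := by
  have hw : ∀ I ⊆ K, weight ε η Lk C (insert j I) z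
      = ε ^ (C j).card * linkInd Lk (C j) z * weight ε η Lk C I z := by
    intro I hI
    have hjI : j ∉ I := fun h => hj (hI h)
    have hm : ∀ e, mult C (insert j I) e = mult C I e + if e ∈ C j then 1 else 0 := by
      intro e
      unfold mult
      rw [Finset.filter_insert]
      split_ifs with he
      · rw [Finset.card_insert_of_notMem (by simp [hjI])]
      · rfl
    have hm0 : ∀ e ∈ C j, mult C I e = 0 := by
      intro e he
      rw [mult, Finset.card_eq_zero, Finset.filter_eq_empty_iff]
      exact fun i hi hei => Finset.disjoint_left.mp (hd i (hI hi)) hei he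
    have h1 : level C (insert j I) 1 = C j ∪ level C I 1 := by
      ext e
      rw [Finset.mem_union, mem_level, mem_level, hm]
      by_cases he : e ∈ C j
      · simp [he, hm0 e he]
      · simp [he]
    have h2 : level C (insert j I) 2 = level C I 2 := by
      ext e
      rw [mem_level, mem_level, hm]
      by_cases he : e ∈ C j
      · simp [he, hm0 e he]
      · simp [he]
    have hdis : Disjoint (C j) (level C I 1) := Finset.disjoint_left.mpr fun e he he' => by
      rw [mem_level, hm0 e he] at he'
      exact zero_ne_one he'
    rw [weight, h1, h2, Finset.prod_union hdis, prod_eps_eq, mul_assoc]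
    rfl
  rw [centredWeight, Finset.sum_powerset_insert hj, centredWeight, Finset.mul_sum,
    ← Finset.sum_add_distrib]
  refine Finset.sum_congr rfl fun I hI => ?_
  have hI' := Finset.mem_powerset.mp hI
  have hjI : j ∉ I := fun h => hj (hI' h)
  rw [hw I hI', Finset.insert_sdiff_of_notMem _ hjI, Finset.prod_insert (by simp [hj]),
    Finset.insert_sdiff_insert, Finset.sdiff_insert_of_notMem hj]
  ring

lemma centredWeight_union [DecidableEq ι] (s : Sampling) (ε η : ℝ) (Lk : Finset (Sym2 (Fin n)))
    {C : ι → Finset (Sym2 (Fin n))} {R : Finset ι} (J : Finset ι) (hJR : Disjoint J R)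
    (hd : ∀ j ∈ J, ∀ i ∈ J ∪ R, i ≠ j → Disjoint (C i) (C j)) (z : Fin n → Fin n) :
    centredWeight s ε η Lk C (J ∪ R) z
      = (∏ j ∈ J, (ε ^ (C j).card * linkInd Lk (C j) z - s.monoMean ε Lk (C j)))
        * centredWeight s ε η Lk C R z := by
  induction J using Finset.induction_on with
  | empty => simp
  | insert j J hj ih =>
    rw [Finset.disjoint_insert_left] at hJR
    rw [Finset.insert_union, Finset.prod_insert hj, centredWeight_insert, ih hJR.2, mul_assoc]
    · intro k hk i hi hne
      refine hd k (Finset.mem_insert_of_mem hk) i ?_ hne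
      rw [Finset.insert_union]
      exact Finset.mem_insert_of_mem hi
    · simp [hj, hJR.1]
    · intro i hi
      refine hd j (Finset.mem_insert_self _ _) i ?_ ?_
      · rw [Finset.insert_union]
        exact Finset.mem_insert_of_mem hi
      · rintro rfl
        simp [hj, hJR.1] at hi

lemma dependsOn_weight (ε η : ℝ) (Lk : Finset (Sym2 (Fin n))) (C : ι → Finset (Sym2 (Fin n)))
    {I K : Finset ι} (hI : I ⊆ K) :
    DependsOn (weight ε η Lk C I) (K.biUnion fun i => verts (C i) : Finset (Fin n)) := by
  intro z w h
  have key : ∀ e, mult C I e ≠ 0 → e.map z = e.map w := by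
    intro e he
    rw [mult, Finset.card_ne_zero] at he
    obtain ⟨i, hi⟩ := he
    obtain ⟨hiI, hei⟩ := Finset.mem_filter.mp hi
    induction e using Sym2.ind with
    | _ x y =>
      rw [Sym2.map_mk, Sym2.map_mk,
        h x (Finset.mem_biUnion.mpr ⟨i, hI hiI, mem_verts.mpr ⟨_, hei, Sym2.mem_mk_left x y⟩⟩),
        h y (Finset.mem_biUnion.mpr ⟨i, hI hiI, mem_verts.mpr ⟨_, hei, Sym2.mem_mk_right x y⟩⟩)]
  unfold weight
  congr 1
  · exact Finset.prod_congr rfl fun e he => by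
      rw [key e (by rw [mem_level.mp he]; norm_num)]
  · exact Finset.prod_congr rfl fun e he => by
      rw [key e (by rw [mem_level.mp he]; norm_num)]

lemma dependsOn_centredWeight [DecidableEq ι] (s : Sampling) (ε η : ℝ) (Lk : Finset (Sym2 (Fin n)))
    (C : ι → Finset (Sym2 (Fin n))) (K : Finset ι) :
    DependsOn (centredWeight s ε η Lk C K) (K.biUnion fun i => verts (C i) : Finset (Fin n)) := by
  intro z w h
  refine Finset.sum_congr rfl fun I hI => ?_
  rw [dependsOn_weight ε η Lk C (Finset.mem_powerset.mp hI) h]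

lemma exists_mem_of_mem_level_one {C : ι → Finset (Sym2 (Fin n))} {I : Finset ι}
    {e : Sym2 (Fin n)} (he : e ∈ level C I 1) : ∃ i ∈ I, e ∈ C i := by
  rw [mem_level] at he
  obtain ⟨i, hi⟩ := Finset.card_pos.mp (show 0 < (I.filter fun i => e ∈ C i).card by
    rw [mult] at he
    omega)
  exact ⟨i, (Finset.mem_filter.mp hi).1, (Finset.mem_filter.mp hi).2⟩

lemma mem_level_one_of_unique {C : ι → Finset (Sym2 (Fin n))} {I : Finset ι}
    {e : Sym2 (Fin n)} {i : ι} (hi : i ∈ I) (hei : e ∈ C i) (h : ∀ j ∈ I, e ∈ C j → j = i) :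
    e ∈ level C I 1 := by
  rw [mem_level, mult, Finset.card_eq_one]
  refine ⟨i, ?_⟩
  ext j
  simp only [Finset.mem_filter, Finset.mem_singleton]
  exact ⟨fun hj => h j hj.1 hj.2, fun hj => hj ▸ ⟨hi, hei⟩⟩

lemma mem_level_one_of_not_shared [DecidableEq ι] {C : ι → Finset (Sym2 (Fin n))}
    {I K : Finset ι} (hIK : I ⊆ K)
    {e : Sym2 (Fin n)} {i : ι} (hi : i ∈ I) (hei : e ∈ C i) {x : Fin n} (hxe : x ∈ e)
    (hx : x ∉ shared C K) : e ∈ level C I 1 := by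
  refine mem_level_one_of_unique hi hei fun j hj hej => ?_
  by_contra hne
  exact hx (mem_shared.mpr ⟨j, hIK hj, i, hIK hi, hne, mem_verts.mpr ⟨e, hej, hxe⟩,
    mem_verts.mpr ⟨e, hei, hxe⟩⟩)

/-- If all kept members meet the shared nodes, then so does every connected component of the edges
that are kept exactly once. -/
lemma ConnectedFamily.anchored_level_one [DecidableEq ι] {C : ι → Finset (Sym2 (Fin n))}
    {I K : Finset ι} (hC : ConnectedFamily C K) (hIK : I ⊆ K)
    (hI : ∀ i ∈ I, ∃ m ∈ verts (C i), m ∈ shared C K) :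
    Anchored (level C I 1) (shared C K) := by
  intro X hX hX0 hXM
  obtain ⟨x, hx⟩ := hX0
  obtain ⟨e, he, hxe⟩ := mem_verts.mp (hX hx)
  obtain ⟨i, hi, hei⟩ := exists_mem_of_mem_level_one he
  obtain ⟨m, hmi, hmM⟩ := hI i hi
  obtain ⟨x', hx', y, hy, he'⟩ := hC.connected i (hIK hi) X
    ⟨x, hx, mem_verts.mpr ⟨e, hei, hxe⟩⟩
    ⟨m, fun h => Finset.disjoint_left.mp hXM h hmM, hmi⟩
  exact ⟨x', hx', y, hy, mem_level_one_of_not_shared hIK hi he' (Sym2.mem_mk_left x' y)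
    (Finset.disjoint_left.mp hXM hx')⟩

end Family

/-! ### Connected edge sets as blocks -/

section FamilyBound

variable {n : ℕ} {ι : Type*}

lemma one_add_pow_le {x : ℝ} (hx : 0 ≤ x) (N : ℕ) (h : 2 * (N * x) ≤ 1) :
    (1 + x) ^ N ≤ 1 + 2 * (N * x) := by
  induction N with
  | zero => simp
  | succ N ih =>
    push_cast at h ⊢
    have h1 := ih (by nlinarith)
    have h2 : 0 ≤ (N : ℝ) * x := by positivity
    rw [pow_succ]
    nlinarith [mul_le_mul_of_nonneg_right h1 (by linarith : 0 ≤ 1 + x)]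

lemma card_level_le {C : ι → Finset (Sym2 (Fin n))} {I K : Finset ι} (hI : I ⊆ K) {r : ℕ}
    (hr : r ≠ 0) : (level C I r).card ≤ ∑ i ∈ K, (C i).card := by
  refine le_trans (Finset.card_le_card (t := K.biUnion C) fun e he => ?_) Finset.card_biUnion_le
  rw [mem_level] at he
  have : (I.filter fun i => e ∈ C i).Nonempty := by
    rw [← Finset.card_ne_zero]
    change mult C I e ≠ 0
    omega
  obtain ⟨i, hi⟩ := this
  obtain ⟨hiI, hei⟩ := Finset.mem_filter.mp hi
  exact Finset.mem_biUnion.mpr ⟨i, hI hiI, hei⟩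

lemma weight_nonneg {ε η : ℝ} (hε : 0 ≤ ε) (hη : 0 ≤ η) (Lk : Finset (Sym2 (Fin n)))
    (C : ι → Finset (Sym2 (Fin n))) (I : Finset ι) (z : Fin n → Fin n) :
    0 ≤ weight ε η Lk C I z :=
  mul_nonneg (Finset.prod_nonneg fun e _ => mul_nonneg hε (by split_ifs <;> norm_num))
    (Finset.prod_nonneg fun e _ => by split_ifs <;> linarith)

lemma weight_le {ε η : ℝ} (hε : 0 ≤ ε) (hη : 0 ≤ η) (Lk : Finset (Sym2 (Fin n)))
    (C : ι → Finset (Sym2 (Fin n))) {I K : Finset ι} (hI : I ⊆ K) {N : ℕ}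
    (hN : ∑ i ∈ K, (C i).card ≤ N) (z : Fin n → Fin n) :
    weight ε η Lk C I z
      ≤ (1 + η) ^ N * (ε ^ (level C I 1).card * linkInd Lk (level C I 1) z) := by
  rw [weight, prod_eps_eq, mul_comm]
  refine mul_le_mul_of_nonneg_right ?_
    (mul_nonneg (pow_nonneg hε _) (linkInd_nonneg _ _ _))
  calc _ ≤ ∏ e ∈ level C I 2, (1 + η) :=
        Finset.prod_le_prod (fun e _ => by split_ifs <;> linarith)
          fun e _ => by split_ifs <;> linarith
    _ = (1 + η) ^ (level C I 2).card := Finset.prod_const _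
    _ ≤ (1 + η) ^ N :=
        pow_le_pow_right₀ (by linarith) ((card_level_le hI two_ne_zero).trans hN)

lemma Sampling.monoMean_nonneg (s : Sampling) {ε : ℝ} (hε : 0 ≤ ε)
    (Lk F : Finset (Sym2 (Fin n))) : 0 ≤ s.monoMean ε Lk F :=
  s.mean_nonneg fun _ => mul_nonneg (pow_nonneg hε _) (linkInd_nonneg _ _ _)

lemma dependsOn_eps_linkInd (ε : ℝ) (Lk F : Finset (Sym2 (Fin n))) :
    DependsOn (fun z => ε ^ F.card * linkInd Lk F z) (verts F) :=
  fun _ _ h => by simp only [dependsOn_linkInd Lk F h]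

lemma Regime.monoMean_le {Lk F : Finset (Sym2 (Fin n))} {ε η κ ρ δ : ℝ}
    (h : Regime n Lk ε η κ ρ δ) (s : Sampling) (hF : 2 * ((verts F).card : ℝ) ^ 2 ≤ n)
    {M : Finset (Fin n)} (hM : Anchored F M) :
    s.monoMean ε Lk F ≤ 2 * (δ ^ F.card * ρ ^ (verts F \ M).card) := by
  refine (s.mean_le_two_mul_expect h.n_pos hF (dependsOn_eps_linkInd ε Lk F)
    fun z => mul_nonneg (pow_nonneg h.eps_nonneg _) (linkInd_nonneg _ _ _)).trans ?_
  rw [← Finset.mul_expect]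
  exact mul_le_mul_of_nonneg_left (h.expect_le hM) zero_le_two

/-- The part of the family whose members all meet the shared nodes forms one block. Every term of
its expansion costs `δ` per edge used once or removed, and `ρ` per node that is not shared. -/
lemma spread_centredWeight [DecidableEq ι] {Lk : Finset (Sym2 (Fin n))} {ε η κ ρ t : ℝ}
    (h : Regime n Lk ε η κ ρ (t ^ 2)) (ht0 : 0 ≤ t) (ht1 : t ≤ 1) (s : Sampling)
    {C : ι → Finset (Sym2 (Fin n))} {R K : Finset ι} (hC : ConnectedFamily C K) (hRK : R ⊆ K)
    (hR : ∀ i ∈ R, ∃ m ∈ verts (C i), m ∈ shared C K) {N : ℕ} (hN : ∑ i ∈ K, (C i).card ≤ N)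
    (hNn : 2 * (2 * (N : ℝ)) ^ 2 ≤ n) :
    Spread (centredWeight s ε η Lk C R) (R.biUnion fun i => verts (C i))
      ((1 + η) ^ N * (1 + 2 * t) ^ R.card * (t ^ (level C R 1).card *
        ρ ^ ((R.biUnion fun i => verts (C i)) \ shared C K).card)) := by
  have hρ0 := h.rho_nonneg
  have hη0 := h.eta_nonneg
  have hn0 : (0 : ℝ) ≤ n := Nat.cast_nonneg n
  set WR := R.biUnion fun i => verts (C i) with hWR
  have hpin : ∀ u a, (𝔼 z : Fin n → Fin n, |centredWeight s ε η Lk C R z| *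
      (if z u = a then 1 else 0)) ≤ (1 + η) ^ N * (1 + 2 * t) ^ R.card *
        (t ^ (level C R 1).card * ρ ^ (WR \ shared C K).card) / n := by
    intro u a
    have hterm : ∀ I ∈ R.powerset,
        (𝔼 z : Fin n → Fin n, (∏ i ∈ R \ I, s.monoMean ε Lk (C i)) * weight ε η Lk C I z *
          (if z u = a then 1 else 0))
        ≤ (1 + η) ^ N * (t ^ (level C R 1).card * ρ ^ (WR \ shared C K).card) / n *
          ((∏ _i ∈ I, (1 : ℝ)) * ∏ _i ∈ R \ I, (2 * t)) := by
      intro I hI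
      have hIR := Finset.mem_powerset.mp hI
      have hIK := hIR.trans hRK
      -- The mean of each removed member is bounded separately, anchored at a shared node.
      have hrem : (∏ i ∈ R \ I, s.monoMean ε Lk (C i)) ≤ 2 ^ (R \ I).card *
          ((t ^ 2) ^ (∑ i ∈ R \ I, (C i).card) *
            ρ ^ (∑ i ∈ R \ I, (verts (C i) \ shared C K).card)) := by
        rw [← Finset.prod_pow_eq_pow_sum, ← Finset.prod_pow_eq_pow_sum, ← Finset.prod_const,
          ← Finset.prod_mul_distrib, ← Finset.prod_mul_distrib]
        refine Finset.prod_le_prod (fun i _ => s.monoMean_nonneg h.eps_nonneg _ _) fun i hi => ?_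
        have hiR := (Finset.mem_sdiff.mp hi).1
        obtain ⟨m, hm, hmM⟩ := hR i hiR
        have hanch : Anchored (C i) (shared C K) := by
          intro X hX hX0 hXM
          exact hC.anchored (hRK hiR) hm X hX hX0
            (hXM.mono_right (Finset.singleton_subset_iff.mpr hmM))
        refine h.monoMean_le s ?_ hanch
        have h1 : ((verts (C i)).card : ℝ) ≤ 2 * N := by
          have h2 := card_verts_le (C i)
          have h3 : (C i).card ≤ ∑ i ∈ K, (C i).card :=
            Finset.single_le_sum (f := fun i => (C i).card) (fun _ _ => Nat.zero_le _) (hRK hiR)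
          exact_mod_cast (by omega : (verts (C i)).card ≤ 2 * N)
        have h2 : ((verts (C i)).card : ℝ) ^ 2 ≤ (2 * (N : ℝ)) ^ 2 :=
          pow_le_pow_left₀ (Nat.cast_nonneg _) h1 2
        linarith
      -- The edges kept exactly once are anchored at the shared nodes.
      have hkept : (𝔼 z : Fin n → Fin n, weight ε η Lk C I z * (if z u = a then 1 else 0))
          ≤ (1 + η) ^ N * ((t ^ 2) ^ (level C I 1).card *
            ρ ^ (verts (level C I 1) \ shared C K).card / n) := by
        have h1 := h.pinned_le (hC.anchored_level_one hIK fun i hi => hR i (hIR hi)) u a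
        refine le_trans (Finset.expect_le_expect (g := fun z : Fin n → Fin n => (1 + η) ^ N *
          (ε ^ (level C I 1).card * (linkInd Lk (level C I 1) z *
            (if z u = a then 1 else 0)))) fun z _ => ?_) ?_
        · rw [← mul_assoc, ← mul_assoc, mul_assoc ((1 + η) ^ N)]
          exact mul_le_mul_of_nonneg_right (weight_le h.eps_nonneg hη0 Lk C hIK hN z)
            (by split_ifs <;> norm_num)
        · rw [← Finset.mul_expect, ← Finset.mul_expect]
          exact mul_le_mul_of_nonneg_left h1 (by positivity)
      have hx1 : (level C R 1).card ≤ (level C I 1).card + ∑ i ∈ R \ I, (C i).card := by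
        refine le_trans (Finset.card_le_card
          (t := level C I 1 ∪ (R \ I).biUnion C) fun e he => ?_)
          ((Finset.card_union_le _ _).trans (Nat.add_le_add_left Finset.card_biUnion_le _))
        obtain ⟨i, hi, hei⟩ := exists_mem_of_mem_level_one he
        by_cases hiI : i ∈ I
        · refine Finset.mem_union_left _ (mem_level_one_of_unique hiI hei fun j hj hej => ?_)
          rw [mem_level, mult, Finset.card_eq_one] at he
          obtain ⟨k, hk⟩ := he
          have hik : i ∈ ({k} : Finset ι) := hk ▸ Finset.mem_filter.mpr ⟨hi, hei⟩
          have hjk : j ∈ ({k} : Finset ι) := hk ▸ Finset.mem_filter.mpr ⟨hIR hj, hej⟩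
          rw [Finset.mem_singleton] at hik hjk
          rw [hik, hjk]
        · exact Finset.mem_union_right _
            (Finset.mem_biUnion.mpr ⟨i, Finset.mem_sdiff.mpr ⟨hi, hiI⟩, hei⟩)
      have hx2 : (R \ I).card ≤ (level C I 1).card + ∑ i ∈ R \ I, (C i).card := by
        refine le_trans ?_ (Nat.le_add_left _ _)
        rw [Finset.card_eq_sum_ones]
        exact Finset.sum_le_sum fun i hi =>
          Finset.card_pos.mpr (hC.nonempty i (hRK (Finset.mem_sdiff.mp hi).1))
      have hy : (WR \ shared C K).card ≤ (verts (level C I 1) \ shared C K).card +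
          ∑ i ∈ R \ I, (verts (C i) \ shared C K).card := by
        refine le_trans (Finset.card_le_card (t := (verts (level C I 1) \ shared C K) ∪
          (R \ I).biUnion fun i => verts (C i) \ shared C K) fun v hv => ?_)
          ((Finset.card_union_le _ _).trans (Nat.add_le_add_left Finset.card_biUnion_le _))
        obtain ⟨hvW, hvM⟩ := Finset.mem_sdiff.mp hv
        obtain ⟨i, hi, hvi⟩ := Finset.mem_biUnion.mp hvW
        by_cases hiI : i ∈ I
        · obtain ⟨e, he, hve⟩ := mem_verts.mp hvi
          exact Finset.mem_union_left _ (Finset.mem_sdiff.mpr ⟨mem_verts.mpr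
            ⟨e, mem_level_one_of_not_shared hIK hiI he hve hvM, hve⟩, hvM⟩)
        · exact Finset.mem_union_right _ (Finset.mem_biUnion.mpr
            ⟨i, Finset.mem_sdiff.mpr ⟨hi, hiI⟩, Finset.mem_sdiff.mpr ⟨hvi, hvM⟩⟩)
      have hcost : (t ^ 2) ^ ((level C I 1).card + ∑ i ∈ R \ I, (C i).card)
          ≤ t ^ (level C R 1).card * t ^ (R \ I).card := by
        rw [← pow_mul, ← pow_add]
        exact pow_le_pow_of_le_one ht0 ht1 (by omega)
      have hcost' : ρ ^ ((verts (level C I 1) \ shared C K).card +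
          ∑ i ∈ R \ I, (verts (C i) \ shared C K).card) ≤ ρ ^ (WR \ shared C K).card :=
        pow_le_pow_of_le_one hρ0 h.rho_le hy
      calc _ = (∏ i ∈ R \ I, s.monoMean ε Lk (C i)) *
            𝔼 z : Fin n → Fin n, weight ε η Lk C I z * (if z u = a then 1 else 0) := by
            rw [Finset.mul_expect]
            exact Finset.expect_congr rfl fun z _ => mul_assoc _ _ _
        _ ≤ (2 ^ (R \ I).card * ((t ^ 2) ^ (∑ i ∈ R \ I, (C i).card) *
            ρ ^ (∑ i ∈ R \ I, (verts (C i) \ shared C K).card))) *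
            ((1 + η) ^ N * ((t ^ 2) ^ (level C I 1).card *
            ρ ^ (verts (level C I 1) \ shared C K).card / n)) := by
            refine mul_le_mul hrem hkept (Finset.expect_nonneg fun z _ =>
              mul_nonneg (weight_nonneg h.eps_nonneg hη0 _ _ _ _) (by split_ifs <;> norm_num))
              (by positivity)
        _ = (1 + η) ^ N * 2 ^ (R \ I).card / n *
            ((t ^ 2) ^ ((level C I 1).card + ∑ i ∈ R \ I, (C i).card) *
            ρ ^ ((verts (level C I 1) \ shared C K).card +
              ∑ i ∈ R \ I, (verts (C i) \ shared C K).card)) := by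
            rw [pow_add, pow_add]
            ring
        _ ≤ (1 + η) ^ N * 2 ^ (R \ I).card / n *
            (t ^ (level C R 1).card * t ^ (R \ I).card * ρ ^ (WR \ shared C K).card) :=
            mul_le_mul_of_nonneg_left (mul_le_mul hcost hcost' (by positivity) (by positivity))
              (by positivity)
        _ = _ := by
            rw [Finset.prod_const_one, Finset.prod_const, mul_pow]
            ring
    have habs : ∀ z : Fin n → Fin n,
        |centredWeight s ε η Lk C R z| * (if z u = a then 1 else 0)
        ≤ ∑ I ∈ R.powerset, (∏ i ∈ R \ I, s.monoMean ε Lk (C i)) * weight ε η Lk C I z *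
          (if z u = a then 1 else 0) := by
      intro z
      rw [← Finset.sum_mul]
      refine mul_le_mul_of_nonneg_right ((Finset.abs_sum_le_sum_abs _ _).trans
        (Finset.sum_le_sum fun I _ => le_of_eq ?_)) (by split_ifs <;> norm_num)
      rw [abs_mul, Finset.abs_prod, abs_of_nonneg (weight_nonneg h.eps_nonneg hη0 _ _ _ _)]
      congr 1
      refine Finset.prod_congr rfl fun i _ => ?_
      rw [abs_neg, abs_of_nonneg (s.monoMean_nonneg h.eps_nonneg _ _)]
    refine (Finset.expect_le_expect fun z _ => habs z).trans ?_
    rw [Finset.expect_sum_comm]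
    refine (Finset.sum_le_sum hterm).trans (le_of_eq ?_)
    rw [← Finset.mul_sum, ← Finset.prod_add, Finset.prod_const]
    ring
  exact ⟨dependsOn_centredWeight s ε η Lk C R, expect_le_of_pinned_le h.n_pos hpin,
    fun u _ a => hpin u a⟩

/-- A connected edge set that meets no other member of the family, restricted to the assignments
allowed on its own nodes, forms a centred block. -/
lemma spread_single {Lk F : Finset (Sym2 (Fin n))} {ε η κ ρ δ : ℝ}
    (h : Regime n Lk ε η κ ρ δ) (s : Sampling) (hF : 2 * ((verts F).card : ℝ) ^ 2 ≤ n)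
    {m : Fin n} (hm : m ∈ verts F) (hM : Anchored F {m}) :
    Spread (fun z => (ε ^ F.card * linkInd Lk F z - s.monoMean ε Lk F) *
        avoid (s.exclusions (verts F)) z) (verts F)
      (3 * (δ ^ F.card * ρ ^ ((verts F).card - 1))) ∧
    (𝔼 z, (ε ^ F.card * linkInd Lk F z - s.monoMean ε Lk F) *
        avoid (s.exclusions (verts F)) z) = 0 := by
  have hcard : (verts F \ {m}).card = (verts F).card - 1 := by
    rw [Finset.sdiff_singleton_eq_erase, Finset.card_erase_of_mem hm]
  have hdep := dependsOn_eps_linkInd ε Lk F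
  have hmono := h.monoMean_le s hF hM
  have hmono0 := s.monoMean_nonneg h.eps_nonneg Lk F
  have hn0 : (0 : ℝ) ≤ n := Nat.cast_nonneg n
  rw [hcard] at hmono
  have hpin : ∀ u a, (𝔼 z : Fin n → Fin n, |(ε ^ F.card * linkInd Lk F z - s.monoMean ε Lk F) *
        avoid (s.exclusions (verts F)) z| * (if z u = a then 1 else 0))
      ≤ 3 * (δ ^ F.card * ρ ^ ((verts F).card - 1)) / n := by
    intro u a
    have h1 := h.pinned_le hM u a
    rw [hcard, Finset.mul_expect] at h1
    have h2 : ∀ z : Fin n → Fin n, |(ε ^ F.card * linkInd Lk F z - s.monoMean ε Lk F) *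
        avoid (s.exclusions (verts F)) z| * (if z u = a then 1 else 0)
        ≤ ε ^ F.card * (linkInd Lk F z * (if z u = a then 1 else 0))
          + s.monoMean ε Lk F * (if z u = a then 1 else 0) := by
      intro z
      rw [← mul_assoc, ← add_mul]
      refine mul_le_mul_of_nonneg_right ?_ (by split_ifs <;> norm_num)
      rw [abs_mul, abs_of_nonneg (avoid_nonneg _ _)]
      refine (mul_le_of_le_one_right (abs_nonneg _) (avoid_le_one _ _)).trans ?_
      refine (abs_sub _ _).trans (le_of_eq ?_)
      rw [abs_of_nonneg hmono0,
        abs_of_nonneg (mul_nonneg (pow_nonneg h.eps_nonneg _) (linkInd_nonneg _ _ _))]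
    refine (Finset.expect_le_expect fun z _ => h2 z).trans ?_
    rw [Finset.expect_add_distrib, ← Finset.mul_expect _ _ (s.monoMean ε Lk F), expect_pin]
    calc _ ≤ δ ^ F.card * ρ ^ ((verts F).card - 1) / n
          + 2 * (δ ^ F.card * ρ ^ ((verts F).card - 1)) * (1 / n) :=
          add_le_add h1 (mul_le_mul_of_nonneg_right hmono (by positivity))
      _ = _ := by ring
  refine ⟨⟨?_, expect_le_of_pinned_le h.n_pos hpin, fun u _ a => hpin u a⟩, ?_⟩
  · intro z w hzw
    have h1 : linkInd Lk F z = linkInd Lk F w := dependsOn_linkInd Lk F hzw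
    have h2 : avoid (s.exclusions (verts F)) z = avoid (s.exclusions (verts F)) w :=
      dependsOn_avoid (fun p hp => by
        have := Finset.mem_offDiag.mp (s.exclusions_subset _ hp)
        exact ⟨this.1, this.2.1⟩) hzw
    simp only [h1, h2]
  · simp only [sub_mul]
    rw [Finset.expect_sub_distrib, ← s.mean_mul_expect_avoid hdep, ← Finset.mul_expect]
    exact sub_self _

end FamilyBound

/-! ### The mean of a product of centred monomials -/

lemma Sampling.mem_exclusions {s : Sampling} {n : ℕ} {W : Finset (Fin n)} {p : Fin n × Fin n} :
    p ∈ s.exclusions W ↔ s = .permutation ∧ p.1 ∈ W ∧ p.2 ∈ W ∧ p.1 ≠ p.2 := by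
  cases s <;> simp [Sampling.exclusions]

/-- The exclusions inside `W` are those inside the disjoint blocks `U j` and the remaining ones. -/
lemma avoid_exclusions_eq {n : ℕ} {ι : Type*} (s : Sampling) {W : Finset (Fin n)} {J : Finset ι}
    {U : ι → Finset (Fin n)} (hUW : ∀ j ∈ J, U j ⊆ W)
    (hU : ∀ i ∈ J, ∀ j ∈ J, i ≠ j → Disjoint (U i) (U j)) (z : Fin n → Fin n) :
    avoid (s.exclusions W) z = (∏ j ∈ J, avoid (s.exclusions (U j)) z) *
      avoid ((s.exclusions W).filter fun p => ∀ j ∈ J, ¬(p.1 ∈ U j ∧ p.2 ∈ U j)) z := by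
  have h1 : (s.exclusions W).filter (fun p => ¬∀ j ∈ J, ¬(p.1 ∈ U j ∧ p.2 ∈ U j))
      = J.biUnion fun j => s.exclusions (U j) := by
    ext p
    simp only [Finset.mem_filter, Finset.mem_biUnion, Sampling.mem_exclusions, not_forall, not_not]
    constructor
    · rintro ⟨⟨hs, _, _, hne⟩, j, hj, h1, h2⟩
      exact ⟨j, hj, hs, h1, h2, hne⟩
    · rintro ⟨j, hj, hs, h1, h2, hne⟩
      exact ⟨⟨hs, hUW j hj h1, hUW j hj h2, hne⟩, j, hj, h1, h2⟩
  unfold avoid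
  rw [← Finset.prod_filter_mul_prod_filter_not (s.exclusions W)
    (fun p => ∀ j ∈ J, ¬(p.1 ∈ U j ∧ p.2 ∈ U j)), h1, mul_comm, Finset.prod_biUnion]
  intro i hi j hj hij
  refine Finset.disjoint_left.mpr fun p hp hp' => ?_
  rw [Sampling.mem_exclusions] at hp hp'
  exact Finset.disjoint_left.mp (hU i hi j hj hij) hp.2.1 hp'.2.1

/-- The mean of a product of centred monomials of connected edge sets costs `t` for each edge used
exactly once and `ρ` for each node used exactly once. -/
theorem abs_mean_centredWeight_le {n : ℕ} {ι : Type*} [DecidableEq ι] {Lk : Finset (Sym2 (Fin n))}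
    {ε η κ ρ t : ℝ} (h : Regime n Lk ε η κ ρ (t ^ 2)) (ht0 : 0 ≤ t) (ht1 : t ≤ 1) (hρt : ρ ≤ t)
    (s : Sampling) {C : ι → Finset (Sym2 (Fin n))} {K : Finset ι} (hC : ConnectedFamily C K)
    {N : ℕ} (hN : ∑ i ∈ K, (C i).card ≤ N) (hNt : 12 * (N * t) ≤ 1) :
    |s.mean (centredWeight s ε η Lk C K)| ≤ 8 * (t ^ (level C K 1).card *
      ρ ^ ((K.biUnion fun i => verts (C i)) \ shared C K).card) := by
  have hρ0 := h.rho_nonneg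
  have hn : (0 : ℝ) < n := by exact_mod_cast h.n_pos
  have hNt0 : 0 ≤ N * t := by positivity
  have hNρ : N * ρ ≤ N * t := mul_le_mul_of_nonneg_left hρt (Nat.cast_nonneg N)
  have hNρ0 : 0 ≤ N * ρ := by positivity
  have hNn : 2 * (2 * (N : ℝ)) ^ 2 ≤ n := by
    have h1 : 8 * (N * ρ) ^ 2 ≤ 1 := by nlinarith
    rw [mul_pow, h.rho_sq, mul_one_div, ← mul_div_assoc, div_le_one hn] at h1
    linarith
  set V : ι → Finset (Fin n) := fun i => verts (C i) with hV
  set W := K.biUnion V with hW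
  set J := K.filter fun i => ¬∃ m ∈ V i, m ∈ shared C K with hJ
  set R := K.filter fun i => ∃ m ∈ V i, m ∈ shared C K with hR
  have hJK : J ⊆ K := Finset.filter_subset _ _
  have hRK : R ⊆ K := Finset.filter_subset _ _
  have hJR : Disjoint J R := (Finset.disjoint_filter_filter_not K K _).symm
  have hKeq : J ∪ R = K := by
    rw [Finset.union_comm]
    exact Finset.filter_union_filter_not_eq _ K
  have hcard1 : ∀ i ∈ K, (C i).card ≤ N := fun i hi =>
    (Finset.single_le_sum (f := fun i => (C i).card) (fun _ _ => Nat.zero_le _) hi).trans hN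
  have hVsmall : ∀ i ∈ K, 2 * ((V i).card : ℝ) ^ 2 ≤ n := by
    intro i hi
    have h1 : ((V i).card : ℝ) ≤ 2 * N := by
      have h2 := card_verts_le (C i)
      have h3 := hcard1 i hi
      exact_mod_cast (by omega : (verts (C i)).card ≤ 2 * N)
    have h2 := pow_le_pow_left₀ (Nat.cast_nonneg _) h1 2
    linarith
  have hWcard : (W.card : ℝ) ≤ 2 * N := by
    have h1 : W.card ≤ ∑ i ∈ K, 2 * (C i).card :=
      Finset.card_biUnion_le.trans (Finset.sum_le_sum fun i _ => card_verts_le (C i))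
    rw [← Finset.mul_sum] at h1
    exact_mod_cast h1.trans (Nat.mul_le_mul_left 2 hN)
  have hWsmall : 2 * (W.card : ℝ) ^ 2 ≤ n := by
    have h2 := pow_le_pow_left₀ (Nat.cast_nonneg _) hWcard 2
    linarith
  -- A member without shared nodes is disjoint from all the others.
  have hdisj : ∀ j ∈ J, ∀ i ∈ K, i ≠ j → Disjoint (V i) (V j) := by
    intro j hj i hi hne
    obtain ⟨hjK, hjM⟩ := Finset.mem_filter.mp hj
    refine Finset.disjoint_left.mpr fun v hvi hvj => hjM ⟨v, hvj, ?_⟩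
    exact mem_shared.mpr ⟨i, hi, j, hjK, hne, hvi, hvj⟩
  have hdisjC : ∀ j ∈ J, ∀ i ∈ J ∪ R, i ≠ j → Disjoint (C i) (C j) := by
    intro j hj i hi hne
    rw [hKeq] at hi
    refine Finset.disjoint_left.mpr fun e hei hej => ?_
    induction e using Sym2.ind with
    | _ x y =>
      exact Finset.disjoint_left.mp (hdisj j hj i hi hne)
        (mem_verts.mpr ⟨_, hei, Sym2.mem_mk_left x y⟩)
        (mem_verts.mpr ⟨_, hej, Sym2.mem_mk_left x y⟩)
  have hex : ∀ j ∈ J, ∃ m, m ∈ V j := by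
    intro j hj
    obtain ⟨e, he⟩ := hC.nonempty j (hJK hj)
    induction e using Sym2.ind with
    | _ x y => exact ⟨x, mem_verts.mpr ⟨_, he, Sym2.mem_mk_left x y⟩⟩
  have hsingle := fun j (hj : j ∈ J) => spread_single h s (hVsmall j (hJK hj))
    (hex j hj).choose_spec (hC.anchored (hJK hj) (hex j hj).choose_spec)
  have hblock := spread_centredWeight h ht0 ht1 s hC hRK
    (fun i hi => (Finset.mem_filter.mp hi).2) hN hNn
  set Q := (s.exclusions W).filter fun p => ∀ j ∈ J, ¬(p.1 ∈ V j ∧ p.2 ∈ V j) with hQ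
  have hWU : W = R.biUnion V ∪ J.biUnion V := by
    rw [hW, ← hKeq, Finset.union_biUnion, Finset.union_comm]
  have hQM : (Q.card : ℝ) ≤ (2 * (N : ℝ)) ^ 2 := by
    have h1 : Q.card ≤ W.card ^ 2 := by
      refine (Finset.card_le_card ((Finset.filter_subset _ _).trans
        (s.exclusions_subset W))).trans ?_
      rw [Finset.offDiag_card, sq]
      omega
    have h2 : (Q.card : ℝ) ≤ (W.card : ℝ) ^ 2 := by exact_mod_cast h1
    exact h2.trans (pow_le_pow_left₀ (Nat.cast_nonneg _) hWcard 2)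
  have hmain := abs_expect_prod_mul_avoid_le (M := 2 * N) hρ0 h.rho_sq (by positivity)
    (by linarith) J
    (fun j hj => (hsingle j hj).1) (fun j hj => (hsingle j hj).2)
    (fun i hi j hj hij => hdisj j hj i (hJK hi) hij) hblock
    (fun j hj => (Finset.disjoint_biUnion_left R V _).mpr fun i hi =>
      hdisj j hj i (hRK hi) fun hij => Finset.disjoint_left.mp hJR hj (hij ▸ hi))
    (Q := Q) (fun p hp => by
      have := Finset.mem_offDiag.mp (s.exclusions_subset W (Finset.mem_filter.mp hp).1)
      rw [← hWU]
      exact ⟨this.1, this.2.1⟩)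
    (fun p hp => (Finset.mem_filter.mp hp).2) hQM
  have hmean := s.mean_mul_expect_avoid (W := W) (dependsOn_centredWeight s ε η Lk C K)
  have hfac : (𝔼 z : Fin n → Fin n, centredWeight s ε η Lk C K z * avoid (s.exclusions W) z)
      = 𝔼 z, centredWeight s ε η Lk C R z * (∏ j ∈ J,
        (ε ^ (C j).card * linkInd Lk (C j) z - s.monoMean ε Lk (C j)) *
          avoid (s.exclusions (V j)) z) * avoid Q z := by
    refine Finset.expect_congr rfl fun z _ => ?_
    conv_lhs => rw [← hKeq]
    rw [centredWeight_union s ε η Lk J hJR hdisjC, avoid_exclusions_eq s (J := J) (U := V)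
      (fun j hj => Finset.subset_biUnion_of_mem V (hJK hj))
      (fun i hi j hj hij => hdisj j hj i (hJK hi) hij), Finset.prod_mul_distrib]
    ring
  have hhalf := half_le_expect_avoid s h.n_pos W hWsmall
  rw [← hfac, ← hmean, abs_mul, abs_of_nonneg (by linarith :
    0 ≤ 𝔼 z : Fin n → Fin n, avoid (s.exclusions W) z)] at hmain
  -- The smallness of `N t` absorbs the factors that depend on the number of edges.
  have hη1 : (1 + η) ^ N ≤ 2 := by
    have h1 : N * η ≤ N * t := mul_le_mul_of_nonneg_left
      (h.eta_le.trans (by nlinarith)) (Nat.cast_nonneg N)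
    refine (one_add_pow_le h.eta_nonneg N (by linarith)).trans (by linarith)
  have hKN : R.card ≤ N := by
    refine (Finset.card_le_card hRK).trans (le_trans ?_ hN)
    rw [Finset.card_eq_sum_ones]
    exact Finset.sum_le_sum fun i hi => Finset.card_pos.mpr (hC.nonempty i hi)
  have ht2 : (1 + 2 * t) ^ R.card ≤ 2 := by
    refine (pow_le_pow_right₀ (by linarith) hKN).trans ?_
    refine (one_add_pow_le (by linarith) N (by linarith)).trans (by linarith)
  have hconst : (1 + η) ^ N * (1 + 2 * t) ^ R.card ≤ 4 := by
    calc _ ≤ (2 : ℝ) * 2 := mul_le_mul hη1 ht2 (by positivity) (by norm_num)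
      _ = 4 := by norm_num
  have hprod : (∏ j ∈ J, (3 * ((t ^ 2) ^ (C j).card * ρ ^ ((V j).card - 1)))) *
      (2 * N * ρ) ^ J.card ≤ t ^ (∑ j ∈ J, (C j).card) * ρ ^ (∑ j ∈ J, (V j).card) := by
    rw [← Finset.prod_const, ← Finset.prod_mul_distrib, ← Finset.prod_pow_eq_pow_sum,
      ← Finset.prod_pow_eq_pow_sum, ← Finset.prod_mul_distrib]
    refine Finset.prod_le_prod (fun j _ => by positivity) fun j hj => ?_
    have hCpos : 1 ≤ (C j).card := Finset.card_pos.mpr (hC.nonempty j (hJK hj))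
    have hVpos : 1 ≤ (V j).card := Finset.card_pos.mpr (hex j hj)
    have h1 : ρ ^ ((V j).card - 1) * ρ = ρ ^ (V j).card := by
      rw [← pow_succ, Nat.sub_add_cancel hVpos]
    have h2 : 6 * N * t ^ (C j).card ≤ 1 := by
      have h3 : t ^ (C j).card ≤ t := pow_le_of_le_one ht0 ht1 (by omega)
      have h4 := mul_le_mul_of_nonneg_left h3 (Nat.cast_nonneg (α := ℝ) N)
      linarith
    calc _ = 6 * N * t ^ (C j).card * (t ^ (C j).card * (ρ ^ ((V j).card - 1) * ρ)) := by ring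
      _ ≤ 1 * (t ^ (C j).card * (ρ ^ ((V j).card - 1) * ρ)) :=
          mul_le_mul_of_nonneg_right h2 (by positivity)
      _ = _ := by rw [one_mul, h1]
  have hx : (level C K 1).card ≤ (level C R 1).card + ∑ j ∈ J, (C j).card := by
    refine le_trans (Finset.card_le_card (t := level C R 1 ∪ J.biUnion C) fun e he => ?_)
      ((Finset.card_union_le _ _).trans (Nat.add_le_add_left Finset.card_biUnion_le _))
    obtain ⟨i, hi, hei⟩ := exists_mem_of_mem_level_one he
    rw [← hKeq, Finset.mem_union] at hi
    rcases hi with hi | hi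
    · exact Finset.mem_union_right _ (Finset.mem_biUnion.mpr ⟨i, hi, hei⟩)
    · refine Finset.mem_union_left _ (mem_level_one_of_unique hi hei fun j hj hej => ?_)
      rw [mem_level, mult, Finset.card_eq_one] at he
      obtain ⟨k, hk⟩ := he
      have hik : i ∈ ({k} : Finset ι) := hk ▸ Finset.mem_filter.mpr ⟨hRK hi, hei⟩
      have hjk : j ∈ ({k} : Finset ι) := hk ▸ Finset.mem_filter.mpr ⟨hRK hj, hej⟩
      rw [Finset.mem_singleton] at hik hjk
      rw [hik, hjk]
  have hy : (W \ shared C K).card ≤ (R.biUnion V \ shared C K).card + ∑ j ∈ J, (V j).card := by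
    refine le_trans (Finset.card_le_card
      (t := (R.biUnion V \ shared C K) ∪ J.biUnion V) fun v hv => ?_)
      ((Finset.card_union_le _ _).trans (Nat.add_le_add_left Finset.card_biUnion_le _))
    obtain ⟨hvW, hvM⟩ := Finset.mem_sdiff.mp hv
    rw [hWU, Finset.mem_union] at hvW
    rcases hvW with hvW | hvW
    · exact Finset.mem_union_left _ (Finset.mem_sdiff.mpr ⟨hvW, hvM⟩)
    · exact Finset.mem_union_right _ hvW
  have hfinal : |s.mean (centredWeight s ε η Lk C K)| * (1 / 2) ≤
      4 * (t ^ (level C K 1).card * ρ ^ (W \ shared C K).card) := by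
    calc _ ≤ |s.mean (centredWeight s ε η Lk C K)| *
          𝔼 z : Fin n → Fin n, avoid (s.exclusions W) z :=
          mul_le_mul_of_nonneg_left hhalf (abs_nonneg _)
      _ ≤ _ := hmain
      _ = (1 + η) ^ N * (1 + 2 * t) ^ R.card *
          (t ^ (level C R 1).card * ρ ^ (R.biUnion V \ shared C K).card) *
          ((∏ j ∈ J, (3 * ((t ^ 2) ^ (C j).card * ρ ^ ((V j).card - 1)))) *
            (2 * N * ρ) ^ J.card) := by ring
      _ ≤ 4 * (t ^ (level C R 1).card * ρ ^ (R.biUnion V \ shared C K).card) *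
          (t ^ (∑ j ∈ J, (C j).card) * ρ ^ (∑ j ∈ J, (V j).card)) :=
          mul_le_mul (mul_le_mul_of_nonneg_right hconst (by positivity)) hprod (by positivity)
            (by positivity)
      _ = 4 * (t ^ ((level C R 1).card + ∑ j ∈ J, (C j).card) *
          ρ ^ ((R.biUnion V \ shared C K).card + ∑ j ∈ J, (V j).card)) := by
          rw [pow_add, pow_add]
          ring
      _ ≤ _ := by
          refine mul_le_mul_of_nonneg_left ?_ (by norm_num)
          exact mul_le_mul (pow_le_pow_of_le_one ht0 ht1 hx)
            (pow_le_pow_of_le_one hρ0 h.rho_le hy) (by positivity) (by positivity)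
  linarith

/-! ### Conditional moments of the observed graph -/

/-- The pairs `i < j` of nodes. -/
def orderedPairs (n : ℕ) : Finset (Fin n × Fin n) :=
  (Finset.univ : Finset (Fin n × Fin n)).filter fun p => p.1 < p.2

open Classical in
/-- Summing a product of edge factors over all graphs. -/
lemma sum_graph_prod {n : ℕ} (u v : Fin n × Fin n → ℝ) :
    (∑ A : SimpleGraph (Fin n), ∏ p ∈ orderedPairs n, if A.Adj p.1 p.2 then u p else v p)
      = ∏ p ∈ orderedPairs n, (u p + v p) := by
  rw [Finset.prod_add]
  refine Finset.sum_bij (fun A _ => (orderedPairs n).filter fun p => A.Adj p.1 p.2) ?_ ?_ ?_ ?_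
  · exact fun A _ => Finset.mem_powerset.mpr (Finset.filter_subset _ _)
  · intro A _ B _ h
    have key : ∀ i j, i < j → (A.Adj i j ↔ B.Adj i j) := by
      intro i j hij
      have hp : (i, j) ∈ orderedPairs n := by simpa [orderedPairs] using hij
      have := Finset.ext_iff.mp h (i, j)
      simpa [Finset.mem_filter, hp] using this
    ext i j
    rcases lt_trichotomy i j with hij | rfl | hij
    · exact key i j hij
    · simp
    · rw [A.adj_comm, B.adj_comm]
      exact key j i hij
  · intro T hT
    have hT' := Finset.mem_powerset.mp hT
    refine ⟨SimpleGraph.fromRel fun i j => (i, j) ∈ T, Finset.mem_univ _, ?_⟩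
    ext p
    simp only [Finset.mem_filter, SimpleGraph.fromRel_adj]
    constructor
    · rintro ⟨hp, -, h | h⟩
      · exact h
      · have h1 : p.1 < p.2 := by simpa [orderedPairs] using hp
        have h2 : p.2 < p.1 := by simpa [orderedPairs] using hT' h
        exact absurd h1 h2.asymm
    · intro hp
      have h1 : p.1 < p.2 := by simpa [orderedPairs] using hT' hp
      exact ⟨hT' hp, h1.ne, Or.inl hp⟩
  · intro A _
    rw [← Finset.prod_filter_mul_prod_filter_not (orderedPairs n) (fun p => A.Adj p.1 p.2)]
    congr 1
    · exact Finset.prod_congr rfl fun p hp => if_pos (Finset.mem_filter.mp hp).2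
    · rw [Finset.filter_not]
      exact Finset.prod_congr rfl fun p hp => if_neg fun h => (Finset.mem_sdiff.mp hp).2
        (Finset.mem_filter.mpr ⟨(Finset.mem_sdiff.mp hp).1, h⟩)

/-- A product over unordered pairs that is trivial on the diagonal is a product over `i < j`. -/
lemma prod_sym2_eq_prod_orderedPairs {n : ℕ} (g : Sym2 (Fin n) → ℝ)
    (hg : ∀ e : Sym2 (Fin n), e.IsDiag → g e = 1) :
    ∏ e, g e = ∏ p ∈ orderedPairs n, g s(p.1, p.2) := by
  symm
  refine Finset.prod_bij_ne_one (fun p _ _ => s(p.1, p.2)) (fun _ _ _ => Finset.mem_univ _) ?_ ?_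
    (fun _ _ _ => rfl)
  · rintro ⟨a, b⟩ hab - ⟨c, d⟩ hcd - h
    have h1 : a < b := by simpa [orderedPairs] using hab
    have h2 : c < d := by simpa [orderedPairs] using hcd
    rcases Sym2.eq_iff.mp h with ⟨h3, h4⟩ | ⟨h3, h4⟩
    · exact Prod.ext h3 h4
    · simp only at h3 h4
      subst h3 h4
      exact absurd h1 h2.asymm
  · intro e _ he
    induction e using Sym2.ind with
    | _ x y =>
      rcases lt_trichotomy x y with h | h | h
      · exact ⟨(x, y), by simpa [orderedPairs] using h, he, rfl⟩
      · exact absurd (hg _ (by simpa using h)) he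
      · refine ⟨(y, x), by simpa [orderedPairs] using h, ?_, Sym2.eq_swap⟩
        rwa [Sym2.eq_swap]

lemma Model.linked_symm (m : Model) {n : ℕ} (k : ℕ) :
    Std.Symm (m.Linked k : Fin n → Fin n → Prop) := by
  refine ⟨fun i j h => ?_⟩
  cases m with
  | HS => exact And.symm h
  | SBM => exact Eq.symm h
  | TS =>
    simp only [Model.Linked] at h ⊢
    rwa [abs_sub_comm]

open Classical in
/-- The unordered pairs of labels on which the signal matrix is nonzero. -/
noncomputable def Model.linkedPairs (m : Model) (n k : ℕ) : Finset (Sym2 (Fin n)) :=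
  Finset.univ.filter fun e => e ∈ Sym2.fromRel (m.linked_symm k)

lemma Model.mem_linkedPairs {m : Model} {n k : ℕ} {i j : Fin n} :
    s(i, j) ∈ m.linkedPairs n k ↔ m.Linked k i j := by
  simp [Model.linkedPairs]

/-- The centred adjacency of an edge, normalised to have unit variance in the absence of signal. -/
noncomputable def normAdj {n : ℕ} (q : ℝ) (A : SimpleGraph (Fin n)) (e : Sym2 (Fin n)) : ℝ :=
  centredAdj q A e / Real.sqrt (q * (1 - q))

/-- The monomial of an edge set in the normalised centred adjacencies. -/
noncomputable def normMono {n : ℕ} (q : ℝ) (F : Finset (Sym2 (Fin n)))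
    (A : SimpleGraph (Fin n)) : ℝ :=
  ∏ e ∈ F, normAdj q A e

/-- The mean of a normalised centred adjacency on a linked pair. -/
noncomputable def signal (lam q : ℝ) : ℝ := lam / Real.sqrt (q * (1 - q))

/-- The excess second moment of a normalised centred adjacency on a linked pair. -/
noncomputable def excess (lam q : ℝ) : ℝ := lam * (1 - 2 * q) / (q * (1 - q))

open Classical in
/-- The conditional mean given the latent assignment. -/
noncomputable def condMean (m : Model) {n : ℕ} (k : ℕ) (lam q : ℝ) (z : Fin n → Fin n)
    (f : SimpleGraph (Fin n) → ℝ) : ℝ :=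
  ∑ A : SimpleGraph (Fin n), condProb m k lam q z A * f A

lemma expect_eq_mean_condMean (m : Model) (s : Sampling) (n k : ℕ) (lam q : ℝ)
    (f : SimpleGraph (Fin n) → ℝ) :
    expect m s n k lam q f = s.mean fun z => condMean m k lam q z f := by
  rw [Sampling.mean, Finset.expect_eq_sum_div_card]
  rfl

lemma prod_normMono {n : ℕ} {ι : Type*} (q : ℝ) (C : ι → Finset (Sym2 (Fin n))) (I : Finset ι)
    (A : SimpleGraph (Fin n)) :
    ∏ i ∈ I, normMono q (C i) A = ∏ e, normAdj q A e ^ mult C I e := by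
  unfold normMono mult
  simp only [← Finset.prod_const, Finset.prod_filter]
  rw [Finset.prod_comm]
  refine Finset.prod_congr rfl fun i _ => ?_
  rw [← Finset.prod_filter]
  congr 1
  ext e
  simp

/-- The moments up to order two of one normalised centred adjacency. -/
lemma moment_eq {q θ ind lam : ℝ} (hq : 0 < q) (hq1 : q < 1) (hθ : θ = lam * ind) {r : ℕ}
    (hr : r ≤ 2) :
    (q + θ) * ((1 - q) / Real.sqrt (q * (1 - q))) ^ r
        + (1 - q - θ) * ((0 - q) / Real.sqrt (q * (1 - q))) ^ r
      = (if r = 1 then signal lam q * ind else 1) *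
        (if r = 2 then 1 + excess lam q * ind else 1) := by
  have hqb : 0 < q * (1 - q) := mul_pos hq (by linarith)
  have hs : Real.sqrt (q * (1 - q)) ≠ 0 := (Real.sqrt_pos.mpr hqb).ne'
  have h1q : 1 - q ≠ 0 := by linarith
  interval_cases r
  · simp
  · simp only [pow_one, if_true, signal, hθ]
    norm_num
    field_simp
    ring
  · simp only [div_pow, Real.sq_sqrt hqb.le, excess, hθ]
    norm_num
    field_simp
    ring

/-- Given the latent assignment, the mean of a product of monomials in which each edge occurs at
most twice. -/
lemma condMean_prod_normMono (m : Model) {n : ℕ} {ι : Type*} (k : ℕ) {lam q : ℝ} (hq : 0 < q)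
    (hq1 : q < 1) {C : ι → Finset (Sym2 (Fin n))} {I : Finset ι}
    (hdiag : ∀ i ∈ I, ∀ e ∈ C i, ¬e.IsDiag) (hm : ∀ e, mult C I e ≤ 2) (z : Fin n → Fin n) :
    condMean m k lam q z (fun A => ∏ i ∈ I, normMono q (C i) A)
      = weight (signal lam q) (excess lam q) (m.linkedPairs n k) C I z := by
  classical
  have hm0 : ∀ e : Sym2 (Fin n), e.IsDiag → mult C I e = 0 := by
    intro e he
    rw [mult, Finset.card_eq_zero, Finset.filter_eq_empty_iff]
    exact fun i hi hei => hdiag i hi e hei he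
  have h1 : ∀ A : SimpleGraph (Fin n),
      condProb m k lam q z A * ∏ i ∈ I, normMono q (C i) A
      = ∏ p ∈ orderedPairs n, if A.Adj p.1 p.2 then
          (q + m.Theta k lam (z p.1) (z p.2)) *
            ((1 - q) / Real.sqrt (q * (1 - q))) ^ mult C I s(p.1, p.2)
        else (1 - q - m.Theta k lam (z p.1) (z p.2)) *
            ((0 - q) / Real.sqrt (q * (1 - q))) ^ mult C I s(p.1, p.2) := by
    intro A
    rw [prod_normMono, prod_sym2_eq_prod_orderedPairs _ fun e he => by rw [hm0 e he, pow_zero],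
      condProb]
    change (∏ p ∈ orderedPairs n, _) * _ = _
    rw [← Finset.prod_mul_distrib]
    refine Finset.prod_congr rfl fun p _ => ?_
    simp only [normAdj, centredAdj, SimpleGraph.mem_edgeSet]
    split_ifs <;> rfl
  have h2 : ∀ p : Fin n × Fin n, m.Theta k lam (z p.1) (z p.2)
      = lam * (if s(p.1, p.2).map z ∈ m.linkedPairs n k then 1 else 0) := by
    intro p
    rw [Sym2.map_mk, Model.Theta]
    simp only [Model.mem_linkedPairs]
    split_ifs <;> simp
  unfold condMean
  rw [Finset.sum_congr rfl fun A _ => h1 A, sum_graph_prod,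
    Finset.prod_congr rfl fun p _ => moment_eq hq hq1 (h2 p) (hm s(p.1, p.2)),
    ← prod_sym2_eq_prod_orderedPairs (fun e => (if mult C I e = 1 then signal lam q *
      (if e.map z ∈ m.linkedPairs n k then 1 else 0) else 1) *
        (if mult C I e = 2 then 1 + excess lam q *
          (if e.map z ∈ m.linkedPairs n k then 1 else 0) else 1)) fun e he => by
      simp [hm0 e he], Finset.prod_mul_distrib, weight, level, level,
    Finset.prod_filter, Finset.prod_filter]

lemma mult_mono {n : ℕ} {ι : Type*} (C : ι → Finset (Sym2 (Fin n))) {I K : Finset ι} (h : I ⊆ K)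
    (e : Sym2 (Fin n)) : mult C I e ≤ mult C K e :=
  Finset.card_le_card (Finset.filter_subset_filter _ h)

lemma expect_normMono (m : Model) (s : Sampling) {n : ℕ} (k : ℕ) {lam q : ℝ} (hq : 0 < q)
    (hq1 : q < 1) {F : Finset (Sym2 (Fin n))} (hF : ∀ e ∈ F, ¬e.IsDiag) :
    expect m s n k lam q (normMono q F) = s.monoMean (signal lam q) (m.linkedPairs n k) F := by
  rw [expect_eq_mean_condMean, Sampling.monoMean]
  congr 1
  ext z
  have hmult : ∀ e, mult (fun _ : Unit => F) {()} e = if e ∈ F then 1 else 0 := by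
    intro e
    rw [mult, Finset.filter_singleton]
    split_ifs <;> rfl
  have h := condMean_prod_normMono m k (lam := lam) hq hq1 (C := fun _ : Unit => F) (I := {()})
    (fun _ _ => hF) (fun e => by rw [hmult]; split_ifs <;> norm_num) z
  simp only [Finset.prod_singleton] at h
  have h1 : level (fun _ : Unit => F) {()} 1 = F := by
    ext e
    rw [mem_level, hmult]
    simp
  have h2 : level (fun _ : Unit => F) {()} 2 = ∅ := by
    ext e
    rw [mem_level, hmult]
    split_ifs <;> simp
  rw [weight, h1, h2, prod_eps_eq, Finset.prod_empty, mul_one] at h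
  exact h

/-- The mean of a product of centred monomials. -/
lemma expect_prod_centred (m : Model) (s : Sampling) {n : ℕ} {ι : Type*} [DecidableEq ι] (k : ℕ)
    {lam q : ℝ} (hq : 0 < q) (hq1 : q < 1) {C : ι → Finset (Sym2 (Fin n))} {K : Finset ι}
    (hdiag : ∀ i ∈ K, ∀ e ∈ C i, ¬e.IsDiag) (hm : ∀ e, mult C K e ≤ 2) :
    expect m s n k lam q (fun A =>
        ∏ i ∈ K, (normMono q (C i) A - expect m s n k lam q (normMono q (C i))))
      = s.mean (centredWeight s (signal lam q) (excess lam q) (m.linkedPairs n k) C K) := by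
  rw [expect_eq_mean_condMean]
  congr 1
  ext z
  have h1 : ∀ A, (∏ i ∈ K, (normMono q (C i) A - expect m s n k lam q (normMono q (C i))))
      = ∑ I ∈ K.powerset, (∏ i ∈ K \ I, -s.monoMean (signal lam q) (m.linkedPairs n k) (C i)) *
        ∏ i ∈ I, normMono q (C i) A := by
    intro A
    rw [Finset.prod_congr rfl (g := fun i => normMono q (C i) A +
      -s.monoMean (signal lam q) (m.linkedPairs n k) (C i)) fun i hi => by
        rw [expect_normMono m s k hq hq1 (hdiag i hi), sub_eq_add_neg], Finset.prod_add]
    exact Finset.sum_congr rfl fun I _ => mul_comm _ _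
  simp only [h1, condMean, Finset.mul_sum]
  rw [Finset.sum_comm, centredWeight]
  refine Finset.sum_congr rfl fun I hI => ?_
  have hIK := Finset.mem_powerset.mp hI
  rw [← condMean_prod_normMono m k hq hq1 (fun i hi => hdiag i (hIK hi))
    (fun e => (mult_mono C hIK e).trans (hm e)) z, condMean, Finset.mul_sum]
  exact Finset.sum_congr rfl fun A _ => by ring

/-- If every edge used is used twice, the mean of the product of centred monomials is close to one:
removed monomials and the excess second moments are small perturbations. -/
lemma abs_mean_centredWeight_sub_one_le {n : ℕ} {ι : Type*} [DecidableEq ι]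
    {Lk : Finset (Sym2 (Fin n))} {ε η κ ρ t : ℝ} (h : Regime n Lk ε η κ ρ (t ^ 2)) (ht0 : 0 ≤ t)
    (ht1 : t ≤ 1) (s : Sampling) {C : ι → Finset (Sym2 (Fin n))} {K : Finset ι}
    (hC : ConnectedFamily C K) {N : ℕ} (hN : ∑ i ∈ K, (C i).card ≤ N) (hNt : 12 * (N * t) ≤ 1)
    (hK : level C K 1 = ∅) :
    |s.mean (centredWeight s ε η Lk C K) - 1| ≤ t := by
  have hε := h.eps_nonneg
  have hη := h.eta_nonneg
  have hN0 : (0 : ℝ) ≤ N := Nat.cast_nonneg N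
  have ht2 : t ^ 2 ≤ 1 := pow_le_one₀ ht0 ht1
  have hNt2 : N * t ^ 2 ≤ t / 12 := by nlinarith
  have hNη : N * η ≤ t / 12 := (mul_le_mul_of_nonneg_left h.eta_le hN0).trans hNt2
  have hη1 : (1 + η) ^ N ≤ 1 + t / 6 :=
    (one_add_pow_le hη N (by linarith)).trans (by linarith)
  have hKN : K.card ≤ N := by
    refine le_trans ?_ hN
    rw [Finset.card_eq_sum_ones]
    exact Finset.sum_le_sum fun i hi => Finset.card_pos.mpr (hC.nonempty i hi)
  have ht3 : (1 + t ^ 2) ^ K.card ≤ 1 + t / 6 := by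
    refine (pow_le_pow_right₀ (by nlinarith) hKN).trans ?_
    exact (one_add_pow_le (by positivity) N (by linarith)).trans (by linarith)
  have hmono : ∀ i ∈ K, s.monoMean ε Lk (C i) ≤ t ^ 2 := by
    intro i hi
    refine (s.mean_mono (g := fun _ => t ^ 2) fun z => ?_).trans_eq (s.mean_const _)
    calc _ ≤ ε ^ (C i).card := mul_le_of_le_one_right (pow_nonneg hε _) (linkInd_le_one _ _ _)
      _ ≤ ε := pow_le_of_le_one hε (h.eps_le.trans ht2)
          (Finset.card_pos.mpr (hC.nonempty i hi)).ne'
      _ ≤ t ^ 2 := h.eps_le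
  have hwle : ∀ I ⊆ K, ∀ z, weight ε η Lk C I z ≤ (1 + η) ^ N := fun I hI z => by
    refine (weight_le hε hη Lk C hI hN z).trans (mul_le_of_le_one_right (by positivity) ?_)
    exact mul_le_one₀ (pow_le_one₀ hε (h.eps_le.trans ht2)) (linkInd_nonneg _ _ _)
      (linkInd_le_one _ _ _)
  have hfull : ∀ z, 1 ≤ weight ε η Lk C K z := by
    intro z
    rw [weight, hK, Finset.prod_empty, one_mul]
    calc (1 : ℝ) = ∏ _e ∈ level C K 2, 1 := Finset.prod_const_one.symm
      _ ≤ _ := Finset.prod_le_prod (fun _ _ => zero_le_one) fun e _ => by split_ifs <;> linarith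
  have hpt : ∀ z, |centredWeight s ε η Lk C K z - 1| ≤ t := by
    intro z
    have hsum : (∑ I ∈ K.powerset, ∏ _i ∈ K \ I, t ^ 2) = (1 + t ^ 2) ^ K.card := by
      rw [← Finset.prod_const, Finset.prod_add]
      simp
    rw [centredWeight, ← Finset.add_sum_erase _ _ (Finset.mem_powerset_self K)]
    rw [← Finset.add_sum_erase _ _ (Finset.mem_powerset_self K)] at hsum
    simp only [Finset.sdiff_self, Finset.prod_empty, one_mul] at hsum ⊢
    have hrest : |∑ I ∈ K.powerset.erase K, (∏ i ∈ K \ I, -s.monoMean ε Lk (C i)) *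
        weight ε η Lk C I z| ≤ (t / 6) * (1 + η) ^ N := by
      refine (Finset.abs_sum_le_sum_abs _ _).trans ?_
      calc _ ≤ ∑ I ∈ K.powerset.erase K, (∏ _i ∈ K \ I, t ^ 2) * (1 + η) ^ N := by
            refine Finset.sum_le_sum fun I hI => ?_
            have hIK := Finset.mem_powerset.mp (Finset.mem_of_mem_erase hI)
            rw [abs_mul, Finset.abs_prod, abs_of_nonneg (weight_nonneg hε hη Lk C I z)]
            refine mul_le_mul (Finset.prod_le_prod (fun _ _ => abs_nonneg _) fun i hi => ?_)
              (hwle I hIK z) (weight_nonneg hε hη Lk C I z)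
              (Finset.prod_nonneg fun _ _ => by positivity)
            rw [abs_neg, abs_of_nonneg (s.monoMean_nonneg hε _ _)]
            exact hmono i (Finset.mem_sdiff.mp hi).1
        _ ≤ _ := by
            rw [← Finset.sum_mul]
            exact mul_le_mul_of_nonneg_right (by linarith) (by positivity)
    have h1 := hfull z
    have h2 := hwle K subset_rfl z
    have h3 := abs_le.mp hrest
    rw [abs_le]
    constructor <;> nlinarith
  rw [abs_le]
  constructor
  · have := s.mean_mono (f := fun _ => 1 - t) (g := centredWeight s ε η Lk C K)
      fun z => by linarith [(abs_le.mp (hpt z)).1]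
    rw [s.mean_const] at this
    linarith
  · have := s.mean_mono (f := centredWeight s ε η Lk C K) (g := fun _ => 1 + t)
      fun z => by linarith [(abs_le.mp (hpt z)).2]
    rw [s.mean_const] at this
    linarith

/-! ### Connected components of an edge set -/

/-- `y` can be reached from `x` along edges of `S`. -/
def Reach {n : ℕ} (S : Finset (Sym2 (Fin n))) : Fin n → Fin n → Prop :=
  Relation.ReflTransGen fun a b => s(a, b) ∈ S

lemma Reach.symm {n : ℕ} {S : Finset (Sym2 (Fin n))} {x y : Fin n} (h : Reach S x y) :
    Reach S y x := by
  induction h with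
  | refl => exact .refl
  | tail _ hbc ih => exact .head (by rw [Sym2.eq_swap]; exact hbc) ih

lemma Reach.trans {n : ℕ} {S : Finset (Sym2 (Fin n))} {x y w : Fin n} (h : Reach S x y)
    (h' : Reach S y w) : Reach S x w :=
  Relation.ReflTransGen.trans h h'

lemma reach_of_mem_mem {n : ℕ} {S : Finset (Sym2 (Fin n))} {e : Sym2 (Fin n)} (he : e ∈ S)
    {x y : Fin n} (hx : x ∈ e) (hy : y ∈ e) : Reach S x y := by
  by_cases hxy : x = y
  · exact hxy ▸ .refl
  · rw [(Sym2.mem_and_mem_iff hxy).mp ⟨hx, hy⟩] at he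
    exact .single he

open Classical in
/-- The edges of `S` in the connected component of the node `x`. -/
noncomputable def compAt {n : ℕ} (S : Finset (Sym2 (Fin n))) (x : Fin n) :
    Finset (Sym2 (Fin n)) :=
  S.filter fun e => ∃ y ∈ e, Reach S x y

/-- The connected components of an edge set, as edge sets. -/
noncomputable def comps {n : ℕ} (S : Finset (Sym2 (Fin n))) : Finset (Finset (Sym2 (Fin n))) :=
  (verts S).image (compAt S)

lemma mem_compAt {n : ℕ} {S : Finset (Sym2 (Fin n))} {x : Fin n} {e : Sym2 (Fin n)} :
    e ∈ compAt S x ↔ e ∈ S ∧ ∃ y ∈ e, Reach S x y := by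
  simp [compAt]

lemma compAt_eq_of_reach {n : ℕ} {S : Finset (Sym2 (Fin n))} {x y : Fin n} (h : Reach S x y) :
    compAt S x = compAt S y := by
  ext e
  rw [mem_compAt, mem_compAt]
  exact and_congr_right fun _ => exists_congr fun w => and_congr_right fun _ =>
    ⟨h.symm.trans, h.trans⟩

lemma mem_verts_compAt {n : ℕ} {S : Finset (Sym2 (Fin n))} {x y : Fin n} :
    y ∈ verts (compAt S x) ↔ y ∈ verts S ∧ Reach S x y := by
  simp only [mem_verts, mem_compAt]
  constructor
  · rintro ⟨e, ⟨he, w, hw, hxw⟩, hy⟩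
    exact ⟨⟨e, he, hy⟩, hxw.trans (reach_of_mem_mem he hw hy)⟩
  · rintro ⟨⟨e, he, hy⟩, hxy⟩
    exact ⟨e, ⟨he, y, hy, hxy⟩, hy⟩

lemma subset_of_mem_comps {n : ℕ} {S C : Finset (Sym2 (Fin n))} (hC : C ∈ comps S) : C ⊆ S := by
  obtain ⟨x, _, rfl⟩ := Finset.mem_image.mp hC
  exact fun e he => (mem_compAt.mp he).1

lemma eq_of_mem_verts_comps {n : ℕ} {S C C' : Finset (Sym2 (Fin n))} (hC : C ∈ comps S)
    (hC' : C' ∈ comps S) {v : Fin n} (hv : v ∈ verts C) (hv' : v ∈ verts C') : C = C' := by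
  obtain ⟨x, _, rfl⟩ := Finset.mem_image.mp hC
  obtain ⟨y, _, rfl⟩ := Finset.mem_image.mp hC'
  rw [compAt_eq_of_reach (mem_verts_compAt.mp hv).2, compAt_eq_of_reach (mem_verts_compAt.mp hv').2]

lemma exists_mem_comps {n : ℕ} {S : Finset (Sym2 (Fin n))} {e : Sym2 (Fin n)} (he : e ∈ S) :
    ∃ C ∈ comps S, e ∈ C := by
  induction e using Sym2.ind with
  | _ x y =>
    exact ⟨compAt S x, Finset.mem_image_of_mem _ (mem_verts.mpr ⟨_, he, Sym2.mem_mk_left x y⟩),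
      mem_compAt.mpr ⟨he, x, Sym2.mem_mk_left x y, .refl⟩⟩

lemma eq_of_mem_comps {n : ℕ} {S C C' : Finset (Sym2 (Fin n))} (hC : C ∈ comps S)
    (hC' : C' ∈ comps S) {e : Sym2 (Fin n)} (he : e ∈ C) (he' : e ∈ C') : C = C' := by
  induction e using Sym2.ind with
  | _ x y =>
    exact eq_of_mem_verts_comps hC hC' (mem_verts.mpr ⟨_, he, Sym2.mem_mk_left x y⟩)
      (mem_verts.mpr ⟨_, he', Sym2.mem_mk_left x y⟩)

lemma biUnion_comps {n : ℕ} (S : Finset (Sym2 (Fin n))) : (comps S).biUnion id = S := by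
  ext e
  simp only [Finset.mem_biUnion, id]
  exact ⟨fun ⟨C, hC, he⟩ => subset_of_mem_comps hC he, exists_mem_comps⟩

lemma pairwiseDisjoint_comps {n : ℕ} (S : Finset (Sym2 (Fin n))) :
    (comps S : Set (Finset (Sym2 (Fin n)))).PairwiseDisjoint id :=
  fun _ hC _ hC' hne => Finset.disjoint_left.mpr fun _ he he' =>
    hne (eq_of_mem_comps hC hC' he he')

lemma sum_card_comps {n : ℕ} (S : Finset (Sym2 (Fin n))) : ∑ C ∈ comps S, C.card = S.card := by
  conv_rhs => rw [← biUnion_comps S]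
  exact (Finset.card_biUnion fun C hC C' hC' hne => pairwiseDisjoint_comps S hC hC' hne).symm

lemma nonempty_of_mem_comps {n : ℕ} {S C : Finset (Sym2 (Fin n))} (hC : C ∈ comps S) :
    C.Nonempty := by
  obtain ⟨x, hx, rfl⟩ := Finset.mem_image.mp hC
  obtain ⟨e, he, hxe⟩ := mem_verts.mp hx
  exact ⟨e, mem_compAt.mpr ⟨he, x, hxe, .refl⟩⟩

lemma exists_crossing_edge {n : ℕ} {S C : Finset (Sym2 (Fin n))} (hC : C ∈ comps S)
    (X : Finset (Fin n)) (hx : ∃ x ∈ X, x ∈ verts C) (hy : ∃ y ∉ X, y ∈ verts C) :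
    ∃ x ∈ X, ∃ y ∉ X, s(x, y) ∈ C := by
  obtain ⟨v, _, rfl⟩ := Finset.mem_image.mp hC
  obtain ⟨x, hxX, hx⟩ := hx
  obtain ⟨y, hyX, hy⟩ := hy
  by_contra hcon
  push Not at hcon
  have hvx := (mem_verts_compAt.mp hx).2
  have key : ∀ w, Reach S x w → w ∈ X := by
    intro w hw
    induction hw with
    | refl => exact hxX
    | @tail b c hxb hbc ih =>
      by_contra hc
      exact hcon b ih c hc (mem_compAt.mpr ⟨hbc, b, Sym2.mem_mk_left b c, hvx.trans hxb⟩)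
  exact hyX (key y (hvx.symm.trans (mem_verts_compAt.mp hy).2))

/-- The components of `S` and of `T`, as one family. -/
noncomputable def pairFamily {n : ℕ} (S T : Finset (Sym2 (Fin n))) :
    Finset (Finset (Sym2 (Fin n)) ⊕ Finset (Sym2 (Fin n))) :=
  (comps S).disjSum (comps T)

/-- The edge set underlying a component of either edge set. -/
def pairEdges {n : ℕ} : Finset (Sym2 (Fin n)) ⊕ Finset (Sym2 (Fin n)) → Finset (Sym2 (Fin n)) :=
  Sum.elim id id

lemma connectedFamily_pair {n : ℕ} (S T : Finset (Sym2 (Fin n))) :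
    ConnectedFamily pairEdges (pairFamily S T) := by
  constructor
  · intro i hi
    rcases Finset.mem_disjSum.mp hi with ⟨C, hC, rfl⟩ | ⟨C, hC, rfl⟩ <;>
    exact nonempty_of_mem_comps hC
  · intro i hi
    rcases Finset.mem_disjSum.mp hi with ⟨C, hC, rfl⟩ | ⟨C, hC, rfl⟩ <;>
    exact exists_crossing_edge hC

lemma card_filter_mem_comps {n : ℕ} (S : Finset (Sym2 (Fin n))) (e : Sym2 (Fin n)) :
    ((comps S).filter fun C => e ∈ C).card = if e ∈ S then 1 else 0 := by
  split_ifs with he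
  · obtain ⟨C, hC, heC⟩ := exists_mem_comps he
    rw [Finset.card_eq_one]
    refine ⟨C, ?_⟩
    ext C'
    simp only [Finset.mem_filter, Finset.mem_singleton]
    exact ⟨fun h => eq_of_mem_comps h.1 hC h.2 heC, fun h => h ▸ ⟨hC, heC⟩⟩
  · rw [Finset.card_eq_zero, Finset.filter_eq_empty_iff]
    exact fun C hC heC => he (subset_of_mem_comps hC heC)

lemma mult_pair {n : ℕ} (S T : Finset (Sym2 (Fin n))) (e : Sym2 (Fin n)) :
    mult pairEdges (pairFamily S T) e = (if e ∈ S then 1 else 0) + if e ∈ T then 1 else 0 := by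
  rw [← card_filter_mem_comps, ← card_filter_mem_comps, mult, pairFamily, Finset.card_filter,
    Finset.sum_disjSum, Finset.card_filter, Finset.card_filter]
  rfl

lemma level_pair {n : ℕ} (S T : Finset (Sym2 (Fin n))) :
    level pairEdges (pairFamily S T) 1 = symmDiff S T := by
  ext e
  rw [mem_level, mult_pair, Finset.mem_symmDiff]
  by_cases h1 : e ∈ S <;> by_cases h2 : e ∈ T <;> simp [h1, h2]

lemma sum_card_pair {n : ℕ} (S T : Finset (Sym2 (Fin n))) :
    ∑ i ∈ pairFamily S T, (pairEdges i).card = S.card + T.card := by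
  rw [pairFamily, Finset.sum_disjSum, ← sum_card_comps S, ← sum_card_comps T]
  rfl

lemma mem_verts_iff_exists_comps {n : ℕ} {S : Finset (Sym2 (Fin n))} {v : Fin n} :
    v ∈ verts S ↔ ∃ C ∈ comps S, v ∈ verts C := by
  constructor
  · intro hv
    obtain ⟨e, he, hve⟩ := mem_verts.mp hv
    obtain ⟨C, hC, heC⟩ := exists_mem_comps he
    exact ⟨C, hC, mem_verts.mpr ⟨e, heC, hve⟩⟩
  · rintro ⟨C, hC, hv⟩
    obtain ⟨e, he, hve⟩ := mem_verts.mp hv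
    exact mem_verts.mpr ⟨e, subset_of_mem_comps hC he, hve⟩

lemma verts_sdiff_shared_pair {n : ℕ} (S T : Finset (Sym2 (Fin n))) :
    ((pairFamily S T).biUnion fun i => verts (pairEdges i)) \ shared pairEdges (pairFamily S T)
      = symmDiff (verts S) (verts T) := by
  have h1 : ∀ v, v ∈ ((pairFamily S T).biUnion fun i => verts (pairEdges i)) ↔
      v ∈ verts S ∨ v ∈ verts T := by
    intro v
    rw [Finset.mem_biUnion, mem_verts_iff_exists_comps (S := S),
      mem_verts_iff_exists_comps (S := T)]
    constructor
    · rintro ⟨i, hi, hv⟩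
      rcases Finset.mem_disjSum.mp hi with ⟨C, hC, rfl⟩ | ⟨C, hC, rfl⟩
      · exact Or.inl ⟨C, hC, hv⟩
      · exact Or.inr ⟨C, hC, hv⟩
    · rintro (⟨C, hC, hv⟩ | ⟨C, hC, hv⟩)
      · exact ⟨Sum.inl C, Finset.inl_mem_disjSum.mpr hC, hv⟩
      · exact ⟨Sum.inr C, Finset.inr_mem_disjSum.mpr hC, hv⟩
  have h2 : ∀ v, v ∈ shared pairEdges (pairFamily S T) ↔ v ∈ verts S ∧ v ∈ verts T := by
    intro v
    rw [mem_shared, mem_verts_iff_exists_comps (S := S), mem_verts_iff_exists_comps (S := T)]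
    constructor
    · rintro ⟨i, hi, j, hj, hij, hvi, hvj⟩
      rcases Finset.mem_disjSum.mp hi with ⟨C, hC, rfl⟩ | ⟨C, hC, rfl⟩ <;>
      rcases Finset.mem_disjSum.mp hj with ⟨C', hC', rfl⟩ | ⟨C', hC', rfl⟩
      · exact absurd (congrArg Sum.inl (eq_of_mem_verts_comps hC hC' hvi hvj)) hij
      · exact ⟨⟨C, hC, hvi⟩, ⟨C', hC', hvj⟩⟩
      · exact ⟨⟨C', hC', hvj⟩, ⟨C, hC, hvi⟩⟩
      · exact absurd (congrArg Sum.inr (eq_of_mem_verts_comps hC hC' hvi hvj)) hij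
    · rintro ⟨⟨C, hC, hv⟩, ⟨C', hC', hv'⟩⟩
      exact ⟨Sum.inl C, Finset.inl_mem_disjSum.mpr hC, Sum.inr C',
        Finset.inr_mem_disjSum.mpr hC', by simp, hv, hv'⟩
  ext v
  rw [Finset.mem_sdiff, h1, h2, Finset.mem_symmDiff]
  tauto

/-- The product over the connected components of the edge set of the normalised monomials, each
centred by its mean. -/
noncomputable def centredMono (m : Model) (s : Sampling) (n k : ℕ) (lam q : ℝ)
    (S : Finset (Sym2 (Fin n))) (A : SimpleGraph (Fin n)) : ℝ :=
  ∏ C ∈ comps S, (normMono q C A - expect m s n k lam q (normMono q C))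

lemma expect_centredMono_mul (m : Model) (s : Sampling) {n : ℕ} (k : ℕ) {lam q : ℝ} (hq : 0 < q)
    (hq1 : q < 1) {S T : Finset (Sym2 (Fin n))} (hS : ∀ e ∈ S, ¬e.IsDiag)
    (hT : ∀ e ∈ T, ¬e.IsDiag) :
    expect m s n k lam q (fun A =>
        centredMono m s n k lam q S A * centredMono m s n k lam q T A)
      = s.mean (centredWeight s (signal lam q) (excess lam q) (m.linkedPairs n k) pairEdges
          (pairFamily S T)) := by
  rw [← expect_prod_centred m s k hq hq1]
  · congr 1
    ext A
    rw [pairFamily, Finset.prod_disjSum]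
    rfl
  · intro i hi e he
    rcases Finset.mem_disjSum.mp hi with ⟨C, hC, rfl⟩ | ⟨C, hC, rfl⟩
    · exact hS e (subset_of_mem_comps hC he)
    · exact hT e (subset_of_mem_comps hC he)
  · intro e
    rw [mult_pair]
    split_ifs <;> norm_num

/-- Near-orthogonality of the centred monomials of distinct edge sets. -/
theorem abs_expect_centredMono_mul_le (m : Model) (s : Sampling) {n k : ℕ} {lam q κ ρ t : ℝ}
    (hq : 0 < q) (hq1 : q < 1)
    (h : Regime n (m.linkedPairs n k) (signal lam q) (excess lam q) κ ρ (t ^ 2)) (ht0 : 0 ≤ t)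
    (ht1 : t ≤ 1) (hρt : ρ ≤ t) {D : ℕ} (hDt : 24 * (D * t) ≤ 1) {S T : Finset (Sym2 (Fin n))}
    (hS : ∀ e ∈ S, ¬e.IsDiag) (hT : ∀ e ∈ T, ¬e.IsDiag) (hSD : S.card ≤ D) (hTD : T.card ≤ D) :
    |expect m s n k lam q (fun A =>
        centredMono m s n k lam q S A * centredMono m s n k lam q T A)|
      ≤ 8 * (t ^ (symmDiff S T).card * ρ ^ (symmDiff (verts S) (verts T)).card) := by
  rw [expect_centredMono_mul m s k hq hq1 hS hT, ← level_pair, ← verts_sdiff_shared_pair]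
  refine abs_mean_centredWeight_le h ht0 ht1 hρt s (connectedFamily_pair S T) (N := 2 * D) ?_ ?_
  · rw [sum_card_pair]
    omega
  · push_cast
    linarith

/-- The centred monomials are nearly normalised. -/
theorem abs_expect_centredMono_sq_sub_one_le (m : Model) (s : Sampling) {n k : ℕ}
    {lam q κ ρ t : ℝ} (hq : 0 < q) (hq1 : q < 1)
    (h : Regime n (m.linkedPairs n k) (signal lam q) (excess lam q) κ ρ (t ^ 2)) (ht0 : 0 ≤ t)
    (ht1 : t ≤ 1) {D : ℕ} (hDt : 24 * (D * t) ≤ 1) {S : Finset (Sym2 (Fin n))}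
    (hS : ∀ e ∈ S, ¬e.IsDiag) (hSD : S.card ≤ D) :
    |expect m s n k lam q (fun A =>
        centredMono m s n k lam q S A * centredMono m s n k lam q S A) - 1| ≤ t := by
  rw [expect_centredMono_mul m s k hq hq1 hS hS]
  refine abs_mean_centredWeight_sub_one_le h ht0 ht1 s (connectedFamily_pair S S) (N := 2 * D)
    ?_ ?_ ?_
  · rw [sum_card_pair]
    omega
  · push_cast
    linarith
  · rw [level_pair, symmDiff_self]
    rfl

/-! ### The Gram matrix of the centred monomials of labelled edge sets -/

lemma verts_insert {n : ℕ} (F : Finset (Sym2 (Fin n))) (x y : Fin n) :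
    verts (insert s(x, y) F) = insert x (insert y (verts F)) := by
  ext v
  simp only [mem_verts, Finset.mem_insert, exists_eq_or_imp, Sym2.mem_iff, or_assoc]

/-- Adding one node: either one of the boundedly many nodes already present, or one of at most `n`
new nodes, each of weight `1 / n`. -/
lemma sum_inv_pow_card_insert_le {n : ℕ} (U B : Finset (Fin n)) :
    (∑ x : Fin n, (1 / n : ℝ) ^ (insert x B \ U).card)
      ≤ ((U.card : ℝ) + B.card + 1) * (1 / n : ℝ) ^ (B \ U).card := by
  have hn0 : (0 : ℝ) ≤ 1 / n := by positivity
  have hn1 : (1 / n : ℝ) ≤ 1 := by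
    rcases Nat.eq_zero_or_pos n with rfl | h
    · simp
    · rw [div_le_one (by exact_mod_cast h)]
      exact_mod_cast h
  have hterm : ∀ x : Fin n, (1 / n : ℝ) ^ (insert x B \ U).card ≤
      (if x ∈ U ∪ B then (1 / n : ℝ) ^ (B \ U).card else 0) +
        (1 / n : ℝ) * (1 / n : ℝ) ^ (B \ U).card := by
    intro x
    have hnn : 0 ≤ (1 / n : ℝ) * (1 / n : ℝ) ^ (B \ U).card := by positivity
    split_ifs with hx
    · have h1 : (1 / n : ℝ) ^ (insert x B \ U).card ≤ (1 / n : ℝ) ^ (B \ U).card :=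
        pow_le_pow_of_le_one hn0 hn1
          (Finset.card_le_card (Finset.sdiff_subset_sdiff (Finset.subset_insert _ _) subset_rfl))
      linarith
    · rw [Finset.mem_union, not_or] at hx
      rw [Finset.insert_sdiff_of_notMem _ hx.1, Finset.card_insert_of_notMem (by simp [hx.2]),
        pow_succ, zero_add, mul_comm]
  refine (Finset.sum_le_sum fun x _ => hterm x).trans ?_
  rw [Finset.sum_add_distrib, ← Finset.sum_filter, Finset.sum_const, Finset.sum_const,
    nsmul_eq_mul, nsmul_eq_mul, Finset.card_univ, Fintype.card_fin, ← mul_assoc, add_mul _ 1]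
  have h1 : ((Finset.univ.filter fun x => x ∈ U ∪ B).card : ℝ) ≤ U.card + B.card := by
    rw [Finset.filter_univ_mem]
    exact_mod_cast Finset.card_union_le U B
  have h2 : (n : ℝ) * (1 / n) ≤ 1 := by
    rw [mul_one_div]
    exact div_self_le_one _
  have h3 : 0 ≤ (1 / n : ℝ) ^ (B \ U).card := by positivity
  exact add_le_add (mul_le_mul_of_nonneg_right h1 h3) (mul_le_mul_of_nonneg_right h2 h3)

lemma sum_powersetCard_succ_le {n : ℕ} (h : Finset (Sym2 (Fin n)) → ℝ) (h0 : ∀ F, 0 ≤ h F)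
    (d : ℕ) :
    ∑ F ∈ Finset.univ.powersetCard (d + 1), h F
      ≤ ∑ F ∈ Finset.univ.powersetCard d, ∑ x : Fin n, ∑ y : Fin n, h (insert s(x, y) F) := by
  classical
  let g : Finset (Sym2 (Fin n)) × (Fin n × Fin n) → Finset (Sym2 (Fin n)) :=
    fun p => insert s(p.2.1, p.2.2) p.1
  have hsub : (Finset.univ : Finset (Sym2 (Fin n))).powersetCard (d + 1)
      ⊆ (Finset.univ.powersetCard d ×ˢ Finset.univ).image g := by
    intro F hF
    obtain ⟨-, hcard⟩ := Finset.mem_powersetCard.mp hF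
    obtain ⟨e, he⟩ := Finset.card_pos.mp (by omega : 0 < F.card)
    induction e using Sym2.ind with
    | _ x y =>
      refine Finset.mem_image.mpr ⟨(F.erase s(x, y), (x, y)), Finset.mem_product.mpr
        ⟨Finset.mem_powersetCard.mpr ⟨Finset.subset_univ _, ?_⟩, Finset.mem_univ _⟩,
        Finset.insert_erase he⟩
      rw [Finset.card_erase_of_mem he, hcard]
      rfl
  calc _ ≤ ∑ F ∈ (Finset.univ.powersetCard d ×ˢ Finset.univ).image g, h F :=
        Finset.sum_le_sum_of_subset_of_nonneg hsub fun F _ _ => h0 F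
    _ ≤ ∑ p ∈ Finset.univ.powersetCard d ×ˢ Finset.univ, h (g p) :=
        Finset.sum_image_le_of_nonneg fun _ _ => h0 _
    _ = _ := by
        rw [Finset.sum_product]
        exact Finset.sum_congr rfl fun F _ => Fintype.sum_prod_type _

/-- Weighted count of the sets of `d` edges, each node outside `U` having weight `1 / n`. -/
lemma sum_powersetCard_inv_pow_le {n D : ℕ} (hD : 1 ≤ D) (U : Finset (Fin n))
    (hU : U.card ≤ 2 * D) (d : ℕ) (hd : d ≤ 2 * D) :
    ∑ F ∈ (Finset.univ : Finset (Sym2 (Fin n))).powersetCard d,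
      (1 / n : ℝ) ^ (verts F \ U).card ≤ (64 * (D : ℝ) ^ 2) ^ d := by
  induction d with
  | zero => simp [verts]
  | succ d ih =>
    refine (sum_powersetCard_succ_le (fun F => (1 / n : ℝ) ^ (verts F \ U).card)
      (fun F => by positivity) d).trans ?_
    have hstep : ∀ F ∈ (Finset.univ : Finset (Sym2 (Fin n))).powersetCard d,
        (∑ x : Fin n, ∑ y : Fin n, (1 / n : ℝ) ^ (verts (insert s(x, y) F) \ U).card)
        ≤ 64 * (D : ℝ) ^ 2 * (1 / n : ℝ) ^ (verts F \ U).card := by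
      intro F hF
      obtain ⟨-, hcard⟩ := Finset.mem_powersetCard.mp hF
      have hV := card_verts_le F
      simp only [verts_insert]
      rw [Finset.sum_comm]
      have hsize : ∀ B : Finset (Fin n), B.card ≤ 2 * d + 1 →
          (U.card : ℝ) + B.card + 1 ≤ 8 * D := by
        intro B hB
        exact_mod_cast (by omega : U.card + B.card + 1 ≤ 8 * D)
      calc _ ≤ ∑ y : Fin n, 8 * (D : ℝ) * (1 / n : ℝ) ^ (insert y (verts F) \ U).card := by
            refine Finset.sum_le_sum fun y _ => (sum_inv_pow_card_insert_le U _).trans ?_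
            refine mul_le_mul_of_nonneg_right (hsize _ ?_) (by positivity)
            have := Finset.card_insert_le y (verts F)
            omega
        _ ≤ 8 * (D : ℝ) * (8 * D * (1 / n : ℝ) ^ (verts F \ U).card) := by
            rw [← Finset.mul_sum]
            refine mul_le_mul_of_nonneg_left ((sum_inv_pow_card_insert_le U _).trans ?_)
              (by positivity)
            exact mul_le_mul_of_nonneg_right (hsize _ (by omega)) (by positivity)
        _ = _ := by ring
    refine (Finset.sum_le_sum hstep).trans ?_
    rw [← Finset.mul_sum, pow_succ' (64 * (D : ℝ) ^ 2) d]
    exact mul_le_mul_of_nonneg_left (ih (by omega)) (by positivity)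

/-- The edge sets without loops and with at most `D` edges. -/
def edgeSets (n D : ℕ) : Finset (Finset (Sym2 (Fin n))) :=
  Finset.univ.filter fun S => S.card ≤ D ∧ ∀ e ∈ S, ¬e.IsDiag

lemma mem_edgeSets {n D : ℕ} {S : Finset (Sym2 (Fin n))} :
    S ∈ edgeSets n D ↔ S.card ≤ D ∧ ∀ e ∈ S, ¬e.IsDiag := by
  simp [edgeSets]

/-- The row sums of the off-diagonal part of the Gram matrix, after conjugation by the weights
`n ^ (-|V(S)|/2)`. Every `T ≠ S` is `S` changed along a nonempty set `F` of edges. -/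
lemma row_sum_le {n D : ℕ} (hD : 1 ≤ D) {t : ℝ} (ht0 : 0 ≤ t) (hDt : 128 * (D : ℝ) ^ 2 * t ≤ 1)
    {S : Finset (Sym2 (Fin n))} (hS : S ∈ edgeSets n D) :
    ∑ T ∈ (edgeSets n D).erase S, t ^ (symmDiff S T).card * (1 / n : ℝ) ^ (verts T \ verts S).card
      ≤ 128 * (D : ℝ) ^ 2 * t := by
  classical
  set x : ℝ := 64 * (D : ℝ) ^ 2 * t with hx
  have hx0 : 0 ≤ x := by positivity
  have hverts : ∀ T : Finset (Sym2 (Fin n)),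
      verts T \ verts S = verts (symmDiff S T) \ verts S := by
    intro T
    ext v
    simp only [Finset.mem_sdiff, mem_verts, Finset.mem_symmDiff]
    refine and_congr_left fun hv => ?_
    constructor
    · rintro ⟨e, he, hve⟩
      exact ⟨e, Or.inr ⟨he, fun h => hv ⟨e, h, hve⟩⟩, hve⟩
    · rintro ⟨e, ⟨he, -⟩ | ⟨he, -⟩, hve⟩
      · exact absurd ⟨e, he, hve⟩ hv
      · exact ⟨e, he, hve⟩
  have hSV : (verts S).card ≤ 2 * D :=
    (card_verts_le S).trans (Nat.mul_le_mul_left 2 (mem_edgeSets.mp hS).1)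
  have hmaps : ((edgeSets n D).erase S).image (fun T => symmDiff S T)
      ⊆ (Finset.Icc 1 (2 * D)).biUnion fun d =>
        (Finset.univ : Finset (Sym2 (Fin n))).powersetCard d := by
    intro F hF
    obtain ⟨T, hT, rfl⟩ := Finset.mem_image.mp hF
    obtain ⟨hne, hT⟩ := Finset.mem_erase.mp hT
    refine Finset.mem_biUnion.mpr ⟨(symmDiff S T).card, Finset.mem_Icc.mpr ⟨?_, ?_⟩,
      Finset.mem_powersetCard.mpr ⟨Finset.subset_univ _, rfl⟩⟩
    · rw [Nat.one_le_iff_ne_zero, Finset.card_ne_zero, Finset.nonempty_iff_ne_empty]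
      exact fun h => hne (symmDiff_eq_bot.mp h).symm
    · have h1 : (symmDiff S T).card ≤ S.card + T.card := by
        refine (Finset.card_le_card (fun e he => ?_)).trans (Finset.card_union_le S T)
        rcases Finset.mem_symmDiff.mp he with h | h
        · exact Finset.mem_union_left _ h.1
        · exact Finset.mem_union_right _ h.1
      have := (mem_edgeSets.mp hS).1
      have := (mem_edgeSets.mp hT).1
      omega
  calc _ = ∑ F ∈ ((edgeSets n D).erase S).image (fun T => symmDiff S T),
        t ^ F.card * (1 / n : ℝ) ^ (verts F \ verts S).card := by
        rw [Finset.sum_image fun T _ T' _ h => symmDiff_right_injective S h]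
        exact Finset.sum_congr rfl fun T _ => by rw [hverts T]
    _ ≤ ∑ F ∈ (Finset.Icc 1 (2 * D)).biUnion fun d =>
        (Finset.univ : Finset (Sym2 (Fin n))).powersetCard d,
        t ^ F.card * (1 / n : ℝ) ^ (verts F \ verts S).card :=
        Finset.sum_le_sum_of_subset_of_nonneg hmaps fun F _ _ => by positivity
    _ = ∑ d ∈ Finset.Icc 1 (2 * D), ∑ F ∈ (Finset.univ : Finset (Sym2 (Fin n))).powersetCard d,
        t ^ F.card * (1 / n : ℝ) ^ (verts F \ verts S).card := by
        refine Finset.sum_biUnion fun d _ d' _ hdd => Finset.disjoint_left.mpr fun F hF hF' => ?_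
        exact hdd ((Finset.mem_powersetCard.mp hF).2.symm.trans (Finset.mem_powersetCard.mp hF').2)
    _ ≤ ∑ d ∈ Finset.Icc 1 (2 * D), x ^ d := by
        refine Finset.sum_le_sum fun d hd => ?_
        rw [Finset.sum_congr rfl (g := fun F => t ^ d * (1 / n : ℝ) ^ (verts F \ verts S).card)
          fun F hF => by rw [(Finset.mem_powersetCard.mp hF).2], ← Finset.mul_sum, hx, mul_pow,
          mul_comm]
        exact mul_le_mul_of_nonneg_right
          (sum_powersetCard_inv_pow_le hD _ hSV d (Finset.mem_Icc.mp hd).2) (by positivity)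
    _ ≤ 2 * x := by
        have hgeom : ∀ m : ℕ, ∑ d ∈ Finset.Icc 1 m, x ^ d ≤ 2 * x * (1 - (1 / 2) ^ m) := by
          intro m
          induction m with
          | zero => simp
          | succ m ih =>
            rw [Finset.sum_Icc_succ_top (by omega)]
            have h1 : x ^ m ≤ (1 / 2 : ℝ) ^ m := pow_le_pow_left₀ hx0 (by linarith) m
            have h2 := mul_le_mul_of_nonneg_right h1 hx0
            rw [pow_succ, pow_succ]
            nlinarith
        refine (hgeom _).trans (mul_le_of_le_one_right (by linarith) ?_)
        linarith [pow_nonneg (by norm_num : (0 : ℝ) ≤ 1 / 2) (2 * D)]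
    _ = _ := by
        rw [hx]
        ring

lemma expect_sum_mul (m : Model) (s : Sampling) (n k : ℕ) (lam q : ℝ) {ι : Type*} (J : Finset ι)
    (a : ι → ℝ) (f : ι → SimpleGraph (Fin n) → ℝ) :
    expect m s n k lam q (fun A => ∑ j ∈ J, a j * f j A)
      = ∑ j ∈ J, a j * expect m s n k lam q (f j) := by
  simp only [expect_eq_mean_condMean, Sampling.mean, Finset.mul_expect]
  rw [← Finset.expect_sum_comm]
  refine Finset.expect_congr rfl fun z _ => ?_
  simp only [condMean, Finset.mul_sum]
  rw [Finset.sum_comm]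
  exact Finset.sum_congr rfl fun j _ => Finset.sum_congr rfl fun A _ => by ring

/-- The centred monomials of all labelled edge sets are almost orthonormal. -/
theorem abs_expect_sq_sub_le (m : Model) (s : Sampling) {n k : ℕ} {lam q κ ρ t : ℝ}
    (hq : 0 < q) (hq1 : q < 1)
    (h : Regime n (m.linkedPairs n k) (signal lam q) (excess lam q) κ ρ (t ^ 2)) (ht0 : 0 ≤ t)
    (ht1 : t ≤ 1) (hρt : ρ ≤ t) {D : ℕ} (hD : 1 ≤ D) (hDt : 128 * (D : ℝ) ^ 2 * t ≤ 1)
    (g : Finset (Sym2 (Fin n)) → ℝ) :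
    |expect m s n k lam q (fun A =>
        (∑ S ∈ edgeSets n D, g S * centredMono m s n k lam q S A) ^ 2)
      - ∑ S ∈ edgeSets n D, g S ^ 2|
      ≤ (t + 1024 * (D : ℝ) ^ 2 * t) * ∑ S ∈ edgeSets n D, g S ^ 2 := by
  have hD1 : (1 : ℝ) ≤ D := by exact_mod_cast hD
  have hDt' : 24 * (D * t) ≤ 1 := by
    have : (D : ℝ) * t ≤ D ^ 2 * t := mul_le_mul_of_nonneg_right (by nlinarith) ht0
    have h0 : 0 ≤ (D : ℝ) * t := by positivity
    linarith
  have hρ0 := h.rho_nonneg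
  set Γ : Finset (Sym2 (Fin n)) → Finset (Sym2 (Fin n)) → ℝ := fun S T =>
    expect m s n k lam q (fun A =>
      centredMono m s n k lam q S A * centredMono m s n k lam q T A) with hΓ
  have hexp : expect m s n k lam q (fun A =>
        (∑ S ∈ edgeSets n D, g S * centredMono m s n k lam q S A) ^ 2)
      = ∑ S ∈ edgeSets n D, ∑ T ∈ edgeSets n D, g S * g T * Γ S T := by
    have h1 : ∀ A, (∑ S ∈ edgeSets n D, g S * centredMono m s n k lam q S A) ^ 2
        = ∑ p ∈ edgeSets n D ×ˢ edgeSets n D, (g p.1 * g p.2) *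
          (centredMono m s n k lam q p.1 A * centredMono m s n k lam q p.2 A) := by
      intro A
      rw [sq, Finset.sum_mul_sum, Finset.sum_product]
      exact Finset.sum_congr rfl fun S _ => Finset.sum_congr rfl fun T _ => by ring
    simp only [h1]
    rw [expect_sum_mul m s n k lam q (edgeSets n D ×ˢ edgeSets n D) (fun p => g p.1 * g p.2)
      (fun p A => centredMono m s n k lam q p.1 A * centredMono m s n k lam q p.2 A),
      Finset.sum_product]
  have hdiff : (∑ S ∈ edgeSets n D, ∑ T ∈ edgeSets n D, g S * g T * Γ S T)
      - ∑ S ∈ edgeSets n D, g S ^ 2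
      = ∑ S ∈ edgeSets n D, g S ^ 2 * (Γ S S - 1)
        + ∑ S ∈ edgeSets n D, ∑ T ∈ (edgeSets n D).erase S, g S * g T * Γ S T := by
    rw [← Finset.sum_sub_distrib, ← Finset.sum_add_distrib]
    refine Finset.sum_congr rfl fun S hS => ?_
    rw [← Finset.add_sum_erase _ _ hS]
    ring
  have hdiag : |∑ S ∈ edgeSets n D, g S ^ 2 * (Γ S S - 1)| ≤ t * ∑ S ∈ edgeSets n D, g S ^ 2 := by
    refine (Finset.abs_sum_le_sum_abs _ _).trans ?_
    rw [Finset.mul_sum]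
    refine Finset.sum_le_sum fun S hS => ?_
    obtain ⟨hSD, hSd⟩ := mem_edgeSets.mp hS
    rw [abs_mul, abs_of_nonneg (sq_nonneg _), mul_comm]
    exact mul_le_mul_of_nonneg_right
      (abs_expect_centredMono_sq_sub_one_le m s hq hq1 h ht0 ht1 hDt' hSd hSD) (sq_nonneg _)
  set r : Finset (Sym2 (Fin n)) → Finset (Sym2 (Fin n)) → ℝ := fun S T =>
    t ^ (symmDiff S T).card * (1 / n : ℝ) ^ (verts T \ verts S).card with hr
  -- Schur's test: the weight `n ^ (-|V(S) ∆ V(T)|/2)` is split between the two rows.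
  have hoff : ∀ S ∈ edgeSets n D, ∀ T ∈ (edgeSets n D).erase S,
      |g S * g T * Γ S T| ≤ 4 * (g S ^ 2 * r S T) + 4 * (g T ^ 2 * r T S) := by
    intro S hS T hT
    obtain ⟨hSD, hSd⟩ := mem_edgeSets.mp hS
    obtain ⟨hTD, hTd⟩ := mem_edgeSets.mp (Finset.mem_of_mem_erase hT)
    have h1 := abs_expect_centredMono_mul_le m s hq hq1 h ht0 ht1 hρt hDt' hSd hTd hSD hTD
    have h2 : (symmDiff (verts S) (verts T)).card
        = (verts T \ verts S).card + (verts S \ verts T).card := by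
      rw [symmDiff_comm]
      refine Finset.card_union_of_disjoint (s := verts T \ verts S) (t := verts S \ verts T) ?_
      exact Finset.disjoint_left.mpr fun v hv hv' =>
        (Finset.mem_sdiff.mp hv').2 (Finset.mem_sdiff.mp hv).1
    set a := (verts T \ verts S).card
    set b := (verts S \ verts T).card
    have h3 : r S T = t ^ (symmDiff S T).card * (ρ ^ a) ^ 2 := by
      rw [hr, ← pow_mul, mul_comm a, pow_mul, h.rho_sq]
    have h4 : r T S = t ^ (symmDiff S T).card * (ρ ^ b) ^ 2 := by
      rw [hr, ← pow_mul, mul_comm b, pow_mul, h.rho_sq, symmDiff_comm]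
    rw [abs_mul, h3, h4, abs_mul]
    have h5 : |g S| * |g T| * |Γ S T| ≤ |g S| * |g T| *
        (8 * (t ^ (symmDiff S T).card * (ρ ^ a * ρ ^ b))) := by
      refine mul_le_mul_of_nonneg_left (h1.trans_eq ?_) (by positivity)
      rw [h2, pow_add]
    refine h5.trans ?_
    rw [← sq_abs (g S), ← sq_abs (g T)]
    have h6 : 0 ≤ t ^ (symmDiff S T).card := by positivity
    have h7 := mul_nonneg h6 (sq_nonneg (|g S| * ρ ^ a - |g T| * ρ ^ b))
    nlinarith
  have hrow : ∀ S ∈ edgeSets n D, ∑ T ∈ (edgeSets n D).erase S, r S T ≤ 128 * (D : ℝ) ^ 2 * t :=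
    fun S hS => row_sum_le hD ht0 hDt hS
  have hswap : ∑ S ∈ edgeSets n D, ∑ T ∈ (edgeSets n D).erase S, g T ^ 2 * r T S
      = ∑ S ∈ edgeSets n D, ∑ T ∈ (edgeSets n D).erase S, g S ^ 2 * r S T := by
    refine Finset.sum_comm' fun S T => ?_
    simp only [Finset.mem_erase]
    tauto
  have hmain : |∑ S ∈ edgeSets n D, ∑ T ∈ (edgeSets n D).erase S, g S * g T * Γ S T|
      ≤ 1024 * (D : ℝ) ^ 2 * t * ∑ S ∈ edgeSets n D, g S ^ 2 := by
    calc _ ≤ ∑ S ∈ edgeSets n D, ∑ T ∈ (edgeSets n D).erase S, |g S * g T * Γ S T| :=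
          (Finset.abs_sum_le_sum_abs _ _).trans
            (Finset.sum_le_sum fun S _ => Finset.abs_sum_le_sum_abs _ _)
      _ ≤ ∑ S ∈ edgeSets n D, ∑ T ∈ (edgeSets n D).erase S,
          (4 * (g S ^ 2 * r S T) + 4 * (g T ^ 2 * r T S)) :=
          Finset.sum_le_sum fun S hS => Finset.sum_le_sum fun T hT => hoff S hS T hT
      _ = 8 * ∑ S ∈ edgeSets n D, ∑ T ∈ (edgeSets n D).erase S, g S ^ 2 * r S T := by
          simp only [Finset.sum_add_distrib, ← Finset.mul_sum]
          simp only [Finset.mul_sum] at hswap ⊢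
          rw [← Finset.sum_congr rfl fun S _ => Finset.mul_sum _ _ _]
          simp only [← Finset.mul_sum] at hswap ⊢
          rw [hswap]
          ring
      _ ≤ 8 * ∑ S ∈ edgeSets n D, g S ^ 2 * (128 * (D : ℝ) ^ 2 * t) := by
          refine mul_le_mul_of_nonneg_left (Finset.sum_le_sum fun S hS => ?_) (by norm_num)
          rw [← Finset.mul_sum]
          exact mul_le_mul_of_nonneg_left (hrow S hS) (sq_nonneg _)
      _ = _ := by
          rw [← Finset.sum_mul]
          ring
  rw [hexp, hdiff, add_mul]
  exact (abs_add_le _ _).trans (add_le_add hdiag hmain)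

namespace RootedTemplate

/-! ### Rooted templates as labelled edge sets -/

lemma mem_edges {G : RootedTemplate} {e : Sym2 (Fin (G.extra + 2))} :
    e ∈ G.edges ↔ e ∈ G.graph.edgeSet := by
  simp [edges]

/-- The set of edges of the copy of the template given by a labeling. -/
noncomputable def copy (G : RootedTemplate) {n : ℕ} (π : Fin (G.extra + 2) → Fin n) :
    Finset (Sym2 (Fin n)) :=
  G.edges.image (Sym2.map π)

lemma mem_labelings {G : RootedTemplate} {n : ℕ} {π : Fin (G.extra + 2) → Fin n} :
    π ∈ G.labelings n ↔ Function.Injective π ∧ (π 0 : ℕ) = 0 ∧ (π 1 : ℕ) = 1 := by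
  simp [labelings]

lemma card_copy (G : RootedTemplate) {n : ℕ} {π : Fin (G.extra + 2) → Fin n}
    (hπ : Function.Injective π) : (G.copy π).card = G.edges.card :=
  Finset.card_image_of_injective _ (Sym2.map.injective hπ)

lemma mk_mem_copy {G : RootedTemplate} {n : ℕ} {π : Fin (G.extra + 2) → Fin n}
    (hπ : Function.Injective π) {v w : Fin (G.extra + 2)} :
    s(π v, π w) ∈ G.copy π ↔ G.graph.Adj v w := by
  rw [copy, ← Sym2.map_mk, Finset.mem_image]
  constructor
  · rintro ⟨e, he, h⟩
    rw [Sym2.map.injective hπ h, mem_edges] at he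
    exact he
  · exact fun h => ⟨s(v, w), mem_edges.mpr h, rfl⟩

lemma exists_of_mk_mem_copy {G : RootedTemplate} {n : ℕ} {π : Fin (G.extra + 2) → Fin n}
    {x y : Fin n} (h : s(x, y) ∈ G.copy π) : ∃ v w, x = π v ∧ y = π w ∧ G.graph.Adj v w := by
  obtain ⟨e, he, hexy⟩ := Finset.mem_image.mp h
  induction e using Sym2.ind with
  | _ v w =>
    have hadj : G.graph.Adj v w := mem_edges.mp he
    rcases Sym2.eq_iff.mp hexy with ⟨h1, h2⟩ | ⟨h1, h2⟩
    · exact ⟨v, w, h1.symm, h2.symm, hadj⟩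
    · exact ⟨w, v, h2.symm, h1.symm, hadj.symm⟩

lemma not_isDiag_of_mem_copy {G : RootedTemplate} {n : ℕ} {π : Fin (G.extra + 2) → Fin n}
    (hπ : Function.Injective π) : ∀ e ∈ G.copy π, ¬e.IsDiag := by
  intro e he
  induction e using Sym2.ind with
  | _ x y =>
    obtain ⟨v, w, rfl, rfl, hadj⟩ := exists_of_mk_mem_copy he
    rw [Sym2.mk_isDiag_iff]
    exact fun h => hadj.ne (hπ h)

lemma copy_nonempty (G : RootedTemplate) {n : ℕ} (π : Fin (G.extra + 2) → Fin n) :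
    (G.copy π).Nonempty := by
  obtain ⟨v, w, h⟩ := G.has_edge
  exact ⟨_, Finset.mem_image_of_mem _ (mem_edges.mpr (show s(v, w) ∈ G.graph.edgeSet from h))⟩

lemma reach_copy_iff {G : RootedTemplate} {n : ℕ} {π : Fin (G.extra + 2) → Fin n}
    (hπ : Function.Injective π) {v w : Fin (G.extra + 2)} :
    Reach (G.copy π) (π v) (π w) ↔ G.graph.Reachable v w := by
  rw [SimpleGraph.reachable_iff_reflTransGen]
  constructor
  · intro h
    have key : ∀ y, Reach (G.copy π) (π v) y →
        ∃ u, y = π u ∧ Relation.ReflTransGen G.graph.Adj v u := by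
      intro y hy
      induction hy with
      | refl => exact ⟨v, rfl, .refl⟩
      | @tail b c _ hbc ih =>
        obtain ⟨u, rfl, hu⟩ := ih
        obtain ⟨a, b', h1, rfl, hadj⟩ := exists_of_mk_mem_copy hbc
        rw [← hπ h1] at hadj
        exact ⟨b', rfl, hu.tail hadj⟩
    obtain ⟨u, h1, hu⟩ := key _ h
    rwa [hπ h1]
  · intro h
    induction h with
    | refl => exact .refl
    | tail _ hbc ih => exact ih.tail ((mk_mem_copy hπ).mpr hbc)

lemma mem_componentEdges {G : RootedTemplate} {c : G.graph.ConnectedComponent}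
    {e : Sym2 (Fin (G.extra + 2))} :
    e ∈ G.componentEdges c ↔ e ∈ G.edges ∧ ∀ v ∈ e, G.graph.connectedComponentMk v = c := by
  simp [componentEdges]

lemma compAt_copy (G : RootedTemplate) {n : ℕ} {π : Fin (G.extra + 2) → Fin n}
    (hπ : Function.Injective π) (v : Fin (G.extra + 2)) :
    compAt (G.copy π) (π v)
      = (G.componentEdges (G.graph.connectedComponentMk v)).image (Sym2.map π) := by
  ext e
  rw [mem_compAt, Finset.mem_image]
  constructor
  · rintro ⟨he, y, hy, hvy⟩
    obtain ⟨e₀, he₀, rfl⟩ := Finset.mem_image.mp he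
    obtain ⟨u, hu, rfl⟩ := Sym2.mem_map.mp hy
    refine ⟨e₀, mem_componentEdges.mpr ⟨he₀, fun w hw => ?_⟩, rfl⟩
    have h1 := (reach_copy_iff hπ).mp hvy
    have h2 : G.graph.Reachable u w := (reach_copy_iff hπ).mp
      (reach_of_mem_mem he hy (Sym2.mem_map.mpr ⟨w, hw, rfl⟩))
    exact SimpleGraph.ConnectedComponent.eq.mpr (h1.trans h2).symm
  · rintro ⟨e₀, he₀, rfl⟩
    obtain ⟨he, hc⟩ := mem_componentEdges.mp he₀
    refine ⟨Finset.mem_image_of_mem _ he, ?_⟩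
    induction e₀ using Sym2.ind with
    | _ a b =>
      refine ⟨π a, by simp, (reach_copy_iff hπ).mpr ?_⟩
      exact (SimpleGraph.ConnectedComponent.eq.mp (hc a (Sym2.mem_mk_left a b))).symm

lemma mem_nontrivialComponents {G : RootedTemplate} {c : G.graph.ConnectedComponent} :
    c ∈ G.nontrivialComponents ↔ c.supp.Nontrivial := by
  simp [nontrivialComponents]

lemma exists_adj_of_nontrivial {G : RootedTemplate} {c : G.graph.ConnectedComponent}
    (hc : c ∈ G.nontrivialComponents) :
    ∃ v w, G.graph.Adj v w ∧ G.graph.connectedComponentMk v = c := by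
  obtain ⟨v, hv, w, hw, hne⟩ := mem_nontrivialComponents.mp hc
  rw [SimpleGraph.ConnectedComponent.mem_supp_iff] at hv hw
  have hr : G.graph.Reachable v w := SimpleGraph.ConnectedComponent.eq.mp (hv.trans hw.symm)
  rw [SimpleGraph.reachable_iff_reflTransGen] at hr
  rcases Relation.ReflTransGen.cases_head hr with h | ⟨u, hvu, -⟩
  · exact absurd h hne
  · exact ⟨v, u, hvu, hv⟩

/-- The components of a copy are the copies of the nontrivial components. -/
lemma comps_copy (G : RootedTemplate) {n : ℕ} {π : Fin (G.extra + 2) → Fin n}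
    (hπ : Function.Injective π) :
    comps (G.copy π)
      = G.nontrivialComponents.image fun c => (G.componentEdges c).image (Sym2.map π) := by
  ext C
  rw [comps, Finset.mem_image, Finset.mem_image]
  constructor
  · rintro ⟨x, hx, rfl⟩
    obtain ⟨e, he, hxe⟩ := mem_verts.mp hx
    obtain ⟨y, rfl⟩ := Sym2.mem_iff_exists.mp hxe
    obtain ⟨v, w, rfl, rfl, hadj⟩ := exists_of_mk_mem_copy he
    refine ⟨G.graph.connectedComponentMk v, mem_nontrivialComponents.mpr ⟨v, ?_, w, ?_, hadj.ne⟩,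
      (compAt_copy G hπ v).symm⟩
    · exact SimpleGraph.ConnectedComponent.mem_supp_iff _ _ |>.mpr rfl
    · exact SimpleGraph.ConnectedComponent.mem_supp_iff _ _ |>.mpr
        (SimpleGraph.ConnectedComponent.eq.mpr hadj.reachable.symm)
  · rintro ⟨c, hc, rfl⟩
    obtain ⟨v, w, hadj, rfl⟩ := exists_adj_of_nontrivial hc
    exact ⟨π v, mem_verts.mpr ⟨s(π v, π w), (mk_mem_copy hπ).mpr hadj, Sym2.mem_mk_left _ _⟩,
      compAt_copy G hπ v⟩

lemma injOn_copy_componentEdges (G : RootedTemplate) {n : ℕ} {π : Fin (G.extra + 2) → Fin n}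
    (hπ : Function.Injective π) :
    Set.InjOn (fun c => (G.componentEdges c).image (Sym2.map π)) G.nontrivialComponents := by
  intro c hc c' _ h
  obtain ⟨v, w, hadj, hv⟩ := exists_adj_of_nontrivial hc
  have h1 : G.componentEdges c = G.componentEdges c' :=
    Finset.image_injective (Sym2.map.injective hπ) h
  have h2 : s(v, w) ∈ G.componentEdges c := by
    refine mem_componentEdges.mpr ⟨mem_edges.mpr hadj, fun u hu => ?_⟩
    rcases Sym2.mem_iff.mp hu with rfl | rfl
    · exact hv
    · rw [← hv]
      exact SimpleGraph.ConnectedComponent.eq.mpr hadj.reachable.symm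
  rw [h1] at h2
  exact hv.symm.trans ((mem_componentEdges.mp h2).2 v (Sym2.mem_mk_left v w))

lemma componentMonomial_eq (G : RootedTemplate) {n : ℕ} {q : ℝ} (hq : 0 < q) (hq1 : q < 1)
    {π : Fin (G.extra + 2) → Fin n} (hπ : Function.Injective π) (c : G.graph.ConnectedComponent)
    (A : SimpleGraph (Fin n)) :
    G.componentMonomial c q π A
      = Real.sqrt (q * (1 - q)) ^ ((G.componentEdges c).image (Sym2.map π)).card
        * normMono q ((G.componentEdges c).image (Sym2.map π)) A := by
  have hs : Real.sqrt (q * (1 - q)) ≠ 0 :=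
    (Real.sqrt_pos.mpr (mul_pos hq (by linarith))).ne'
  rw [normMono, ← Finset.prod_const, ← Finset.prod_mul_distrib,
    Finset.prod_image fun e _ e' _ h => Sym2.map.injective hπ h, componentMonomial]
  refine Finset.prod_congr rfl fun e _ => ?_
  rw [normAdj, mul_div_cancel₀ _ hs]

lemma expect_const_mul (m : Model) (s : Sampling) (n k : ℕ) (lam q a : ℝ)
    (f : SimpleGraph (Fin n) → ℝ) :
    expect m s n k lam q (fun A => a * f A) = a * expect m s n k lam q f := by
  simpa using expect_sum_mul m s n k lam q {()} (fun _ => a) (fun _ => f)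

/-- The corrected monomial of a labelled template depends only on the copy. -/
lemma correctedMonomial_eq (m : Model) (s : Sampling) {n : ℕ} (k : ℕ) {lam q : ℝ} (hq : 0 < q)
    (hq1 : q < 1) (G : RootedTemplate) {π : Fin (G.extra + 2) → Fin n}
    (hπ : Function.Injective π) (A : SimpleGraph (Fin n)) :
    correctedMonomial m s n k lam q G π A
      = Real.sqrt (q * (1 - q)) ^ G.edges.card * centredMono m s n k lam q (G.copy π) A := by
  rw [← card_copy G hπ, ← sum_card_comps, ← Finset.prod_pow_eq_pow_sum, centredMono,
    ← Finset.prod_mul_distrib, comps_copy G hπ, Finset.prod_image (injOn_copy_componentEdges G hπ),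
    correctedMonomial]
  refine Finset.prod_congr rfl fun c _ => ?_
  have h1 : G.componentMonomial c q π = fun A : SimpleGraph (Fin n) =>
      Real.sqrt (q * (1 - q)) ^ ((G.componentEdges c).image (Sym2.map π)).card
        * normMono q ((G.componentEdges c).image (Sym2.map π)) A :=
    funext fun A => componentMonomial_eq G hq hq1 hπ c A
  rw [h1, expect_const_mul]
  exact (mul_sub _ _ _).symm

/-- Two labelled templates with the same copy differ by an isomorphism that fixes the roots. -/
lemma exists_iso_of_copy_eq {G H : RootedTemplate} {n : ℕ} {π : Fin (G.extra + 2) → Fin n}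
    {π' : Fin (H.extra + 2) → Fin n} (hπ : π ∈ G.labelings n) (hπ' : π' ∈ H.labelings n)
    (h : G.copy π = H.copy π') :
    ∃ σ : G.graph ≃g H.graph, (σ 0 = 0 ∧ σ 1 = 1) ∧ ∀ v, π' (σ v) = π v := by
  obtain ⟨hi, h0, h1⟩ := mem_labelings.mp hπ
  obtain ⟨hi', h0', h1'⟩ := mem_labelings.mp hπ'
  have range : ∀ (G H : RootedTemplate) (π : Fin (G.extra + 2) → Fin n)
      (π' : Fin (H.extra + 2) → Fin n), Function.Injective π → (π 0 : ℕ) = 0 → (π 1 : ℕ) = 1 →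
      (π' 0 : ℕ) = 0 → (π' 1 : ℕ) = 1 → G.copy π = H.copy π' → ∀ v, ∃ w, π' w = π v := by
    intro G H π π' hi h0 h1 h0' h1' h v
    by_cases hv0 : v = 0
    · exact ⟨0, Fin.ext (by rw [hv0, h0, h0'])⟩
    by_cases hv1 : v = 1
    · exact ⟨1, Fin.ext (by rw [hv1, h1, h1'])⟩
    obtain ⟨w, hw⟩ := G.not_isolated v hv0 hv1
    have hmem := (mk_mem_copy hi).mpr hw
    rw [h] at hmem
    obtain ⟨a, b, ha, -, -⟩ := exists_of_mk_mem_copy hmem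
    exact ⟨a, ha.symm⟩
  choose f hf using range G H π π' hi h0 h1 h0' h1' h
  choose f' hf' using range H G π' π hi' h0' h1' h0 h1 h.symm
  refine ⟨⟨⟨f, f', fun v => hi (by rw [hf', hf]), fun v => hi' (by rw [hf, hf'])⟩, ?_⟩,
    ⟨hi' ?_, hi' ?_⟩, hf⟩
  · intro v w
    change H.graph.Adj (f v) (f w) ↔ G.graph.Adj v w
    rw [← mk_mem_copy hi', ← mk_mem_copy hi, hf, hf, h]
  · exact (hf 0).trans (Fin.ext (by rw [h0, h0']))
  · exact (hf 1).trans (Fin.ext (by rw [h1, h1']))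

/-- The labelings of a template with a prescribed copy. -/
noncomputable def fiber (G : RootedTemplate) {n : ℕ} (S : Finset (Sym2 (Fin n))) :
    Finset (Fin (G.extra + 2) → Fin n) :=
  (G.labelings n).filter fun π => G.copy π = S

lemma mem_fiber {G : RootedTemplate} {n : ℕ} {S : Finset (Sym2 (Fin n))}
    {π : Fin (G.extra + 2) → Fin n} : π ∈ G.fiber S ↔ π ∈ G.labelings n ∧ G.copy π = S := by
  rw [fiber, Finset.mem_filter]

lemma finite_rootedAut (G : RootedTemplate) :
    Finite {σ : G.graph ≃g G.graph // σ 0 = 0 ∧ σ 1 = 1} :=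
  Finite.of_injective (fun σ v => σ.1 v) fun _ _ h =>
    Subtype.ext (RelIso.ext fun v => congrFun h v)

/-- The labelings with the same copy as a given one are its translates by the automorphisms that
fix the roots. -/
lemma card_fiber_copy (G : RootedTemplate) {n : ℕ} {π : Fin (G.extra + 2) → Fin n}
    (hπ : π ∈ G.labelings n) : (G.fiber (G.copy π)).card = G.autCard := by
  classical
  obtain ⟨hi, h0, h1⟩ := mem_labelings.mp hπ
  have := G.finite_rootedAut
  have := Fintype.ofFinite {σ : G.graph ≃g G.graph // σ 0 = 0 ∧ σ 1 = 1}
  rw [autCard, Nat.card_eq_fintype_card, ← Finset.card_univ]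
  symm
  refine Finset.card_bij (fun σ _ => π ∘ σ.1) ?_ ?_ ?_
  · rintro ⟨σ, hσ0, hσ1⟩ -
    have hinj : Function.Injective (π ∘ σ) := hi.comp σ.injective
    refine mem_fiber.mpr ⟨mem_labelings.mpr ⟨hinj, by simp [hσ0, h0],
      by simp [hσ1, h1]⟩, ?_⟩
    ext e
    induction e using Sym2.ind with
    | _ x y =>
      constructor
      · intro h
        obtain ⟨v, w, rfl, rfl, hadj⟩ := exists_of_mk_mem_copy h
        exact (mk_mem_copy hi).mpr (σ.map_rel_iff.mpr hadj)
      · intro h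
        obtain ⟨v, w, rfl, rfl, hadj⟩ := exists_of_mk_mem_copy h
        have h2 := (mk_mem_copy (π := π ∘ σ) hinj (v := σ.symm v) (w := σ.symm w)).mpr
          (σ.symm.map_rel_iff.mpr hadj)
        simpa using h2
  · rintro ⟨σ, hσ⟩ - ⟨τ, hτ⟩ - h
    refine Subtype.ext (RelIso.ext fun v => hi ?_)
    exact congrFun h v
  · intro π' hπ'
    obtain ⟨hπ', hc⟩ := mem_fiber.mp hπ'
    obtain ⟨σ, hσ, hσπ⟩ := exists_iso_of_copy_eq hπ' hπ hc
    exact ⟨⟨σ, hσ⟩, Finset.mem_univ _, funext hσπ⟩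

lemma sum_card_fiber_sq (G : RootedTemplate) {n : ℕ} (𝒮 : Finset (Finset (Sym2 (Fin n))))
    (h𝒮 : ∀ π ∈ G.labelings n, G.copy π ∈ 𝒮) :
    ∑ S ∈ 𝒮, ((G.fiber S).card : ℝ) ^ 2 = (G.labelings n).card * G.autCard := by
  have h1 : ∀ S ∈ 𝒮, ((G.fiber S).card : ℝ) ^ 2 = ∑ _π ∈ G.fiber S, (G.autCard : ℝ) := by
    intro S _
    rw [Finset.sum_const, nsmul_eq_mul, sq]
    rcases (G.fiber S).eq_empty_or_nonempty with h | ⟨π, hπ⟩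
    · simp [h]
    · have hS := (mem_fiber.mp hπ).2
      rw [← hS, card_fiber_copy G (mem_fiber.mp hπ).1]
  rw [Finset.sum_congr rfl h1]
  have h2 := Finset.sum_fiberwise_of_maps_to (s := G.labelings n) (t := 𝒮) (g := G.copy) h𝒮
    fun _ => (G.autCard : ℝ)
  rw [Finset.sum_const, nsmul_eq_mul] at h2
  exact h2

lemma autCard_pos (G : RootedTemplate) : 0 < G.autCard := by
  have : Nonempty {σ : G.graph ≃g G.graph // σ 0 = 0 ∧ σ 1 = 1} := ⟨⟨RelIso.refl _, rfl, rfl⟩⟩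
  have := G.finite_rootedAut
  exact Nat.card_pos

lemma numVertices_le (G : RootedTemplate) : G.numVertices ≤ 2 * G.edges.card + 2 := by
  have h1 : (Finset.univ : Finset (Fin (G.extra + 2))) ⊆ verts G.edges ∪ {0, 1} := by
    intro v _
    by_cases hv0 : v = 0
    · simp [hv0]
    by_cases hv1 : v = 1
    · simp [hv1]
    obtain ⟨w, hw⟩ := G.not_isolated v hv0 hv1
    exact Finset.mem_union_left _ (mem_verts.mpr
      ⟨s(v, w), mem_edges.mpr hw, Sym2.mem_mk_left v w⟩)
  have h2 := (Finset.card_le_card h1).trans (Finset.card_union_le _ _)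
  rw [Finset.card_univ, Fintype.card_fin] at h2
  have h3 := card_verts_le G.edges
  have h4 : ({0, 1} : Finset (Fin (G.extra + 2))).card ≤ 2 := Finset.card_le_two
  rw [numVertices]
  omega

lemma card_labelings (G : RootedTemplate) {n : ℕ} (hn : G.numVertices ≤ n) :
    ((G.labelings n).card : ℝ) = ((n - 2).factorial : ℝ) / ((n - G.numVertices).factorial : ℝ) := by
  classical
  rw [numVertices] at hn
  have h1 : (G.labelings n).card = Fintype.card (Fin G.extra ↪ {x : Fin n // 2 ≤ (x : ℕ)}) := by
    rw [← Finset.card_univ]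
    refine Finset.card_bij (fun π hπ => ⟨fun i => ⟨π i.succ.succ, ?_⟩, ?_⟩) ?_ ?_ ?_
    · obtain ⟨hi, h0, h1⟩ := mem_labelings.mp hπ
      have h2 : (π i.succ.succ : ℕ) ≠ 0 := fun h => by
        have := hi (Fin.ext (h.trans h0.symm))
        exact Fin.succ_ne_zero _ this
      have h3 : (π i.succ.succ : ℕ) ≠ 1 := fun h => by
        have := hi (Fin.ext (h.trans h1.symm))
        exact Fin.succ_ne_zero _ (Fin.succ_injective _ (this.trans Fin.succ_zero_eq_one.symm))
      omega
    · intro i j hij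
      have := (mem_labelings.mp hπ).1 (Subtype.ext_iff.mp hij)
      exact Fin.succ_injective _ (Fin.succ_injective _ this)
    · exact fun _ _ => Finset.mem_univ _
    · intro π hπ π' hπ' h
      obtain ⟨-, h0, h1⟩ := mem_labelings.mp hπ
      obtain ⟨-, h0', h1'⟩ := mem_labelings.mp hπ'
      ext v
      refine Fin.cases ?_ (fun v => Fin.cases ?_ (fun i => ?_) v) v
      · rw [h0, h0']
      · rw [Fin.succ_zero_eq_one, h1, h1']
      · have := DFunLike.congr_fun h i
        exact congrArg (fun x : {x : Fin n // 2 ≤ (x : ℕ)} => ((x : Fin n) : ℕ)) this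
    · intro f _
      let π : Fin (G.extra + 2) → Fin n :=
        Fin.cons ⟨0, by omega⟩ (Fin.cons ⟨1, by omega⟩ fun i => (f i).1)
      have e0 : π 0 = ⟨0, by omega⟩ := rfl
      have e1 : π 1 = ⟨1, by omega⟩ := rfl
      have e2 : ∀ i : Fin G.extra, π i.succ.succ = (f i).1 := fun i => rfl
      refine ⟨π, mem_labelings.mpr ⟨?_, by rw [e0], by rw [e1]⟩, ?_⟩
      · intro v w
        refine Fin.cases ?_ (fun v => Fin.cases ?_ (fun i => ?_) v) v <;>
        refine Fin.cases ?_ (fun w => Fin.cases ?_ (fun j => ?_) w) w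
        · exact fun _ => rfl
        · intro h
          exact absurd (Fin.ext_iff.mp h) (by rw [Fin.succ_zero_eq_one, e0, e1]; norm_num)
        · intro h
          have := (f j).2
          rw [e0, e2] at h
          rw [← h] at this
          norm_num at this
        · intro h
          exact absurd (Fin.ext_iff.mp h) (by rw [Fin.succ_zero_eq_one, e0, e1]; norm_num)
        · exact fun _ => rfl
        · intro h
          have := (f j).2
          rw [Fin.succ_zero_eq_one, e1, e2] at h
          rw [← h] at this
          norm_num at this
        · intro h
          have := (f i).2
          rw [e0, e2] at h
          rw [h] at this
          norm_num at this
        · intro h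
          have := (f i).2
          rw [Fin.succ_zero_eq_one, e1, e2] at h
          rw [h] at this
          norm_num at this
        · intro h
          rw [e2, e2] at h
          rw [f.injective (Subtype.ext h)]
      · ext i
        rfl
  have h2 : Fintype.card {x : Fin n // 2 ≤ (x : ℕ)} = n - 2 := by
    rw [Fintype.card_subtype]
    have h3 : (Finset.univ.filter fun x : Fin n => 2 ≤ (x : ℕ))
        = Finset.univ \ {⟨0, by omega⟩, ⟨1, by omega⟩} := by
      ext x
      simp only [Finset.mem_filter, Finset.mem_univ, true_and, Finset.mem_sdiff,
        Finset.mem_insert, Finset.mem_singleton, Fin.ext_iff]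
      omega
    rw [h3, Finset.card_sdiff_of_subset (Finset.subset_univ _), Finset.card_univ,
      Fintype.card_fin, Finset.card_pair (by simp)]
  rw [h1, Fintype.card_embedding_eq, h2, Fintype.card_fin, numVertices, eq_div_iff (by positivity)]
  have h3 := Nat.factorial_mul_descFactorial (n := n - 2) (k := G.extra) (by omega)
  rw [show n - (G.extra + 2) = n - 2 - G.extra by omega, mul_comm]
  exact_mod_cast h3

end RootedTemplate

/-! ### From templates to labelled edge sets -/

lemma centredMono_empty (m : Model) (s : Sampling) (n k : ℕ) (lam q : ℝ)
    (A : SimpleGraph (Fin n)) : centredMono m s n k lam q ∅ A = 1 := by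
  have h : comps (∅ : Finset (Sym2 (Fin n))) = ∅ := by simp [comps, verts]
  rw [centredMono, h, Finset.prod_empty]

lemma sq_sum_of_pairwise_mul_eq_zero {ι : Type*} (J : Finset ι) (x : ι → ℝ)
    (hx : ∀ i ∈ J, ∀ j ∈ J, i ≠ j → x i * x j = 0) : (∑ i ∈ J, x i) ^ 2 = ∑ i ∈ J, x i ^ 2 := by
  classical
  rw [sq, Finset.sum_mul_sum]
  refine Finset.sum_congr rfl fun i hi => ?_
  rw [Finset.sum_eq_single_of_mem i hi fun j hj hji => hx i hi j hj hji.symm, sq]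

namespace RootedTemplate

lemma copy_mem_edgeSets {G : RootedTemplate} {n D : ℕ} (hG : G.edges.card ≤ D)
    {π : Fin (G.extra + 2) → Fin n} (hπ : π ∈ G.labelings n) : G.copy π ∈ edgeSets n D := by
  have hi := (mem_labelings.mp hπ).1
  exact mem_edgeSets.mpr ⟨(card_copy G hi).trans_le hG, not_isDiag_of_mem_copy hi⟩

lemma fiber_empty (G : RootedTemplate) (n : ℕ) :
    G.fiber (∅ : Finset (Sym2 (Fin n))) = ∅ := by
  refine Finset.eq_empty_of_forall_notMem fun π hπ => ?_
  have := G.copy_nonempty π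
  rw [(mem_fiber.mp hπ).2] at this
  exact Finset.not_nonempty_empty this

/-- The coefficient, in `Ψ_G`, of the centred monomial of one labeling. -/
noncomputable def copyWeight (n : ℕ) (q : ℝ) (G : RootedTemplate) : ℝ :=
  Real.sqrt (q * (1 - q)) ^ G.edges.card / Real.sqrt (varianceProxy n q G)

lemma copyWeight_sq_mul {n : ℕ} {q : ℝ} (hq : 0 < q) (hq1 : q < 1) (G : RootedTemplate)
    (hn : G.numVertices ≤ n) :
    copyWeight n q G ^ 2 * ((G.labelings n).card * G.autCard) = 1 := by
  have hqq : 0 < q * (1 - q) := mul_pos hq (by linarith)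
  have h1 : varianceProxy n q G
      = (G.labelings n).card * G.autCard * (q * (1 - q)) ^ G.edges.card := by
    rw [varianceProxy, card_labelings G hn]
  have ha : (0 : ℝ) < G.autCard := by exact_mod_cast G.autCard_pos
  have hl : (0 : ℝ) < (G.labelings n).card := by
    rw [card_labelings G hn]
    positivity
  have hV : 0 < varianceProxy n q G := by
    rw [h1]
    positivity
  rw [copyWeight, div_pow, Real.sq_sqrt hV.le, ← pow_mul, mul_comm _ 2, pow_mul,
    Real.sq_sqrt hqq.le, h1]
  field_simp

lemma Psi_eq_sum_fiber (m : Model) (s : Sampling) {n : ℕ} (k : ℕ) {lam q : ℝ} (hq : 0 < q)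
    (hq1 : q < 1) (G : RootedTemplate) {D : ℕ} (hG : G.edges.card ≤ D)
    (A : SimpleGraph (Fin n)) :
    G.Psi m s n k lam q A
      = ∑ S ∈ edgeSets n D,
        copyWeight n q G * (G.fiber S).card * centredMono m s n k lam q S A := by
  have h1 : ∑ π ∈ G.labelings n, correctedMonomial m s n k lam q G π A
      = ∑ π ∈ G.labelings n,
        Real.sqrt (q * (1 - q)) ^ G.edges.card * centredMono m s n k lam q (G.copy π) A :=
    Finset.sum_congr rfl fun π hπ =>
      correctedMonomial_eq m s k hq hq1 G (mem_labelings.mp hπ).1 A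
  rw [Psi, h1, ← Finset.sum_fiberwise_of_maps_to
    (fun π hπ => copy_mem_edgeSets hG hπ), Finset.sum_div]
  refine Finset.sum_congr rfl fun S _ => ?_
  have h2 : ∀ π ∈ (G.labelings n).filter (fun π => G.copy π = S),
      Real.sqrt (q * (1 - q)) ^ G.edges.card * centredMono m s n k lam q (G.copy π) A
        = Real.sqrt (q * (1 - q)) ^ G.edges.card * centredMono m s n k lam q S A := by
    intro π hπ
    rw [(Finset.mem_filter.mp hπ).2]
  rw [Finset.sum_congr rfl h2, Finset.sum_const, nsmul_eq_mul, copyWeight, fiber]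
  ring

/-- Non-equivalent templates have no copy in common. -/
lemma card_fiber_mul_card_fiber {G H : RootedTemplate} (h : ¬G.Equivalent H) {n : ℕ}
    (S : Finset (Sym2 (Fin n))) : ((G.fiber S).card : ℝ) * (H.fiber S).card = 0 := by
  rcases (G.fiber S).eq_empty_or_nonempty with hG | ⟨π, hπ⟩
  · simp [hG]
  rcases (H.fiber S).eq_empty_or_nonempty with hH | ⟨π', hπ'⟩
  · simp [hH]
  rw [mem_fiber] at hπ hπ'
  obtain ⟨σ, hσ, -⟩ := exists_iso_of_copy_eq hπ.1 hπ'.1 (hπ.2.trans hπ'.2.symm)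
  exact absurd ⟨σ, hσ⟩ h

end RootedTemplate

open Classical in
/-- The coefficients, in the centred monomials of labelled edge sets, of the combination of the
rooted polynomials `Ψ_G` with coefficients `α` and of the constant `α₀`. -/
noncomputable def labelledCoeff (n : ℕ) (q : ℝ) (𝒢 : Finset RootedTemplate) (α₀ : ℝ)
    (α : 𝒢 → ℝ) (S : Finset (Sym2 (Fin n))) : ℝ :=
  (if S = ∅ then α₀ else 0) + ∑ G : 𝒢, α G * (G.1.copyWeight n q * (G.1.fiber S).card)

lemma empty_mem_edgeSets (n D : ℕ) : ∅ ∈ edgeSets n D :=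
  mem_edgeSets.mpr ⟨by simp, by simp⟩

lemma add_sum_Psi_eq (m : Model) (s : Sampling) {n : ℕ} (k : ℕ) {lam q : ℝ} (hq : 0 < q)
    (hq1 : q < 1) {D : ℕ} {𝒢 : Finset RootedTemplate} (h𝒢 : ∀ G ∈ 𝒢, G.edges.card ≤ D)
    (α₀ : ℝ) (α : 𝒢 → ℝ) (A : SimpleGraph (Fin n)) :
    α₀ + ∑ G : 𝒢, α G * G.1.Psi m s n k lam q A
      = ∑ S ∈ edgeSets n D, labelledCoeff n q 𝒢 α₀ α S * centredMono m s n k lam q S A := by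
  classical
  simp only [labelledCoeff, add_mul, Finset.sum_add_distrib, Finset.sum_mul]
  rw [Finset.sum_comm]
  congr 1
  · rw [Finset.sum_eq_single_of_mem ∅ (empty_mem_edgeSets n D)
      fun S _ hS => by rw [if_neg hS, zero_mul], if_pos rfl, centredMono_empty, mul_one]
  · refine Finset.sum_congr rfl fun G _ => ?_
    rw [RootedTemplate.Psi_eq_sum_fiber m s k hq hq1 G.1 (h𝒢 G.1 G.2) A, Finset.mul_sum]
    exact Finset.sum_congr rfl fun S _ => by ring

/-- Passing from templates to labelled edge sets preserves the norm of the coefficients. -/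
lemma sum_labelledCoeff_sq {n : ℕ} {q : ℝ} (hq : 0 < q) (hq1 : q < 1) {D : ℕ}
    {𝒢 : Finset RootedTemplate} (h𝒢 : IsMaximumCollection D 𝒢) (hn : 2 * D + 2 ≤ n) (α₀ : ℝ)
    (α : 𝒢 → ℝ) :
    ∑ S ∈ edgeSets n D, labelledCoeff n q 𝒢 α₀ α S ^ 2 = α₀ ^ 2 + ∑ G : 𝒢, α G ^ 2 := by
  classical
  have h1 : ∀ S ∈ edgeSets n D, labelledCoeff n q 𝒢 α₀ α S ^ 2
      = (if S = ∅ then α₀ ^ 2 else 0)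
        + ∑ G : 𝒢, (α G ^ 2 * G.1.copyWeight n q ^ 2) * ((G.1.fiber S).card : ℝ) ^ 2 := by
    intro S _
    rw [labelledCoeff]
    by_cases hS : S = ∅
    · simp [hS, RootedTemplate.fiber_empty]
    rw [if_neg hS, if_neg hS, zero_add, zero_add, sq_sum_of_pairwise_mul_eq_zero]
    · exact Finset.sum_congr rfl fun G _ => by ring
    · intro G _ H _ hGH
      have := RootedTemplate.card_fiber_mul_card_fiber
        (fun h => hGH (Subtype.ext (h𝒢.eq_of_equivalent G.1 G.2 H.1 H.2 h))) S
      linear_combination (α G * G.1.copyWeight n q * (α H * H.1.copyWeight n q)) * this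
  rw [Finset.sum_congr rfl h1, Finset.sum_add_distrib, Finset.sum_comm]
  congr 1
  · rw [Finset.sum_eq_single_of_mem ∅ (empty_mem_edgeSets n D)
      fun S _ hS => if_neg hS, if_pos rfl]
  · refine Finset.sum_congr rfl fun G _ => ?_
    have hGD := h𝒢.edges_le G.1 G.2
    have hGn : G.1.numVertices ≤ n := by
      have := G.1.numVertices_le
      omega
    rw [← Finset.mul_sum, RootedTemplate.sum_card_fiber_sq G.1 _
      fun π hπ => RootedTemplate.copy_mem_edgeSets hGD hπ, mul_assoc,
      RootedTemplate.copyWeight_sq_mul hq hq1 G.1 hGn, mul_one]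

/-! ### The parameter regime -/

/-- In all three structures linked labels are at distance at most `k`. -/
lemma Model.Linked.abs_sub_le {m : Model} {n k : ℕ} (hk : 1 ≤ k) {i j : Fin n}
    (h : m.Linked k i j) : (i : ℕ) ≤ j + k ∧ (j : ℕ) ≤ i + k := by
  cases m with
  | HS =>
    obtain ⟨h1, h2⟩ := h
    omega
  | SBM =>
    have hk' : (0 : ℝ) < k := by exact_mod_cast hk
    have key : ∀ a b : ℕ, ⌈((a + 1 : ℕ) : ℝ) / (k : ℝ)⌉ = ⌈((b + 1 : ℕ) : ℝ) / (k : ℝ)⌉ →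
        a ≤ b + k := by
      intro a b hab
      have h1 := Int.le_ceil (((a + 1 : ℕ) : ℝ) / (k : ℝ))
      have h2 := Int.ceil_lt_add_one (((b + 1 : ℕ) : ℝ) / (k : ℝ))
      rw [hab] at h1
      have h3 : ((a + 1 : ℕ) : ℝ) < (((b + 1 : ℕ) : ℝ) / k + 1) * k :=
        (div_lt_iff₀ hk').mp (h1.trans_lt h2)
      rw [add_mul, div_mul_cancel₀ _ hk'.ne', one_mul] at h3
      have h4 : a + 1 < b + 1 + k := by exact_mod_cast h3
      omega
    exact ⟨key _ _ h, key _ _ h.symm⟩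
  | TS =>
    have h0 : |((i : ℕ) : ℝ) - ((j : ℕ) : ℝ)| ≤ (k : ℝ) / 2 := h
    obtain ⟨h1, h2⟩ := abs_le.mp h0
    have hk' : (0 : ℝ) ≤ k := Nat.cast_nonneg k
    constructor
    · have : ((i : ℕ) : ℝ) ≤ (j : ℕ) + k := by linarith
      exact_mod_cast this
    · have : ((j : ℕ) : ℝ) ≤ (i : ℕ) + k := by linarith
      exact_mod_cast this

lemma Model.card_linked_le (m : Model) {n k : ℕ} (hk : 1 ≤ k) (a : Fin n) :
    ((Finset.univ.filter fun b => s(a, b) ∈ m.linkedPairs n k).card : ℝ) ≤ 3 * k := by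
  have h1 : (Finset.univ.filter fun b => s(a, b) ∈ m.linkedPairs n k).card
      ≤ (Finset.Icc ((a : ℕ) - k) (a + k)).card := by
    refine Finset.card_le_card_of_injOn (fun b => (b : ℕ)) ?_ fun b _ b' _ h => Fin.ext h
    intro b hb
    have h2 := (Model.mem_linkedPairs.mp (Finset.mem_filter.mp hb).2).abs_sub_le hk
    refine Finset.mem_coe.mpr (Finset.mem_Icc.mpr ⟨?_, ?_⟩)
    · exact Nat.sub_le_iff_le_add.mpr h2.1
    · exact h2.2
  rw [Nat.card_Icc] at h1
  have h2 : (Finset.univ.filter fun b => s(a, b) ∈ m.linkedPairs n k).card ≤ 3 * k := by omega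
  exact_mod_cast h2

/-- The three quantities of the signal-to-noise condition control the signal, the excess and the
cost of attaching a node. -/
lemma regime_of_le (m : Model) {n k : ℕ} {lam q B δ : ℝ} (hk : 1 ≤ k) (hkn : k ≤ n) (hq : 0 < q)
    (hq2 : q ≤ 1 / 2) (hlam : 0 ≤ lam) (h2 : lam * k / Real.sqrt (n * q) ≤ B)
    (h3 : lam / q ≤ B) (hB : 6 * B ≤ δ) :
    Regime n (m.linkedPairs n k) (signal lam q) (excess lam q) (3 * k) (1 / Real.sqrt n) δ := by
  have hn : 0 < n := by omega
  have hn' : (1 : ℝ) ≤ n := by exact_mod_cast hn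
  have hqq : 0 < q * (1 - q) := mul_pos hq (by linarith)
  have hB0 : 0 ≤ B := (div_nonneg hlam hq.le).trans h3
  have hs : q ≤ Real.sqrt (q * (1 - q)) := Real.le_sqrt_of_sq_le (by nlinarith)
  have hs0 : 0 < Real.sqrt (q * (1 - q)) := Real.sqrt_pos.mpr hqq
  refine ⟨hn, m.card_linked_le hk, by rw [signal]; positivity, ?_, by positivity, ?_, ?_, ?_, ?_,
    ?_⟩
  · exact div_nonneg (mul_nonneg hlam (by linarith)) hqq.le
  · rw [div_pow, one_pow, Real.sq_sqrt (by linarith)]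
  · have : signal lam q ≤ lam / q := div_le_div_of_nonneg_left hlam hq hs
    linarith
  · have : excess lam q ≤ 2 * (lam / q) := by
      rw [excess, div_le_iff₀ hqq]
      have : 2 * (lam / q) * (q * (1 - q)) = lam * (2 * (1 - q)) := by
        field_simp
      rw [this]
      exact mul_le_mul_of_nonneg_left (by linarith) hlam
    linarith
  · have h4 : Real.sqrt (n * q) / 2 ≤ Real.sqrt (q * (1 - q)) * Real.sqrt n := by
      rw [← Real.sqrt_mul hqq.le]
      refine Real.le_sqrt_of_sq_le ?_
      rw [div_pow, Real.sq_sqrt (by positivity)]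
      have : 0 < n * q := by positivity
      nlinarith
    have h5 : 0 < Real.sqrt (n * q) := Real.sqrt_pos.mpr (by positivity)
    calc signal lam q * (3 * k) * (1 / Real.sqrt n)
        = 3 * (lam * k) / (Real.sqrt (q * (1 - q)) * Real.sqrt n) := by
          rw [signal]
          field_simp
      _ ≤ 3 * (lam * k) / (Real.sqrt (n * q) / 2) :=
          div_le_div_of_nonneg_left (by positivity) (by positivity) h4
      _ = 6 * (lam * k / Real.sqrt (n * q)) := by
          rw [div_div_eq_mul_div, mul_div_assoc']
          ring
      _ ≤ δ := by linarith
  · rw [div_le_one (by positivity)]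
    exact Real.one_le_sqrt.mpr hn'

end LatentGraph

theorem mainTheorem4 :
    ∃ c₀ : ℝ, 0 < c₀ ∧ ∃ c : ℝ, 0 < c ∧
      ∀ (D : ℕ), 2 ≤ D →
      ∀ (m : LatentGraph.Model) (s : LatentGraph.Sampling) (n k : ℕ) (lam q : ℝ),
        1 ≤ k → k ≤ n → m.Admissible n k →
        0 < q → q ≤ 1 / 2 → 0 ≤ lam → lam ≤ 1 - q →
        max (max ((k : ℝ) / (n : ℝ)) (lam * (k : ℝ) / Real.sqrt ((n : ℝ) * q))) (lam / q)
          ≤ (D : ℝ) ^ (-c₀) →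
      ∀ 𝒢 : Finset LatentGraph.RootedTemplate, LatentGraph.IsMaximumCollection D 𝒢 →
      ∀ (α₀ : ℝ) (α : 𝒢 → ℝ),
        (1 - c / (D : ℝ) ^ 2) * (α₀ ^ 2 + ∑ G : 𝒢, α G ^ 2)
            ≤ LatentGraph.expect m s n k lam q
                (fun A => (α₀ + ∑ G : 𝒢, α G * G.1.Psi m s n k lam q A) ^ 2) ∧
          LatentGraph.expect m s n k lam q
                (fun A => (α₀ + ∑ G : 𝒢, α G * G.1.Psi m s n k lam q A) ^ 2)
            ≤ (1 + c / (D : ℝ) ^ 2) * (α₀ ^ 2 + ∑ G : 𝒢, α G ^ 2) := by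
  -- With `u = 1 / D` and `t = u ^ 20`, the Gram matrix is controlled by `δ = t ^ 2 = u ^ 40`; the
  -- exponent `45` leaves `u ^ 5 ≤ 1 / 32` to absorb the constant of `regime_of_le`.
  refine ⟨45, by norm_num, 2000, by norm_num, ?_⟩
  intro D hD m s n k lam q hk hkn _ hq hq2 hlam _ hmax 𝒢 h𝒢 α₀ α
  rw [Real.rpow_neg (Nat.cast_nonneg D), show (45 : ℝ) = ((45 : ℕ) : ℝ) by norm_num,
    Real.rpow_natCast, ← inv_pow] at hmax
  obtain ⟨h12, h3⟩ := max_le_iff.mp hmax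
  obtain ⟨h1, h2⟩ := max_le_iff.mp h12
  have hq1 : q < 1 := by linarith
  have hD' : (2 : ℝ) ≤ D := by exact_mod_cast hD
  have hn : (0 : ℝ) < n := by exact_mod_cast (by omega : 0 < n)
  set u : ℝ := (D : ℝ)⁻¹ with hu
  have hu0 : 0 < u := inv_pos.mpr (by linarith)
  have huD : (D : ℝ) * u = 1 := mul_inv_cancel₀ (by linarith)
  have hu2 : u ≤ 1 / 2 := by
    rw [hu, one_div]
    exact inv_anti₀ (by norm_num) hD'
  have hu1 : u ≤ 1 := by linarith
  have hpow : ∀ a, u ^ a ≤ (1 / 2) ^ a := fun a => pow_le_pow_left₀ hu0.le hu2 a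
  have hB : 6 * u ^ 45 ≤ (u ^ 20) ^ 2 := by
    have h5 := hpow 5
    have h40 : 0 < u ^ 40 := by positivity
    calc 6 * u ^ 45 = 6 * u ^ 5 * u ^ 40 := by ring
      _ ≤ 1 * u ^ 40 := mul_le_mul_of_nonneg_right (by norm_num at h5 ⊢; linarith) h40.le
      _ = _ := by ring
  have hR := LatentGraph.regime_of_le m hk hkn hq hq2 hlam h2 h3 hB
  have hinv : 1 / (n : ℝ) ≤ u ^ 45 :=
    (div_le_div_of_nonneg_right (by exact_mod_cast hk) hn.le).trans h1
  have hρt : 1 / Real.sqrt n ≤ u ^ 20 := by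
    refine le_of_sq_le_sq ?_ (by positivity)
    rw [hR.rho_sq, ← pow_mul]
    exact hinv.trans (pow_le_pow_of_le_one hu0.le hu1 (by norm_num))
  have hDt : ∀ a : ℝ, 0 ≤ a → a * (D : ℝ) ^ 2 * u ^ 20 ≤ a / 2 ^ 16 * u ^ 2 := by
    intro a ha
    have h16 := hpow 16
    have h5 : a * (D : ℝ) ^ 2 * u ^ 20 = a * u ^ 16 * u ^ 2 * ((D : ℝ) * u) ^ 2 := by ring
    rw [h5, huD, one_pow, mul_one]
    refine mul_le_mul_of_nonneg_right ?_ (by positivity)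
    rw [div_eq_mul_inv, ← inv_pow, ← one_div]
    exact mul_le_mul_of_nonneg_left h16 ha
  have hu22 : u ^ 2 ≤ 1 := pow_le_one₀ hu0.le hu1
  have hnD : 2 * D + 2 ≤ n := by
    have h6 : (D : ℝ) ^ 2 * 2 ≤ n := by
      rw [div_le_iff₀ hn] at hinv
      have h43 := hpow 43
      have h7 : u ^ 45 * n ≤ 1 / 2 * u ^ 2 * n := by
        refine mul_le_mul_of_nonneg_right ?_ hn.le
        calc u ^ 45 = u ^ 43 * u ^ 2 := by ring
          _ ≤ 1 / 2 * u ^ 2 := mul_le_mul_of_nonneg_right (by norm_num at h43 ⊢; linarith)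
            (by positivity)
      have h8 : (D : ℝ) ^ 2 * 2 * 1 ≤ (D : ℝ) ^ 2 * 2 * (1 / 2 * u ^ 2 * n) :=
        mul_le_mul_of_nonneg_left (hinv.trans h7) (by positivity)
      have h9 : (D : ℝ) ^ 2 * 2 * (1 / 2 * u ^ 2 * n) = ((D : ℝ) * u) ^ 2 * n := by ring
      rw [h9, huD] at h8
      linarith
    have h7 : D ^ 2 * 2 ≤ n := by exact_mod_cast h6
    nlinarith
  have hmain := LatentGraph.abs_expect_sq_sub_le m s hq hq1 hR (by positivity)
    (pow_le_one₀ hu0.le hu1) hρt (by omega : 1 ≤ D)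
    ((hDt 128 (by norm_num)).trans (by norm_num; linarith))
    (LatentGraph.labelledCoeff n q 𝒢 α₀ α)
  simp only [← LatentGraph.add_sum_Psi_eq m s k hq hq1 h𝒢.edges_le α₀ α] at hmain
  rw [LatentGraph.sum_labelledCoeff_sq hq hq1 h𝒢 hnD] at hmain
  have hN : 0 ≤ α₀ ^ 2 + ∑ G : 𝒢, α G ^ 2 := by positivity
  have hc : u ^ 20 + 1024 * (D : ℝ) ^ 2 * u ^ 20 ≤ 2000 / (D : ℝ) ^ 2 := by
    have h6 := hDt 1024 (by norm_num)
    have h7 : u ^ 20 ≤ u ^ 2 := pow_le_pow_of_le_one hu0.le hu1 (by norm_num)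
    have h8 : 2000 / (D : ℝ) ^ 2 = 2000 * u ^ 2 := by rw [hu, inv_pow, div_eq_mul_inv]
    have h9 : 0 < u ^ 2 := by positivity
    rw [h8]
    norm_num at h6
    linarith
  obtain ⟨h4, h5⟩ := abs_le.mp (hmain.trans (mul_le_mul_of_nonneg_right hc hN))
  constructor
  · linarith
  · linarith
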